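/- **Setting.** Let $(\mathcal V,E)$ be a finite simple bipartite graph (for instance the chain $\{-\ell+1,\dots,\ell\}$ with nearest-neighbour edges), and let $\beta>0$. For $n=2S+1\ge 2$ let $|\alpha\rangle$, $\alpha=-S,\dots,S$, be the standard basis of $\mathbb C^n$, with spin operators $S^{(1)},S^{(2)},S^{(3)}$, $S^{(3)}|\alpha\rangle=\alpha|\alpha\rangle$, $(S^{(1)}+iS^{(2)})|\alpha\rangle=\sqrt{S(S+1)-\alpha(\alpha+1)}\,|\alpha+1\rangle$. On $\mathbb C^n\otimes\mathbb C^n$ let $T$ be the transposition, $Q$ the orthogonal projection onto $\psi=n^{-1/2}\sum_\alpha|\alpha,\alpha\rangle$; let $V|\alpha\rangle=(-1)^{S-\alpha}|-\alpha\rangle$ and $\tilde T=(1\otimes V)T(1\otimes V^*)$. On $(\mathbb C^n)^{\otimes\mathcal V}$ put, for $u,v\in\mathbb R$, $H'=\sum_{xy\in E}(u\tilde T_{xy}+vQ_{xy})$. Given a bipartition $\mathcal V=A\sqcup B$, let $\hat S^{(i)}_x=S^{(i)}_x$ for $x\in A$ and $\hat S^{(i)}_x=(V^*S^{(i)}V)_x$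 for $x\in B$; these are the spin operators carried along by the unitary $\prod_{x\in B}V_x$ that transforms $\sum_{xy\in E}(uT_{xy}+vP_{xy})$ ($P$ the projection onto the singlet $(1\otimes V)\psi$) into $H'$. **Loops.** Let $T_\beta=(-\beta,\beta)_{\rm per}$. A configuration $\omega$ is a finite subset of $E\times T_\beta$ whose points (links) are marked as crosses or double bars; $\#\omega_{\times}$, $\#\omega_{=}$ are the numbers of crosses and double bars. Let $d\rho_u(\omega)=e^{-(1+u)2\beta|E|}u^{\#\omega_\times}\,d^{\otimes\#\omega}x$, that is, $$\int F\,d\rho_u=e^{-(1+u)2\beta|E|}\sum_{k\ge0}\frac1{k!}\int F(\{l_1,\dots,l_k\})\,u^{\#\text{crosses}}\,dl_1\cdots dl_k ,$$ the integrals being over links (Lebesgue measure on $E\times T_\beta$, summed over the two marks). Loops of $\omega$ are the closed trajectories in $\mathcal V\times T_\beta$ that move at unit speed in time, jump across every link they meet, keep their time direction at crosses and reverse it at double bars, considered up to orientation and parametrization and recorded with the links they traverse; $\mathcal L(\omega)$ is their number. Write $x\overset{+}{\leftrightarrow}y$ (resp. $x\overset{-}{\leftrightarrow}y$) if the trajectory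 leaving $(x,0)$ upwards arrives at $(y,0)$ from below (resp. from above). **Statement.** For each parity of $n$ there is a function $s$ from the set of loops to $\{\pm1\}$ such that for all $n\ge2$ of that parity, all $u,v\in\mathbb R$, all $x,y\in\mathcal V$ and $i=1,2,3$, the integrands below are absolutely integrable and: (a) $\displaystyle \operatorname{Tr}e^{-2\beta H'}=e^{2\beta(1+u)|E|}\int d\rho_u(\omega)\,(-v)^{\#\omega_{=}}\,n^{\mathcal L(\omega)-\#\omega_{=}}\prod_{\text{loops }l\text{ of }\omega}s(l)$; (b) for every bipartition, $$\operatorname{Tr}\hat S^{(i)}_x\hat S^{(i)}_ye^{-2\beta H'}=\tfrac{n^2-1}{12}e^{2\beta(1+u)|E|}\int d\rho_u(\omega)\,(-v)^{\#\omega_{=}}\,n^{\mathcal L(\omega)-\#\omega_{=}}\bigl(1[x\overset{+}{\leftrightarrow}y]-1[x\overset{-}{\leftrightarrow}y]\bigr)\prod_{\text{loops }l\text{ of }\omega}s(l);$$ and $\operatorname{Tr}S^{(i)}_xS^{(i)}_ye^{-2\beta H'}$ is equal to the same right-hand side multiplied by $1$ if $i=2$ or $x,y$ lie in the same part of the bipartition,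 and by $-1$ otherwise. For $v=-1$ the factor $(-v)^{\#\omega_{=}}$ is $1$. For even $n$, $\tilde T=-(V\otimes V)T$. For odd $n$, if $\tilde T$ is replaced by $-(V\otimes V)T$ in $H'$, then (a) and (b) hold with $s(l)=+1$ for all loops. -/

import Mathlib

open MeasureTheory
open scoped Matrix Kronecker

noncomputable section

namespace SpinLoop

/-! ### Single-site and two-site operators

`ℂⁿ` has the basis `|α⟩`, `α = -S, …, S`, with `S = (n - 1) / 2`; the basis vector with index
`j : Fin n` is `|α⟩` with `α = j - S`. -/

/-- The spin value `α = j - S` of the basis vector with index `j`. -/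
def spinValue (n : ℕ) (j : Fin n) : ℝ := (j : ℝ) - ((n : ℝ) - 1) / 2

/-- The raising operator: `S⁺ |α⟩ = √(S(S+1) - α(α+1)) |α+1⟩`. -/
def raising (n : ℕ) : Matrix (Fin n) (Fin n) ℂ := fun i j =>
  if (i : ℕ) = (j : ℕ) + 1 then
    ((Real.sqrt ((((n : ℝ) - 1) / 2) * (((n : ℝ) - 1) / 2 + 1)
      - spinValue n j * (spinValue n j + 1)) : ℝ) : ℂ)
  else 0

/-- The spin operators `S⁽¹⁾, S⁽²⁾, S⁽³⁾` (indexed by `0, 1, 2 : Fin 3`), where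
`S⁽³⁾ |α⟩ = α |α⟩`. -/
def spin (n : ℕ) : Fin 3 → Matrix (Fin n) (Fin n) ℂ :=
  ![(1 / 2 : ℂ) • (raising n + (raising n)ᴴ),
    (1 / (2 * Complex.I) : ℂ) • (raising n - (raising n)ᴴ),
    Matrix.diagonal fun j => ((spinValue n j : ℝ) : ℂ)]

/-- The unitary `V |α⟩ = (-1)^(S-α) |-α⟩`. The index of `|-α⟩` is `S - α`. -/
def flipV (n : ℕ) : Matrix (Fin n) (Fin n) ℂ := fun i j =>
  if i = Fin.rev j then (-1) ^ (i : ℕ) else 0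

/-- The transposition operator `T (φ ⊗ ϕ) = ϕ ⊗ φ`. -/
def transposition (n : ℕ) : Matrix (Fin n × Fin n) (Fin n × Fin n) ℂ := fun a b =>
  if a = b.swap then 1 else 0

/-- The orthogonal projection `Q` onto `ψ = n^(-1/2) ∑ |α, α⟩`. -/
def projQ (n : ℕ) : Matrix (Fin n × Fin n) (Fin n × Fin n) ℂ := fun a b =>
  if a.1 = a.2 ∧ b.1 = b.2 then 1 / (n : ℂ) else 0

/-- The transformed transposition operator `(1 ⊗ V) T (1 ⊗ V*)`. -/
def transformedT (n : ℕ) : Matrix (Fin n × Fin n) (Fin n × Fin n) ℂ :=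
  ((1 : Matrix (Fin n) (Fin n) ℂ) ⊗ₖ flipV n) * transposition n *
    ((1 : Matrix (Fin n) (Fin n) ℂ) ⊗ₖ (flipV n)ᴴ)

/-- The operator `-(V ⊗ V) T`. -/
def minusVVT (n : ℕ) : Matrix (Fin n × Fin n) (Fin n × Fin n) ℂ :=
  -((flipV n ⊗ₖ flipV n) * transposition n)

/-! ### Operators on the full system

The Hilbert space is `(ℂⁿ)^{⊗V}`, with basis indexed by `V → Fin n`. -/

variable {V : Type*} [Fintype V] [DecidableEq V]

/-- The operator acting as `A` on the site `x` and as the identity elsewhere. -/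
def siteOp {n : ℕ} (A : Matrix (Fin n) (Fin n) ℂ) (x : V) :
    Matrix (V → Fin n) (V → Fin n) ℂ := fun σ τ =>
  if ∀ z, z ≠ x → σ z = τ z then A (σ x) (τ x) else 0

/-- For `x ≠ y`, the operator acting as `A` on the sites `x, y` (in this order) and as the identity
elsewhere. -/
def pairOp {n : ℕ} (A : Matrix (Fin n × Fin n) (Fin n × Fin n) ℂ) (x y : V) :
    Matrix (V → Fin n) (V → Fin n) ℂ := fun σ τ =>
  if ∀ z, z ≠ x → z ≠ y → σ z = τ z then A (σ x, σ y) (τ x, τ y) else 0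

/-- The Hamiltonian `∑_{xy ∈ E} (u T̃_{xy} + v Q_{xy})`. The interactions of interest are symmetric
in the two sites; every edge occurs twice in the sum over ordered pairs, whence the factor `1/2`. -/
def hamiltonian (G : SimpleGraph V) [DecidableRel G.Adj] {n : ℕ}
    (Tt : Matrix (Fin n × Fin n) (Fin n × Fin n) ℂ) (u v : ℝ) :
    Matrix (V → Fin n) (V → Fin n) ℂ :=
  (1 / 2 : ℂ) • ∑ x : V, ∑ y : V,
    if G.Adj x y then pairOp ((u : ℂ) • Tt + (v : ℂ) • projQ n) x y else 0

/-- The operator `e^{-2βH}`. -/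
def boltzmann (G : SimpleGraph V) [DecidableRel G.Adj] {n : ℕ}
    (Tt : Matrix (Fin n × Fin n) (Fin n × Fin n) ℂ) (β u v : ℝ) :
    Matrix (V → Fin n) (V → Fin n) ℂ :=
  NormedSpace.exp ((-(2 * β : ℝ) : ℂ) • hamiltonian G Tt u v)

/-- The spin operator at the site `x`, transformed by the unitary that acts as `V` on the
sublattice `c = true` and as the identity on the sublattice `c = false`. -/
def transformedSpin {G : SimpleGraph V} (c : G.Coloring Bool) (n : ℕ) (i : Fin 3) (x : V) :
    Matrix (V → Fin n) (V → Fin n) ℂ :=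
  siteOp (if c x = true then (flipV n)ᴴ * spin n i * flipV n else spin n i) x

/-! ### Link configurations -/

/-- The two marks that a link can carry. -/
inductive Mark
  | cross
  | dbar
  deriving DecidableEq

instance : Fintype Mark := ⟨{Mark.cross, Mark.dbar}, fun m => by cases m <;> simp⟩

instance : MeasurableSpace Mark := ⊤

instance : DiscreteMeasurableSpace Mark := ⟨fun _ => trivial⟩

instance (G : SimpleGraph V) : MeasurableSpace G.edgeSet := ⊤

instance (G : SimpleGraph V) : DiscreteMeasurableSpace G.edgeSet := ⟨fun _ => trivial⟩

/-- A link: a marked point of `E × T_β`, where the time circle `T_β = (-β, β)_per` has length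
`2β`. -/
abbrev Link (G : SimpleGraph V) (β : ℝ) : Type _ := (G.edgeSet × Mark) × AddCircle (2 * β)

/-- A configuration: a finite set of links. -/
abbrev Config (G : SimpleGraph V) (β : ℝ) : Type _ := Finset (Link G β)

/-- The measure on links: Lebesgue measure on `E × T_β`, for each of the two marks. -/
def linkVolume (G : SimpleGraph V) (β : ℝ) [Fact (0 < 2 * β)] : Measure (Link G β) :=
  (Measure.count : Measure (G.edgeSet × Mark)).prod volume

/-- Finite configurations together with an enumeration of their links. -/
abbrev Enumerated (G : SimpleGraph V) (β : ℝ) : Type _ := Σ k : ℕ, (Fin k → Link G β)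

open Classical in
/-- The configuration underlying an enumerated one. -/
def Enumerated.config {G : SimpleGraph V} {β : ℝ} (p : Enumerated G β) : Config G β :=
  Finset.univ.image p.2

/-- The measure `d^{⊗#ω} x` on finite configurations: `∫ F(ω) d^{⊗#ω} x` is
`∑ₖ (1/k!) ∫ F({l₁, …, lₖ}) dl₁ ⋯ dlₖ`. -/
def configMeasure (G : SimpleGraph V) (β : ℝ) [Fact (0 < 2 * β)] : Measure (Enumerated G β) :=
  Measure.sum fun k : ℕ =>
    ((k.factorial : ENNReal)⁻¹) •
      Measure.map (fun p : Fin k → Link G β => (⟨k, p⟩ : Enumerated G β))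
        (Measure.pi fun _ => linkVolume G β)

/-- The number of links with the mark `m`. -/
def numMark {G : SimpleGraph V} {β : ℝ} (m : Mark) (ω : Config G β) : ℕ :=
  (ω.filter fun l => l.1.2 = m).card

/-- The density, with respect to `d^{⊗#ω} x`, of the normalized signed measure `ρ_u`:
`exp (-(1 + u) 2β|E|) u^#crosses`. -/
def rhoDensity {G : SimpleGraph V} {β : ℝ} (u : ℝ) (ω : Config G β) : ℝ :=
  Real.exp (-((1 + u) * (2 * β) * (Nat.card G.edgeSet : ℝ))) * u ^ numMark Mark.cross ω

/-! ### Loops -/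

/-- A travelling particle: its site, its time, and its direction of time (`1` is up, `-1` is down).
The state `(x, t, d)` is to be thought of as being immediately after the time `t` in the
direction `d`. -/
abbrev State (V : Type*) (β : ℝ) : Type _ := V × AddCircle (2 * β) × ℤˣ

/-- The time reached from `t` after travelling for the duration `r` in the direction `d`. -/
def move {β : ℝ} (t : AddCircle (2 * β)) (d : ℤˣ) (r : ℝ) : AddCircle (2 * β) :=
  t + (((((d : ℤ) : ℝ) * r : ℝ)) : AddCircle (2 * β))

/-- Crosses preserve the direction of time, double bars reverse it. -/
def Mark.turn : Mark → ℤˣ → ℤˣ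
  | Mark.cross, d => d
  | Mark.dbar, d => -d

/-- There is a link of `ω` at the space-time point `(x, t)`. -/
def Touched {G : SimpleGraph V} {β : ℝ} (ω : Config G β) (x : V) (t : AddCircle (2 * β)) : Prop :=
  ∃ l ∈ ω, x ∈ (l.1.1 : Sym2 V) ∧ l.2 = t

/-- The motion of a particle: it travels at unit speed along the time axis; when it meets a link it
jumps to the other end of the link, and continues in the same direction if the link is a cross, in
the opposite direction if it is a double bar. -/
inductive Step {G : SimpleGraph V} {β : ℝ} (ω : Config G β) : State V β → State V β → Prop
  | glide (x : V) (t : AddCircle (2 * β)) (d : ℤˣ) (r : ℝ) (hr : 0 ≤ r)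
      (free : ∀ r', 0 < r' → r' ≤ r → ¬ Touched ω x (move t d r')) :
      Step ω (x, t, d) (x, move t d r, d)
  | jump (x y : V) (t : AddCircle (2 * β)) (d : ℤˣ) (r : ℝ) (m : Mark) (hr : 0 < r)
      (free : ∀ r', 0 < r' → r' < r → ¬ Touched ω x (move t d r'))
      (hxy : G.Adj x y)
      (hl : ((⟨s(x, y), G.mem_edgeSet.2 hxy⟩, m), move t d r) ∈ ω) :
      Step ω (x, t, d) (y, move t d r, m.turn d)

/-- Two states lie on the same oriented closed trajectory. -/
def SameTrajectory {G : SimpleGraph V} {β : ℝ} (ω : Config G β) : State V β → State V β → Prop :=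
  Relation.EqvGen (Step ω)

/-- Unoriented trajectories, given by the set of space-time points that they visit (apart from the
end-points of links) and the set of links that they traverse. -/
@[ext] structure Loop (G : SimpleGraph V) (β : ℝ) where
  /-- the points visited -/
  support : Set (V × AddCircle (2 * β))
  /-- the links traversed -/
  links : Set (Link G β)

/-- The loop of `ω` through the state `a`. -/
def loopThrough {G : SimpleGraph V} {β : ℝ} (ω : Config G β) (a : State V β) : Loop G β where
  support := {p | ¬ Touched ω p.1 p.2 ∧ ∃ d : ℤˣ, SameTrajectory ω a (p.1, p.2, d)}
  links := {l | l ∈ ω ∧ ∃ y ∈ (l.1.1 : Sym2 V), ∃ d : ℤˣ, SameTrajectory ω a (y, l.2, d)}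

/-- The set of loops of a configuration. -/
def loops {G : SimpleGraph V} {β : ℝ} (ω : Config G β) : Set (Loop G β) :=
  Set.range (loopThrough ω)

/-- The number `𝓛(ω)` of loops. -/
def numLoops {G : SimpleGraph V} {β : ℝ} (ω : Config G β) : ℕ := (loops ω).ncard

/-- `x ↔⁺ y`: the top of `(x, 0)` is connected to the bottom of `(y, 0)`, that is, the trajectory
leaving `(x, 0)` upwards arrives at `(y, 0)` from below. -/
def ConnPlus {G : SimpleGraph V} {β : ℝ} (ω : Config G β) (x y : V) : Prop :=
  SameTrajectory ω (x, 0, 1) (y, 0, 1)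

/-- `x ↔⁻ y`: the top of `(x, 0)` is connected to the top of `(y, 0)`, that is, the trajectory
leaving `(x, 0)` upwards arrives at `(y, 0)` from above. -/
def ConnMinus {G : SimpleGraph V} {β : ℝ} (ω : Config G β) (x y : V) : Prop :=
  SameTrajectory ω (x, 0, 1) (y, 0, -1)

open Classical in
/-- `1[x ↔⁺ y] - 1[x ↔⁻ y]`. -/
def connSign {G : SimpleGraph V} {β : ℝ} (ω : Config G β) (x y : V) : ℝ :=
  (if ConnPlus ω x y then 1 else 0) - (if ConnMinus ω x y then 1 else 0)

/-- The density of `ρ_u` times `(-v)^#dbars n^(𝓛(ω) - #dbars) ∏_{loop l in ω} s(l)`. For `v = -1`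
the first factor is `1`. -/
def loopWeight {G : SimpleGraph V} {β : ℝ} (n : ℕ) (u v : ℝ) (s : Loop G β → ℤˣ)
    (ω : Config G β) : ℝ :=
  rhoDensity u ω * (-v) ^ numMark Mark.dbar ω *
    (n : ℝ) ^ ((numLoops ω : ℤ) - (numMark Mark.dbar ω : ℤ)) *
    ∏ᶠ l ∈ loops ω, (((s l : ℤˣ) : ℤ) : ℝ)

/-- The model with interaction `u T̃ + v Q` on `G` has a loop representation with signs `s`:
* the partition function is given by the signed loop model;
* so are the correlations of the transformed spin operators, with the factor `(n² - 1) / 12`;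
* so are the correlations of the original spin operators `S⁽ⁱ⁾`, up to a factor `-1` if `x, y` are
  on different sublattices and `i ∈ {1, 3}`. -/
def HasLoopRepresentation (G : SimpleGraph V) [DecidableRel G.Adj] (β : ℝ) [Fact (0 < 2 * β)]
    (n : ℕ) (Tt : Matrix (Fin n × Fin n) (Fin n × Fin n) ℂ) (s : Loop G β → ℤˣ) : Prop :=
  ∀ u v : ℝ,
    (Integrable (fun p : Enumerated G β => loopWeight n u v s p.config) (configMeasure G β) ∧
      Matrix.trace (boltzmann G Tt β u v) =
        ((Real.exp (2 * β * (1 + u) * (Nat.card G.edgeSet : ℝ)) *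
          ∫ p, loopWeight n u v s p.config ∂(configMeasure G β) : ℝ) : ℂ)) ∧
    ∀ x y : V,
      Integrable (fun p : Enumerated G β => loopWeight n u v s p.config * connSign p.config x y)
        (configMeasure G β) ∧
      ∀ (c : G.Coloring Bool) (i : Fin 3),
        Matrix.trace (transformedSpin c n i x * transformedSpin c n i y * boltzmann G Tt β u v) =
          ((((n : ℝ) ^ 2 - 1) / 12 * Real.exp (2 * β * (1 + u) * (Nat.card G.edgeSet : ℝ)) *
            ∫ p, loopWeight n u v s p.config * connSign p.config x y
              ∂(configMeasure G β) : ℝ) : ℂ) ∧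
        Matrix.trace (siteOp (spin n i) x * siteOp (spin n i) y * boltzmann G Tt β u v) =
          (((if i = 1 ∨ c x = c y then 1 else -1) *
            (((n : ℝ) ^ 2 - 1) / 12 * Real.exp (2 * β * (1 + u) * (Nat.card G.edgeSet : ℝ)) *
            ∫ p, loopWeight n u v s p.config * connSign p.config x y
              ∂(configMeasure G β)) : ℝ) : ℂ)

end SpinLoop

end

/-!
The proof expands `e^{-2βH}` in a Poisson series and identifies the contribution of each
configuration with a count of signed colourings of its loops.

* By `boltzmann_eq` the exponent is `2β` times the sum over marked edges of `linkOp`, and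
  `integral_configMeasure_eq_trace` shows that the integral of `Tr B A_{l₁} ⋯ A_{l_k}` over the
  configurations, with the links ordered by their times, is `Tr B exp (2β ∑ A_l)`. Only
  configurations with distinct times, none of them `0`, matter (`timedConfig`).

* The time-ordered product has matrix elements supported on histories of spin configurations that
  satisfy a local constraint at each link (`linkOp_apply`, `Ladder.trace_eq_sum`): a double bar
  forces equal spins on either side, a cross exchanges two spins and reverses them. Reversing the
  spins on one sublattice and, once more, along downward motion turns the histories into functions
  that are constant along the oriented trajectories and change to the reversed value when the
  orientation is reversed (`Ladder.spinEquiv`). A trajectory is never its own reversal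
  (`Reversible.not_sameCycle_R`), so each loop carries `n` colours, which gives `n^𝓛`; the spin
  values of different loops are independent with mean zero and variance `(n² - 1) / 12`, which gives the
  correlations of the third component (`card_colourings`, `sum_colourings_mul`). By rotation
  invariance the other components have the same correlations (`trace_transformedSpin_eq`).

* The operator `(V ⊗ V) T` has matrix elements `± 1`, with parity signs of the spins at the crosses.
  Along a loop there is an even number of arrivals from crosses (`Ladder.prod_arrivals_neg_one`), so
  that the parity signs of the colour cancel. What is left does not depend on `n` but on its parity:
  for odd `n` nothing, for even `n` the product over the arrivals of the sublattice signs. For odd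
  `n` the operator `(1 ⊗ V) T (1 ⊗ V*)` is `(V ⊗ V) T`, so each cross contributes a further `-1`,
  which is the product of the sublattice signs of the two legs of the cross, hence again a product
  over the passages of the loops (`Ladder.prod_sublattice`).

* The discretized trajectories are those of the continuous motion (`sameTrajectory_iff`). The signs
  are functions of the loop alone, because the links that a loop traverses determine its motion,
  whatever the rest of the configuration is (`sameTrajectory_iff_of_links_eq`,
  `loopSign_loopThrough`).
-/


noncomputable section

namespace SpinLoop

/-! ### Algebra of one-site and two-site operators -/

section Operators

variable {V : Type*} [Fintype V] [DecidableEq V] {n : ℕ}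

theorem siteOp_smul (a : ℂ) (A : Matrix (Fin n) (Fin n) ℂ) (x : V) :
    siteOp (a • A) x = a • siteOp A x := by
  ext σ τ
  simp only [siteOp, Matrix.smul_apply]
  split_ifs <;> simp

theorem siteOp_sub (A B : Matrix (Fin n) (Fin n) ℂ) (x : V) :
    siteOp (A - B) x = siteOp A x - siteOp B x := by
  ext σ τ
  simp only [siteOp, Matrix.sub_apply]
  split_ifs <;> simp

/-- A sum over configurations that agree with `σ` off `x` is a sum over the value at `x`. -/
theorem sum_agree_off (σ : V → Fin n) (x : V) (F : (V → Fin n) → ℂ) :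
    ∑ τ, (if ∀ z, z ≠ x → σ z = τ z then F τ else 0) = ∑ p, F (Function.update σ x p) := by
  classical
  rw [← Finset.sum_filter]
  refine (Finset.sum_bij (fun p _ => Function.update σ x p) ?_ ?_ ?_ ?_).symm
  · intro p _
    simp +contextual [Function.update_of_ne]
  · intro p _ q _ h
    simpa using congrFun h x
  · intro τ hτ
    refine ⟨τ x, Finset.mem_univ _, ?_⟩
    simp only [Finset.mem_filter, Finset.mem_univ, true_and] at hτ
    ext z
    by_cases hz : z = x
    · subst hz; simp
    · simp [hz, hτ z hz]
  · intros; rfl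

/-- A sum over configurations that agree with `σ` off `x, y` is a sum over the values at
`x, y`. -/
theorem sum_agree_off_pair (σ : V → Fin n) {x y : V} (hxy : x ≠ y) (F : (V → Fin n) → ℂ) :
    ∑ τ, (if ∀ z, z ≠ x → z ≠ y → σ z = τ z then F τ else 0) =
      ∑ p : Fin n × Fin n, F (Function.update (Function.update σ x p.1) y p.2) := by
  classical
  rw [← Finset.sum_filter]
  refine (Finset.sum_bij
    (fun (p : Fin n × Fin n) _ => Function.update (Function.update σ x p.1) y p.2)
    ?_ ?_ ?_ ?_).symm
  · intro p _
    simp +contextual [Function.update_of_ne]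
  · intro p _ q _ h
    ext
    · simpa [Function.update_of_ne hxy] using congrArg Fin.val (congrFun h x)
    · simpa using congrArg Fin.val (congrFun h y)
  · intro τ hτ
    refine ⟨(τ x, τ y), Finset.mem_univ _, ?_⟩
    simp only [Finset.mem_filter, Finset.mem_univ, true_and] at hτ
    ext z
    by_cases hz : z = y
    · subst hz; simp
    · by_cases hz' : z = x
      · subst hz'; simp [hz]
      · simp [hz, hz', hτ z hz' hz]
  · intros; rfl

theorem siteOp_mul (A B : Matrix (Fin n) (Fin n) ℂ) (x : V) :
    siteOp (A * B) x = siteOp A x * siteOp B x := by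
  ext σ ρ
  simp only [siteOp, Matrix.mul_apply, ite_mul, zero_mul]
  rw [sum_agree_off σ x (fun τ => A (σ x) (τ x) * if ∀ z, z ≠ x → τ z = ρ z then
    B (τ x) (ρ x) else 0)]
  have : ∀ p, (∀ z, z ≠ x → Function.update σ x p z = ρ z) ↔ (∀ z, z ≠ x → σ z = ρ z) := by
    intro p
    refine forall₂_congr fun z hz => ?_
    rw [Function.update_of_ne hz]
  simp only [this, Function.update_self]
  split_ifs <;> simp

theorem pairOp_mul (A B : Matrix (Fin n × Fin n) (Fin n × Fin n) ℂ) {x y : V} (hxy : x ≠ y) :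
    pairOp (A * B) x y = pairOp A x y * pairOp B x y := by
  ext σ ρ
  simp only [pairOp, Matrix.mul_apply, ite_mul, zero_mul]
  rw [sum_agree_off_pair σ hxy (fun τ => A (σ x, σ y) (τ x, τ y) *
    if ∀ z, z ≠ x → z ≠ y → τ z = ρ z then B (τ x, τ y) (ρ x, ρ y) else 0)]
  have : ∀ p : Fin n × Fin n, (∀ z, z ≠ x → z ≠ y →
      Function.update (Function.update σ x p.1) y p.2 z = ρ z) ↔
      (∀ z, z ≠ x → z ≠ y → σ z = ρ z) := by
    intro p
    refine forall₃_congr fun z hz hz' => ?_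
    rw [Function.update_of_ne hz', Function.update_of_ne hz]
  simp only [this, Function.update_self, Function.update_of_ne hxy]
  split_ifs <;> simp

theorem pairOp_add (A B : Matrix (Fin n × Fin n) (Fin n × Fin n) ℂ) (x y : V) :
    pairOp (A + B) x y = pairOp A x y + pairOp B x y := by
  ext σ τ
  simp only [pairOp, Matrix.add_apply]
  split_ifs <;> simp

theorem pairOp_smul (a : ℂ) (A : Matrix (Fin n × Fin n) (Fin n × Fin n) ℂ) (x y : V) :
    pairOp (a • A) x y = a • pairOp A x y := by
  ext σ τ
  simp only [pairOp, Matrix.smul_apply]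
  split_ifs <;> simp

theorem siteOp_eq_pairOp_left (A : Matrix (Fin n) (Fin n) ℂ) {x y : V} (hxy : x ≠ y) :
    siteOp A x = pairOp (A ⊗ₖ (1 : Matrix (Fin n) (Fin n) ℂ)) x y := by
  ext σ τ
  simp only [siteOp, pairOp, Matrix.kroneckerMap_apply, Matrix.one_apply, mul_ite, mul_one,
    mul_zero]
  by_cases h : ∀ z, z ≠ x → σ z = τ z
  · rw [if_pos h, if_pos (fun z hz _ => h z hz), if_pos (h y hxy.symm)]
  · rw [if_neg h]
    split_ifs with h1 h2
    · refine absurd (fun z hz => ?_) h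
      by_cases hzy : z = y
      · rw [hzy, h2]
      · exact h1 z hz hzy
    · rfl
    · rfl

theorem siteOp_eq_pairOp_right (A : Matrix (Fin n) (Fin n) ℂ) {x y : V} (hxy : x ≠ y) :
    siteOp A y = pairOp ((1 : Matrix (Fin n) (Fin n) ℂ) ⊗ₖ A) x y := by
  ext σ τ
  simp only [siteOp, pairOp, Matrix.kroneckerMap_apply, Matrix.one_apply, ite_mul, one_mul,
    zero_mul]
  by_cases h : ∀ z, z ≠ y → σ z = τ z
  · rw [if_pos h, if_pos (fun z _ hz => h z hz), if_pos (h x hxy)]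
  · rw [if_neg h]
    split_ifs with h1 h2
    · refine absurd (fun z hz => ?_) h
      by_cases hzx : z = x
      · rw [hzx, h2]
      · exact h1 z hzx hz
    · rfl
    · rfl

theorem pairOp_comm (A : Matrix (Fin n × Fin n) (Fin n × Fin n) ℂ)
    (hA : ∀ a b, A a.swap b.swap = A a b) (x y : V) : pairOp A x y = pairOp A y x := by
  ext σ τ
  simp only [pairOp]
  rw [← hA (σ x, σ y) (τ x, τ y)]
  simp only [Prod.swap_prod_mk]
  congr 1
  exact propext ⟨fun h z a b => h z b a, fun h z a b => h z b a⟩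

theorem siteOp_commute_siteOp (A B : Matrix (Fin n) (Fin n) ℂ) {x y : V} (hxy : x ≠ y) :
    Commute (siteOp A x) (siteOp B y) := by
  rw [Commute, SemiconjBy, siteOp_eq_pairOp_left A hxy, siteOp_eq_pairOp_right B hxy,
    ← pairOp_mul _ _ hxy, ← pairOp_mul _ _ hxy, ← Matrix.mul_kronecker_mul,
    ← Matrix.mul_kronecker_mul]
  simp

theorem siteOp_commute_pairOp (A : Matrix (Fin n) (Fin n) ℂ)
    (B : Matrix (Fin n × Fin n) (Fin n × Fin n) ℂ) {x y z : V} (hx : z ≠ x) (hy : z ≠ y) :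
    Commute (siteOp A z) (pairOp B x y) := by
  ext σ ρ
  rw [Matrix.mul_apply, Matrix.mul_apply,
    Finset.sum_eq_single (Function.update σ z (ρ z)),
    Finset.sum_eq_single (Function.update ρ z (σ z))]
  · simp only [siteOp, pairOp, Function.update_self, Function.update_of_ne hx.symm,
      Function.update_of_ne hy.symm]
    rw [if_pos (fun w hw => by rw [Function.update_of_ne hw]),
      if_pos (c := ∀ w, w ≠ z → Function.update ρ z (σ z) w = ρ w)
        (fun w hw => by rw [Function.update_of_ne hw])]
    have : (∀ w, w ≠ x → w ≠ y → Function.update σ z (ρ z) w = ρ w) ↔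
        (∀ w, w ≠ x → w ≠ y → σ w = Function.update ρ z (σ z) w) := by
      refine forall₃_congr fun w _ _ => ?_
      by_cases hw : w = z
      · subst hw; simp
      · rw [Function.update_of_ne hw, Function.update_of_ne hw]
    simp only [this]
    split_ifs
    · ring
    · simp
  · intro τ _ hτ
    simp only [siteOp, pairOp]
    split_ifs with h1 h2
    · refine absurd ?_ hτ
      ext w
      by_cases hw : w = z
      · subst hw; simp [h1 w hx hy]
      · rw [Function.update_of_ne hw, h2 w hw]
    all_goals simp
  · simp
  · intro τ _ hτ
    simp only [siteOp, pairOp]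
    split_ifs with h1 h2
    · refine absurd ?_ hτ
      ext w
      by_cases hw : w = z
      · subst hw; simp [h2 w hx hy]
      · rw [Function.update_of_ne hw, h1 w hw]
    all_goals simp
  · simp

end Operators

/-! ### Spin operators -/

section Spin

variable (n : ℕ)

theorem spinValue_rev (j : Fin n) : spinValue n (Fin.rev j) = -spinValue n j := by
  simp only [spinValue, Fin.val_rev]
  rw [Nat.cast_sub (by omega)]
  push_cast
  ring

theorem flipV_conjTranspose_apply (i j : Fin n) :
    (flipV n)ᴴ i j = if j = Fin.rev i then (-1) ^ (j : ℕ) else 0 := by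
  simp only [Matrix.conjTranspose_apply, flipV]
  split_ifs <;> simp

theorem conj_flipV_apply (A : Matrix (Fin n) (Fin n) ℂ) (i j : Fin n) :
    ((flipV n)ᴴ * A * flipV n) i j =
      (-1) ^ ((i : ℕ) + (j : ℕ)) * A (Fin.rev i) (Fin.rev j) := by
  have hs : ∀ k : Fin n, ((-1 : ℂ)) ^ ((Fin.rev k : Fin n) : ℕ) = (-1) ^ (n + 1 + (k : ℕ)) := by
    intro k
    have h : ((Fin.rev k : Fin n) : ℕ) + 2 * (k + 1) = n + 1 + k := by
      rw [Fin.val_rev]; omega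
    rw [← h, pow_add, pow_mul]; simp
  simp only [Matrix.mul_apply, flipV_conjTranspose_apply, flipV, ite_mul, zero_mul, mul_ite,
    mul_zero, Finset.sum_ite_eq', Finset.mem_univ, if_true]
  rw [hs, hs]
  have : ((-1 : ℂ)) ^ (n + 1) * (-1) ^ (n + 1) = 1 := by
    rw [← pow_add, ← two_mul, pow_mul]; simp
  rw [pow_add _ (n + 1), pow_add _ (n + 1), pow_add]
  linear_combination ((-1) ^ (i : ℕ) * (-1) ^ (j : ℕ) * A (Fin.rev i) (Fin.rev j)) * this

theorem flipV_mul_conjTranspose : flipV n * (flipV n)ᴴ = 1 := by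
  ext i j
  simp only [Matrix.mul_apply, flipV_conjTranspose_apply, flipV, Matrix.one_apply]
  rw [Finset.sum_eq_single (Fin.rev i)]
  · simp only [Fin.rev_rev, if_true]
    by_cases h : i = j
    · subst h; simp [← pow_add, ← two_mul, pow_mul]
    · rw [if_neg (fun h' => h h'.symm)]
      simp [h]
  · intro b _ hb
    rw [if_neg (fun h => hb (by rw [h, Fin.rev_rev]))]
    simp
  · simp

/-- The coefficient of the raising operator. -/
def raisingCoeff (j : Fin n) : ℝ :=
  Real.sqrt ((((n : ℝ) - 1) / 2) * (((n : ℝ) - 1) / 2 + 1) - spinValue n j * (spinValue n j + 1))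

theorem raisingCoeff_sq (j : Fin n) : raisingCoeff n j * raisingCoeff n j =
    (((n : ℝ) - 1) / 2) * (((n : ℝ) - 1) / 2 + 1) - spinValue n j * (spinValue n j + 1) := by
  refine Real.mul_self_sqrt ?_
  have h1 : (0 : ℝ) ≤ (j : ℕ) := Nat.cast_nonneg _
  have h2 : ((j : ℕ) : ℝ) + 1 ≤ n := by exact_mod_cast j.2
  simp only [spinValue]
  nlinarith

theorem raising_conjTranspose : (raising n)ᴴ = (raising n)ᵀ := by
  ext i j
  simp only [Matrix.conjTranspose_apply, Matrix.transpose_apply, raising]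
  split_ifs <;> simp

theorem raising_apply (i j : Fin n) :
    raising n i j = if (i : ℕ) = (j : ℕ) + 1 then ((raisingCoeff n j : ℝ) : ℂ) else 0 := rfl

theorem conj_flipV_raising : (flipV n)ᴴ * raising n * flipV n = -(raising n)ᵀ := by
  ext i j
  rw [conj_flipV_apply, Matrix.neg_apply, Matrix.transpose_apply, raising_apply, raising_apply]
  simp only [Fin.val_rev]
  by_cases h : (j : ℕ) = i + 1
  · rw [if_pos (by omega), if_pos h, h]
    have : raisingCoeff n (Fin.rev j) = raisingCoeff n i := by
      unfold raisingCoeff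
      rw [spinValue_rev]
      have : spinValue n j = spinValue n i + 1 := by
        simp only [spinValue, h]; push_cast; ring
      rw [this]
      congr 1; ring
    rw [this, ← add_assoc, ← two_mul, pow_succ, pow_mul]
    simp
  · rw [if_neg (by omega), if_neg h]; simp

theorem conj_flipV_raising_transpose :
    (flipV n)ᴴ * (raising n)ᵀ * flipV n = -raising n := by
  have := congrArg Matrix.transpose (conj_flipV_raising n)
  ext i j
  have h := congrFun (congrFun this i) j
  rw [Matrix.transpose_apply, conj_flipV_apply, Matrix.transpose_neg,
    Matrix.transpose_transpose] at h
  rw [conj_flipV_apply, ← h, add_comm (i : ℕ), Matrix.transpose_apply]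

/-- The sign by which conjugation with `V` multiplies `S⁽ⁱ⁾`. -/
def flipSign (i : Fin 3) : ℂ := if i = 1 then 1 else -1

theorem conj_flipV_spin (i : Fin 3) :
    (flipV n)ᴴ * spin n i * flipV n = flipSign i • spin n i := by
  have h1 := conj_flipV_raising n
  have h2 := conj_flipV_raising_transpose n
  fin_cases i
  · simp only [spin, flipSign, raising_conjTranspose]
    simp [Matrix.mul_add, Matrix.add_mul, h1, h2, add_comm]
  · simp only [spin, flipSign, raising_conjTranspose]
    simp [Matrix.mul_sub, Matrix.sub_mul, h1, h2]
    module
  · ext a b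
    rw [conj_flipV_apply]
    simp only [spin, flipSign]
    by_cases h : a = b
    · subst h
      simp [← two_mul, pow_mul, spinValue_rev]
    · simp [Matrix.diagonal_apply_ne, h]

theorem spin_transpose (i : Fin 3) : (spin n i)ᵀ = -flipSign i • spin n i := by
  fin_cases i
  · simp only [spin, flipSign, raising_conjTranspose]
    simp [add_comm]
  · simp only [spin, flipSign, raising_conjTranspose]
    simp
    rw [← smul_neg, neg_sub]
  · simp [spin, flipSign]

theorem raising_commutator :
    raising n * (raising n)ᵀ - (raising n)ᵀ * raising n = (2 : ℂ) • spin n 2 := by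
  have hdiag : ∀ (i : Fin n), (∑ k, raising n i k * raising n i k : ℂ) =
      (((((n : ℝ) - 1) / 2) * (((n : ℝ) - 1) / 2 + 1)
        - spinValue n i * (spinValue n i - 1) : ℝ) : ℂ) := by
    intro i
    simp only [raising_apply]
    by_cases hi : (i : ℕ) = 0
    · rw [Finset.sum_eq_zero]
      · have : spinValue n i = -(((n : ℝ) - 1) / 2) := by simp [spinValue, hi]
        rw [this]; push_cast; ring
      · intro k _
        rw [if_neg (by omega)]; simp
    · have hi' : (i : ℕ) - 1 < n := by omega
      rw [Finset.sum_eq_single ⟨(i : ℕ) - 1, hi'⟩]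
      · rw [if_pos (by simp; omega), ← Complex.ofReal_mul, raisingCoeff_sq]
        have : spinValue n ⟨(i : ℕ) - 1, hi'⟩ = spinValue n i - 1 := by
          simp only [spinValue]
          rw [Nat.cast_sub (by omega)]; push_cast; ring
        rw [this]; congr 1; ring
      · intro b _ hb
        rw [if_neg]; · simp
        intro h; apply hb; ext; simp; omega
      · simp
  have hdiag' : ∀ (i : Fin n), (∑ k, raising n k i * raising n k i : ℂ) =
      (((((n : ℝ) - 1) / 2) * (((n : ℝ) - 1) / 2 + 1)
        - spinValue n i * (spinValue n i + 1) : ℝ) : ℂ) := by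
    intro i
    simp only [raising_apply]
    by_cases hi : (i : ℕ) + 1 = n
    · rw [Finset.sum_eq_zero]
      · have : spinValue n i = (((n : ℝ) - 1) / 2) := by
          have h : ((i : ℕ) : ℝ) + 1 = n := by exact_mod_cast hi
          simp only [spinValue]; linarith
        rw [this]; push_cast; ring
      · intro k _
        rw [if_neg (by omega)]; simp
    · have hi' : (i : ℕ) + 1 < n := by omega
      rw [Finset.sum_eq_single ⟨(i : ℕ) + 1, hi'⟩]
      · rw [if_pos (by simp), ← Complex.ofReal_mul, raisingCoeff_sq]
      · intro b _ hb
        rw [if_neg]; · simp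
        intro h; apply hb; ext; simp; omega
      · simp
  ext i j
  rw [Matrix.sub_apply, Matrix.mul_apply, Matrix.mul_apply]
  simp only [Matrix.transpose_apply]
  by_cases h : i = j
  · subst h
    rw [hdiag, hdiag']
    simp [spin]
    ring
  · rw [Finset.sum_eq_zero, Finset.sum_eq_zero]
    · simp [spin, h]
    · intro k _
      simp only [raising_apply]
      by_cases h1 : (k : ℕ) = i + 1
      · rw [if_neg (c := (k : ℕ) = j + 1)]
        · simp
        · intro h2; apply h; ext; omega
      · rw [if_neg h1]; simp
    · intro k _
      simp only [raising_apply]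
      by_cases h1 : (i : ℕ) = k + 1
      · rw [if_neg (c := (j : ℕ) = k + 1)]
        · simp
        · intro h2; apply h; ext; omega
      · rw [if_neg h1]; simp

theorem spin_two_raising : spin n 2 * raising n - raising n * spin n 2 = raising n := by
  ext i j
  simp only [spin, Matrix.sub_apply]
  simp only [Matrix.cons_val, Matrix.diagonal_mul, Matrix.mul_diagonal, raising_apply]
  split_ifs with h
  · have : spinValue n i = spinValue n j + 1 := by simp only [spinValue, h]; push_cast; ring
    rw [this]; push_cast; ring
  · simp

theorem spin_two_raising_transpose :
    spin n 2 * (raising n)ᵀ - (raising n)ᵀ * spin n 2 = -(raising n)ᵀ := by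
  have h := congrArg Matrix.transpose (spin_two_raising n)
  have h3 : (spin n 2)ᵀ = spin n 2 := by simp [spin]
  rw [Matrix.transpose_sub, Matrix.transpose_mul, Matrix.transpose_mul, h3] at h
  exact ((neg_sub _ _).symm.trans (congrArg Neg.neg h))

/-- The commutation relations `[S⁽ⁱ⁾, S⁽ⁱ⁺¹⁾] = i S⁽ⁱ⁺²⁾`, with indices modulo `3`. -/
theorem spin_commutator (i : Fin 3) :
    spin n i * spin n (i + 1) - spin n (i + 1) * spin n i = Complex.I • spin n (i + 2) := by
  have hI : (2 * Complex.I)⁻¹ = -(Complex.I / 2) := by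
    rw [mul_inv, Complex.inv_I]; ring
  have h0 : spin n 0 = (1 / 2 : ℂ) • (raising n + (raising n)ᵀ) := by
    simp [spin, raising_conjTranspose]
  have h1 : spin n 1 = (-(Complex.I / 2)) • (raising n - (raising n)ᵀ) := by
    simp [spin, raising_conjTranspose, ← hI]
  have a := raising_commutator n
  have b := spin_two_raising n
  have c := spin_two_raising_transpose n
  have hII := Complex.I_mul_I
  fin_cases i
  · change spin n 0 * spin n 1 - spin n 1 * spin n 0 = Complex.I • spin n 2
    rw [h0, h1]
    have : spin n 2 = (1 / 2 : ℂ) • (raising n * (raising n)ᵀ - (raising n)ᵀ * raising n) := by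
      rw [a, smul_smul]; norm_num
    rw [this]
    simp only [smul_mul_assoc, mul_smul_comm, smul_smul, Matrix.mul_add, Matrix.add_mul,
      Matrix.mul_sub, Matrix.sub_mul]
    module
  · change spin n 1 * spin n 2 - spin n 2 * spin n 1 = Complex.I • spin n 0
    have : raising n + (raising n)ᵀ = (spin n 2 * raising n - raising n * spin n 2) -
      (spin n 2 * (raising n)ᵀ - (raising n)ᵀ * spin n 2) := by rw [b, c]; abel
    rw [h0, this, h1]
    simp only [smul_mul_assoc, mul_smul_comm, Matrix.mul_sub, Matrix.sub_mul]
    module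
  · change spin n 2 * spin n 0 - spin n 0 * spin n 2 = Complex.I • spin n 1
    have : raising n - (raising n)ᵀ = (spin n 2 * raising n - raising n * spin n 2) +
      (spin n 2 * (raising n)ᵀ - (raising n)ᵀ * spin n 2) := by rw [b, c]; abel
    rw [h1, this, smul_smul, h0,
      show Complex.I * -(Complex.I / 2) = 1 / 2 by linear_combination (-1 / 2) * hII]
    simp only [smul_mul_assoc, mul_smul_comm, Matrix.mul_add, Matrix.add_mul]
    module

end Spin

/-! ### The interactions and the rotation symmetry -/

section Interaction

variable (n : ℕ)

/-- The operator `(V ⊗ V) T`. Both interactions of interest are `± (V ⊗ V) T`. -/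
def crossT : Matrix (Fin n × Fin n) (Fin n × Fin n) ℂ :=
  (flipV n ⊗ₖ flipV n) * transposition n

theorem mul_transposition_apply (A : Matrix (Fin n × Fin n) (Fin n × Fin n) ℂ)
    (a b : Fin n × Fin n) : (A * transposition n) a b = A a b.swap := by
  simp [Matrix.mul_apply, transposition]

theorem transposition_mul_apply (A : Matrix (Fin n × Fin n) (Fin n × Fin n) ℂ)
    (a b : Fin n × Fin n) : (transposition n * A) a b = A a.swap b := by
  rw [Matrix.mul_apply, Finset.sum_eq_single a.swap]
  · simp [transposition]
  · intro c _ hc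
    rw [transposition, if_neg, zero_mul]
    rintro rfl
    simp at hc
  · simp

theorem transposition_mul_kronecker (A B : Matrix (Fin n) (Fin n) ℂ) :
    transposition n * (A ⊗ₖ B) = (B ⊗ₖ A) * transposition n := by
  ext a b
  rw [transposition_mul_apply, mul_transposition_apply]
  simp [Matrix.kroneckerMap_apply, mul_comm]

theorem crossT_apply (a b : Fin n × Fin n) :
    crossT n a b = if a.1 = Fin.rev b.2 ∧ a.2 = Fin.rev b.1 then
      (-1) ^ ((a.1 : ℕ) + (a.2 : ℕ)) else 0 := by
  rw [crossT, mul_transposition_apply]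
  simp only [Matrix.kroneckerMap_apply, flipV, Prod.fst_swap, Prod.snd_swap]
  split_ifs <;> simp_all [pow_add]

theorem flipV_conjTranspose : (flipV n)ᴴ = (-1 : ℂ) ^ (n + 1) • flipV n := by
  ext i j
  simp only [flipV_conjTranspose_apply, Matrix.smul_apply, flipV, smul_eq_mul]
  by_cases h : j = Fin.rev i
  · rw [if_pos h, if_pos (by rw [h, Fin.rev_rev]), ← pow_add, h, Fin.val_rev]
    have : n + 1 + (i : ℕ) = n - (i + 1) + 2 * (i + 1) := by omega
    rw [this, pow_add _ _ (2 * _), pow_mul]; simp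
  · rw [if_neg h, if_neg (fun h' => h (by rw [h', Fin.rev_rev]))]; simp

theorem transformedT_eq : transformedT n = (-1 : ℂ) ^ (n + 1) • crossT n := by
  rw [transformedT, Matrix.mul_assoc, transposition_mul_kronecker, ← Matrix.mul_assoc,
    ← Matrix.mul_kronecker_mul, flipV_conjTranspose, crossT]
  simp [Matrix.smul_kronecker]

theorem minusVVT_eq : minusVVT n = -crossT n := rfl

theorem flipSign_mul_self (i : Fin 3) : flipSign i * flipSign i = 1 := by
  unfold flipSign; split_ifs <;> norm_num

theorem flipV_mul_spin (i : Fin 3) : flipV n * spin n i = flipSign i • (spin n i * flipV n) := by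
  have h := congrArg (fun A => flipV n * A) (conj_flipV_spin n i)
  simp only [← Matrix.mul_assoc, flipV_mul_conjTranspose, Matrix.one_mul, mul_smul_comm] at h
  rw [h, smul_smul, flipSign_mul_self, one_smul]

/-- The total transformed spin of two neighbouring sites, the second of which belongs to the
transformed sublattice. -/
def pairSpin (i : Fin 3) : Matrix (Fin n × Fin n) (Fin n × Fin n) ℂ :=
  spin n i ⊗ₖ (1 : Matrix (Fin n) (Fin n) ℂ) +
    flipSign i • ((1 : Matrix (Fin n) (Fin n) ℂ) ⊗ₖ spin n i)

theorem pairSpin_commute_crossT (i : Fin 3) : Commute (pairSpin n i) (crossT n) := by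
  have hs := flipSign_mul_self i
  rw [Commute, SemiconjBy, pairSpin, crossT, Matrix.mul_add, Matrix.add_mul, mul_smul_comm,
    smul_mul_assoc, Matrix.mul_assoc _ (transposition n), Matrix.mul_assoc _ (transposition n),
    transposition_mul_kronecker, transposition_mul_kronecker]
  simp only [← Matrix.mul_assoc, ← Matrix.mul_kronecker_mul, Matrix.one_mul, Matrix.mul_one]
  rw [flipV_mul_spin, Matrix.kronecker_smul, Matrix.smul_kronecker]
  simp only [smul_mul_assoc, smul_smul, hs, one_smul]
  abel

theorem projQ_mul_kronecker (A : Matrix (Fin n) (Fin n) ℂ) :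
    projQ n * (A ⊗ₖ (1 : Matrix (Fin n) (Fin n) ℂ)) =
      projQ n * ((1 : Matrix (Fin n) (Fin n) ℂ) ⊗ₖ Aᵀ) := by
  ext a b
  simp only [Matrix.mul_apply, Fintype.sum_prod_type, projQ, Matrix.kroneckerMap_apply,
    Matrix.one_apply, Matrix.transpose_apply]
  by_cases h : a.1 = a.2
  · simp [h]
  · simp [h]

theorem kronecker_mul_projQ (A : Matrix (Fin n) (Fin n) ℂ) :
    (A ⊗ₖ (1 : Matrix (Fin n) (Fin n) ℂ)) * projQ n =
      ((1 : Matrix (Fin n) (Fin n) ℂ) ⊗ₖ Aᵀ) * projQ n := by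
  ext a b
  simp only [Matrix.mul_apply, Fintype.sum_prod_type, projQ, Matrix.kroneckerMap_apply,
    Matrix.one_apply, Matrix.transpose_apply]
  by_cases h : b.1 = b.2
  · simp [h]
  · simp [h]

theorem pairSpin_commute_projQ (i : Fin 3) : Commute (pairSpin n i) (projQ n) := by
  rw [Commute, SemiconjBy, pairSpin, Matrix.mul_add, Matrix.add_mul, kronecker_mul_projQ,
    projQ_mul_kronecker, spin_transpose, Matrix.kronecker_smul]
  simp

end Interaction

section Rotation

variable {V : Type*} [Fintype V] [DecidableEq V] {G : SimpleGraph V} {n : ℕ}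

/-- The sign relating the transformed spin operators to the original ones. -/
def sublatticeSign (i : Fin 3) (b : Bool) : ℂ := if b = true then flipSign i else 1

theorem transformedSpin_eq (c : G.Coloring Bool) (i : Fin 3) (x : V) :
    transformedSpin c n i x = sublatticeSign i (c x) • siteOp (spin n i) x := by
  unfold transformedSpin sublatticeSign
  split_ifs
  · rw [conj_flipV_spin, siteOp_smul]
  · rw [one_smul]

theorem transformedSpin_commutator (c : G.Coloring Bool) (i : Fin 3) (x : V) :
    transformedSpin c n i x * transformedSpin c n (i + 1) x -
      transformedSpin c n (i + 1) x * transformedSpin c n i x =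
      Complex.I • transformedSpin c n (i + 2) x := by
  have conj : ∀ A B : Matrix (Fin n) (Fin n) ℂ, ((flipV n)ᴴ * A * flipV n) *
      ((flipV n)ᴴ * B * flipV n) = (flipV n)ᴴ * (A * B) * flipV n := by
    intro A B
    calc _ = (flipV n)ᴴ * A * (flipV n * (flipV n)ᴴ) * B * flipV n := by
          simp only [Matrix.mul_assoc]
      _ = _ := by rw [flipV_mul_conjTranspose]; simp only [Matrix.mul_assoc, Matrix.one_mul]
  unfold transformedSpin
  rw [← siteOp_mul, ← siteOp_mul, ← siteOp_sub, ← siteOp_smul]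
  congr 1
  split_ifs
  · rw [conj, conj, ← Matrix.sub_mul, ← Matrix.mul_sub, spin_commutator]
    simp
  · exact spin_commutator n i

theorem transformedSpin_commute (c : G.Coloring Bool) (i j : Fin 3) {x y : V} (h : x ≠ y) :
    Commute (transformedSpin c n i x) (transformedSpin c n j y) :=
  siteOp_commute_siteOp _ _ h

/-- The total transformed spin. -/
def totalSpin (c : G.Coloring Bool) (n : ℕ) (i : Fin 3) : Matrix (V → Fin n) (V → Fin n) ℂ :=
  ∑ x, transformedSpin c n i x

theorem totalSpin_commutator (c : G.Coloring Bool) (i : Fin 3) (x : V) :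
    totalSpin c n i * transformedSpin c n (i + 1) x -
      transformedSpin c n (i + 1) x * totalSpin c n i =
      Complex.I • transformedSpin c n (i + 2) x := by
  rw [← transformedSpin_commutator c i x, totalSpin, Finset.sum_mul, Finset.mul_sum,
    ← Finset.sum_sub_distrib]
  refine Finset.sum_eq_single x (fun z _ hz => ?_) (by simp)
  exact sub_eq_zero.2 (transformedSpin_commute c i (i + 1) hz).eq

theorem totalSpin_commutator' (c : G.Coloring Bool) (i : Fin 3) (x : V) :
    totalSpin c n i * transformedSpin c n (i + 2) x -
      transformedSpin c n (i + 2) x * totalSpin c n i =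
      -(Complex.I • transformedSpin c n (i + 1) x) := by
  have h := transformedSpin_commutator (n := n) c (i + 2) x
  rw [show i + 2 + 1 = i by fin_cases i <;> rfl, show i + 2 + 2 = i + 1 by fin_cases i <;> rfl] at h
  rw [← h, totalSpin, Finset.sum_mul, Finset.mul_sum, ← Finset.sum_sub_distrib, neg_sub]
  refine Finset.sum_eq_single x (fun z _ hz => ?_) (by simp)
  exact sub_eq_zero.2 (transformedSpin_commute c i (i + 2) hz).eq

theorem totalSpin_commute_pairOp (c : G.Coloring Bool) (i : Fin 3)
    {M : Matrix (Fin n × Fin n) (Fin n × Fin n) ℂ} (hM : Commute (pairSpin n i) M)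
    {x y : V} (hxy : G.Adj x y) : Commute (totalSpin c n i) (pairOp M x y) := by
  have hne := hxy.ne
  have hsplit : totalSpin c n i = (transformedSpin c n i x + transformedSpin c n i y) +
      ∑ z ∈ Finset.univ \ {x, y}, transformedSpin c n i z := by
    rw [totalSpin, ← Finset.sum_pair hne, add_comm, Finset.sum_sdiff (Finset.subset_univ _)]
  rw [hsplit]
  refine Commute.add_left ?_ (Commute.sum_left _ _ _ fun z hz => ?_)
  · have hs : sublatticeSign i (c y) = sublatticeSign i (c x) * flipSign i := by
      have := c.valid hxy
      have hf := flipSign_mul_self i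
      unfold sublatticeSign
      cases hx : c x <;> cases hy : c y <;> simp_all
    have : transformedSpin c n i x + transformedSpin c n i y =
        sublatticeSign i (c x) • pairOp (pairSpin n i) x y := by
      rw [transformedSpin_eq, transformedSpin_eq, hs, siteOp_eq_pairOp_left _ hne,
        siteOp_eq_pairOp_right _ hne, pairSpin, pairOp_add, pairOp_smul, smul_add, smul_smul]
    rw [this]
    refine Commute.smul_left ?_ _
    rw [Commute, SemiconjBy, ← pairOp_mul _ _ hne, ← pairOp_mul _ _ hne, hM.eq]
  · simp only [Finset.mem_sdiff, Finset.mem_univ, true_and, Finset.mem_insert,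
      Finset.mem_singleton, not_or] at hz
    exact siteOp_commute_pairOp _ _ hz.1 hz.2

theorem trace_spin_eq (c : G.Coloring Bool) (B : Matrix (V → Fin n) (V → Fin n) ℂ) (i : Fin 3)
    (x y : V) :
    Matrix.trace (siteOp (spin n i) x * siteOp (spin n i) y * B) =
      (if i = 1 ∨ c x = c y then 1 else -1) *
        Matrix.trace (transformedSpin c n i x * transformedSpin c n i y * B) := by
  rw [transformedSpin_eq, transformedSpin_eq]
  simp only [smul_mul_assoc, mul_smul_comm, Matrix.trace_smul, smul_eq_mul]
  rw [← mul_assoc, ← mul_assoc]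
  convert (one_mul _).symm using 2
  unfold sublatticeSign flipSign
  cases c x <;> cases c y <;> by_cases hi : i = 1 <;> simp [hi]

/-- By rotation invariance the correlations of two consecutive transformed spin components
agree. -/
theorem trace_transformedSpin_succ (c : G.Coloring Bool) (i : Fin 3)
    {B : Matrix (V → Fin n) (V → Fin n) ℂ} (hB : Commute (totalSpin c n i) B) (x y : V) :
    Matrix.trace (transformedSpin c n (i + 1) x * transformedSpin c n (i + 1) y * B) =
      Matrix.trace (transformedSpin c n (i + 2) x * transformedSpin c n (i + 2) y * B) := by
  have h1 := totalSpin_commutator (n := n) c i x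
  have h2 := totalSpin_commutator' (n := n) c i y
  set T := totalSpin c n i
  set A := transformedSpin c n (i + 1) x
  set A' := transformedSpin c n (i + 1) y
  set C := transformedSpin c n (i + 2) y
  set C' := transformedSpin c n (i + 2) x
  have e1 : T * A = A * T + Complex.I • C' := by rw [← h1]; abel
  have e2 : T * C = C * T - Complex.I • A' := by rw [← sub_eq_iff_eq_add'.1 h2 |>.symm]; abel
  have e3 : T * (A * C * B) = A * C * B * T + Complex.I • (C' * C * B - A * A' * B) := by
    calc T * (A * C * B) = (T * A) * C * B := by simp only [Matrix.mul_assoc]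
      _ = A * (T * C) * B + Complex.I • (C' * C * B) := by
          rw [e1]; simp only [Matrix.add_mul, Matrix.mul_assoc, smul_mul_assoc]
      _ = A * C * (T * B) + Complex.I • (C' * C * B) - Complex.I • (A * A' * B) := by
          rw [e2]
          simp only [Matrix.mul_sub, Matrix.sub_mul, Matrix.mul_assoc, smul_mul_assoc,
            mul_smul_comm]
          abel
      _ = _ := by
          rw [hB.eq, smul_sub]; simp only [Matrix.mul_assoc]; abel
  have e4 := congrArg Matrix.trace e3
  rw [Matrix.trace_mul_comm, Matrix.trace_add, Matrix.trace_smul, Matrix.trace_sub] at e4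
  have e5 : Complex.I * ((C' * C * B).trace - (A * A' * B).trace) = 0 := by
    rw [smul_eq_mul] at e4
    linear_combination -e4
  rcases mul_eq_zero.1 e5 with h | h
  · exact absurd h Complex.I_ne_zero
  · exact (sub_eq_zero.1 h).symm

variable [DecidableRel G.Adj]

theorem totalSpin_commute_boltzmann (c : G.Coloring Bool) (i : Fin 3)
    {Tt : Matrix (Fin n × Fin n) (Fin n × Fin n) ℂ} (hT : Commute (pairSpin n i) Tt)
    (β u v : ℝ) : Commute (totalSpin c n i) (boltzmann G Tt β u v) := by
  unfold boltzmann hamiltonian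
  refine Commute.exp_right (Commute.smul_right (Commute.smul_right ?_ _) _)
  refine Commute.sum_right _ _ _ fun x _ => Commute.sum_right _ _ _ fun y _ => ?_
  split_ifs with h
  · exact totalSpin_commute_pairOp c i
      ((hT.smul_right _).add_right ((pairSpin_commute_projQ n i).smul_right _)) h
  · exact Commute.zero_right _

/-- By rotation invariance it suffices to know the correlations of the third component. -/
theorem trace_transformedSpin_eq (c : G.Coloring Bool)
    {Tt : Matrix (Fin n × Fin n) (Fin n × Fin n) ℂ} (hT : ∀ i, Commute (pairSpin n i) Tt)
    (β u v : ℝ) (i : Fin 3) (x y : V) :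
    Matrix.trace (transformedSpin c n i x * transformedSpin c n i y * boltzmann G Tt β u v) =
      Matrix.trace (transformedSpin c n 2 x * transformedSpin c n 2 y *
        boltzmann G Tt β u v) := by
  have h := fun j => trace_transformedSpin_succ c j
    (totalSpin_commute_boltzmann c j (hT j) β u v) x y
  fin_cases i
  · exact (h 1).symm
  · exact h 0
  · rfl

end Rotation

/-! ### The Hamiltonian as a sum over links -/

section LinkOperators

variable {V : Type*} [Fintype V] [DecidableEq V] {G : SimpleGraph V} {n : ℕ}

/-- The operator attached to a link: `-u T̃` for a cross, `-v Q` for a double bar. -/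
def markOp (Tt : Matrix (Fin n × Fin n) (Fin n × Fin n) ℂ) (u v : ℝ) :
    Mark → Matrix (Fin n × Fin n) (Fin n × Fin n) ℂ
  | Mark.cross => -((u : ℂ) • Tt)
  | Mark.dbar => -((v : ℂ) • projQ n)

/-- The operator on the full system attached to a link. -/
def linkOp (Tt : Matrix (Fin n × Fin n) (Fin n × Fin n) ℂ) (u v : ℝ) (l : G.edgeSet × Mark) :
    Matrix (V → Fin n) (V → Fin n) ℂ :=
  pairOp (markOp Tt u v l.2) (Quot.out (l.1 : Sym2 V)).1 (Quot.out (l.1 : Sym2 V)).2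

/-- Invariance of a two-site operator under exchange of the two sites. -/
def SwapInvariant (M : Matrix (Fin n × Fin n) (Fin n × Fin n) ℂ) : Prop :=
  ∀ a b, M a.swap b.swap = M a b

theorem swapInvariant_crossT : SwapInvariant (crossT n) := by
  intro a b
  rw [crossT_apply, crossT_apply]
  simp only [Prod.fst_swap, Prod.snd_swap, and_comm, add_comm]

theorem SwapInvariant.smul {M : Matrix (Fin n × Fin n) (Fin n × Fin n) ℂ}
    (h : SwapInvariant M) (a : ℂ) : SwapInvariant (a • M) := fun i j => by
  simp [h i j]

theorem SwapInvariant.neg {M : Matrix (Fin n × Fin n) (Fin n × Fin n) ℂ}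
    (h : SwapInvariant M) : SwapInvariant (-M) := fun i j => by
  simp [h i j]

theorem swapInvariant_projQ : SwapInvariant (projQ n) := fun a b => by
  simp only [projQ, Prod.fst_swap, Prod.snd_swap, eq_comm]

theorem SwapInvariant.markOp {Tt : Matrix (Fin n × Fin n) (Fin n × Fin n) ℂ}
    (h : SwapInvariant Tt) (u v : ℝ) (m : Mark) : SwapInvariant (markOp Tt u v m) := by
  cases m
  · exact (h.smul _).neg
  · exact (swapInvariant_projQ.smul _).neg

theorem linkOp_eq {Tt : Matrix (Fin n × Fin n) (Fin n × Fin n) ℂ} (h : SwapInvariant Tt)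
    (u v : ℝ) (l : G.edgeSet × Mark) {x y : V} (hl : (l.1 : Sym2 V) = s(x, y)) :
    linkOp Tt u v l = pairOp (markOp Tt u v l.2) x y := by
  unfold linkOp
  have : s((Quot.out (l.1 : Sym2 V)).1, (Quot.out (l.1 : Sym2 V)).2) = s(x, y) := by
    rw [← hl]; exact Quot.out_eq _
  rcases Sym2.eq_iff.1 this with ⟨h1, h2⟩ | ⟨h1, h2⟩
  · rw [h1, h2]
  · rw [h1, h2, pairOp_comm _ (h.markOp u v l.2)]

variable [DecidableRel G.Adj]

theorem sum_adj_eq_sum_edges {M : Type*} [AddCommMonoid M] (f : V → V → M) (g : G.edgeSet → M)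
    (hg : ∀ x y (h : G.Adj x y), f x y = g ⟨s(x, y), h⟩) :
    ∑ x, ∑ y, (if G.Adj x y then f x y else 0) = 2 • ∑ e, g e := by
  classical
  have h1 : ∑ x, ∑ y, (if G.Adj x y then f x y else 0) = ∑ d : G.Dart, f d.fst d.snd := by
    rw [← Finset.sum_product', ← Finset.sum_filter]
    refine (Finset.sum_bij (fun (d : G.Dart) _ => d.toProd) ?_ ?_ ?_ ?_).symm
    · intro d _; simp
    · intro d _ d' _ h; exact SimpleGraph.Dart.ext _ _ h
    · intro p hp; exact ⟨⟨p, by simpa using hp⟩, Finset.mem_univ _, rfl⟩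
    · intro d _; rfl
  rw [h1, ← Finset.sum_fiberwise Finset.univ (fun d : G.Dart => (⟨d.edge, d.edge_mem⟩ : G.edgeSet)),
    Finset.smul_sum]
  refine Finset.sum_congr rfl fun e _ => ?_
  obtain ⟨e, he⟩ := e
  induction e using Sym2.ind with
  | _ x y =>
    have hadj : G.Adj x y := he
    have hf : (Finset.univ.filter fun d : G.Dart =>
        (⟨d.edge, d.edge_mem⟩ : G.edgeSet) = ⟨s(x, y), he⟩) =
        {(⟨(x, y), hadj⟩ : G.Dart), (⟨(x, y), hadj⟩ : G.Dart).symm} := by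
      rw [← SimpleGraph.Dart.edge_fiber]
      ext d
      simp only [Finset.mem_filter, Finset.mem_univ, true_and, Subtype.ext_iff]
      exact Iff.rfl
    rw [hf, Finset.sum_pair (SimpleGraph.Dart.symm_ne _).symm]
    change f x y + f y x = _
    rw [hg x y hadj, hg y x hadj.symm, two_smul]
    simp only [Sym2.eq_swap]

theorem neg_hamiltonian_eq {Tt : Matrix (Fin n × Fin n) (Fin n × Fin n) ℂ} (h : SwapInvariant Tt)
    (u v : ℝ) : -hamiltonian G Tt u v = ∑ l : G.edgeSet × Mark, linkOp Tt u v l := by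
  have key : ∑ x, ∑ y, (if G.Adj x y then pairOp ((u : ℂ) • Tt + (v : ℂ) • projQ n) x y else 0) =
      2 • ∑ e : G.edgeSet, -(∑ m : Mark, linkOp Tt u v (e, m)) := by
    refine sum_adj_eq_sum_edges _ _ fun x y hxy => ?_
    have : (Finset.univ : Finset Mark) = {Mark.cross, Mark.dbar} := rfl
    rw [this, Finset.sum_pair (by decide), linkOp_eq h u v _ rfl, linkOp_eq h u v _ rfl,
      ← pairOp_add]
    ext σ τ
    simp only [markOp, pairOp, Matrix.neg_apply, Matrix.add_apply]
    split_ifs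
    · ring
    · simp
  unfold hamiltonian
  rw [key, Finset.sum_neg_distrib, Fintype.sum_prod_type]
  module

theorem boltzmann_eq {Tt : Matrix (Fin n × Fin n) (Fin n × Fin n) ℂ} (h : SwapInvariant Tt)
    (β u v : ℝ) : boltzmann G Tt β u v =
      NormedSpace.exp (((2 * β : ℝ) : ℂ) • ∑ l : G.edgeSet × Mark, linkOp Tt u v l) := by
  rw [← neg_hamiltonian_eq h, boltzmann]
  congr 1
  module

end LinkOperators

/-! ### The measure on configurations -/

section Generic

variable {V : Type*} {G : SimpleGraph V} {β : ℝ}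

/-- The representative in `[0, 2β)` of a time. -/
def timeRep [Fact (0 < 2 * β)] (t : AddCircle (2 * β)) : ℝ := (AddCircle.equivIco (2 * β) 0 t : ℝ)

/-- The configuration with the links `e j` at the times `r j`. -/
def timedConfig (β : ℝ) {k : ℕ} (e : Fin k → G.edgeSet × Mark) (r : Fin k → ℝ) : Config G β :=
  haveI := Classical.decEq (Link G β)
  Finset.univ.image fun j => (e j, (r j : AddCircle (2 * β)))

/-- The permutation that sorts the links of an enumerated configuration by their times. -/
def sortPerm [Fact (0 < 2 * β)] {k : ℕ} (t : Fin k → AddCircle (2 * β)) : Equiv.Perm (Fin k) :=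
  Tuple.sort fun j => timeRep (t j)

variable [Fact (0 < 2 * β)]

theorem coe_timeRep (t : AddCircle (2 * β)) : ((timeRep t : ℝ) : AddCircle (2 * β)) = t :=
  AddCircle.coe_equivIco

theorem timeRep_injective : Function.Injective (timeRep (β := β)) := fun s t h => by
  rw [← coe_timeRep s, h, coe_timeRep]

theorem timeRep_nonneg (t : AddCircle (2 * β)) : 0 ≤ timeRep t :=
  (AddCircle.equivIco (2 * β) 0 t).2.1

theorem timeRep_lt (t : AddCircle (2 * β)) : timeRep t < 2 * β := by
  have h := (AddCircle.equivIco (2 * β) 0 t).2.2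
  exact h.trans_eq (zero_add _)

theorem measurable_timeRep : Measurable (timeRep (β := β)) :=
  measurable_subtype_coe.comp (AddCircle.measurableEquivIco (2 * β) 0).measurable

theorem config_eq_timedConfig [DecidableEq V] {k : ℕ} (p : Fin k → Link G β) :
    Enumerated.config ⟨k, p⟩ = timedConfig β
      (fun j => (p (sortPerm (fun i => (p i).2) j)).1)
      (fun j => timeRep (p (sortPerm (fun i => (p i).2) j)).2) := by
  classical
  ext l
  simp only [Enumerated.config, timedConfig, Finset.mem_image, Finset.mem_univ, true_and,
    coe_timeRep]
  exact (sortPerm fun i => (p i).2).surjective.exists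

theorem sorted_strictMono {k : ℕ} {t : Fin k → AddCircle (2 * β)} (ht : Function.Injective t) :
    StrictMono fun j => timeRep (t (sortPerm t j)) :=
  (Tuple.monotone_sort fun j => timeRep (t j)).strictMono_of_injective
    ((timeRep_injective.comp ht).comp (sortPerm t).injective)

theorem measurable_sortPerm {k : ℕ} {M : Type*} [MeasurableSpace M] (Φ : Equiv.Perm (Fin k) → M) :
    Measurable fun t : Fin k → AddCircle (2 * β) => Φ (sortPerm t) := by
  let _ : MeasurableSpace (Equiv.Perm (Fin k)) := ⊤
  have h : Measurable fun t : Fin k → AddCircle (2 * β) => sortPerm t := by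
    refine measurable_to_countable' fun σ => ?_
    have : (fun t : Fin k → AddCircle (2 * β) => sortPerm t) ⁻¹' {σ} =
        (⋂ i : Fin k, ⋂ j : Fin k, ⋂ _ : i ≤ j, {t | timeRep (t (σ i)) ≤ timeRep (t (σ j))}) ∩
        (⋂ i : Fin k, ⋂ j : Fin k, ⋂ _ : i < j,
          ({t | timeRep (t (σ i)) = timeRep (t (σ j))}ᶜ ∪ {_t | σ i < σ j})) := by
      ext t
      simp only [Set.mem_preimage, Set.mem_singleton_iff, Set.mem_inter_iff, Set.mem_iInter,
        Set.mem_ofPred_eq, Set.mem_union, Set.mem_compl_iff]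
      rw [eq_comm, sortPerm, Tuple.eq_sort_iff]
      refine and_congr Iff.rfl ?_
      exact forall₃_congr fun i j _ => imp_iff_not_or
    rw [this]
    have hm : ∀ i : Fin k, Measurable fun t : Fin k → AddCircle (2 * β) => timeRep (t i) :=
      fun i => measurable_timeRep.comp (measurable_pi_apply i)
    refine MeasurableSet.inter ?_ ?_
    · exact MeasurableSet.iInter fun i => MeasurableSet.iInter fun j => MeasurableSet.iInter
        fun _ => measurableSet_le (hm _) (hm _)
    · exact MeasurableSet.iInter fun i => MeasurableSet.iInter fun j => MeasurableSet.iInter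
        fun _ => (measurableSet_eq_fun (hm _) (hm _)).compl.union (MeasurableSet.const _)
  exact (measurable_from_top (f := Φ)).comp h

variable (G β) in
instance [Finite G.edgeSet] : IsFiniteMeasure (linkVolume G β) := by
  unfold linkVolume; infer_instance

theorem volume_singleton (a : AddCircle (2 * β)) :
    (volume : Measure (AddCircle (2 * β))) {a} = 0 := by
  simpa using AddCircle.volume_closedBall (T := 2 * β) (x := a) 0

theorem ae_link_time_ne [Finite G.edgeSet] (a : AddCircle (2 * β)) :
    ∀ᵐ l ∂linkVolume G β, l.2 ≠ a := by
  have : {l : Link G β | ¬ l.2 ≠ a} = Set.univ ×ˢ {a} := by ext; simp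
  rw [ae_iff, this, linkVolume, Measure.prod_prod, volume_singleton, mul_zero]

theorem ae_times_ne [Finite G.edgeSet] (k : ℕ) (a : AddCircle (2 * β)) :
    ∀ᵐ p ∂(Measure.pi fun _ : Fin k => linkVolume G β), ∀ i, (p i).2 ≠ a :=
  ae_all_iff.2 fun i => (Measure.quasiMeasurePreserving_eval (fun _ : Fin k => linkVolume G β)
    i).ae (ae_link_time_ne a)

theorem ae_times_injective [Finite G.edgeSet] (k : ℕ) :
    ∀ᵐ p ∂(Measure.pi fun _ : Fin k => linkVolume G β), Function.Injective fun i => (p i).2 := by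
  have key : ∀ i j : Fin k, i ≠ j →
      ∀ᵐ p ∂(Measure.pi fun _ : Fin k => linkVolume G β), (p i).2 ≠ (p j).2 := by
    intro i j hij
    cases k with
    | zero => exact i.elim0
    | succ m =>
      obtain ⟨j', rfl⟩ := Fin.exists_succAbove_eq hij.symm
      have hmp := measurePreserving_piFinSuccAbove (fun _ : Fin (m + 1) => linkVolume G β) i
      have hset : MeasurableSet {q : Link G β × (Fin m → Link G β) | q.1.2 = (q.2 j').2} :=
        measurableSet_eq_fun (by fun_prop) (by fun_prop)
      have hnull : ∀ᵐ q ∂((linkVolume G β).prod (Measure.pi fun _ : Fin m => linkVolume G β)),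
          q.1.2 ≠ (q.2 j').2 := by
        rw [ae_iff]
        simp only [not_not]
        rw [Measure.measure_prod_null hset]
        refine Filter.Eventually.of_forall fun a => ?_
        have := ae_times_ne (G := G) m a.2
        refine measure_mono_null ?_ (ae_iff.1 this)
        intro q hq
        simp only [Set.mem_preimage, Set.mem_ofPred_eq] at hq ⊢
        push Not
        exact ⟨j', hq.symm⟩
      exact hmp.quasiMeasurePreserving.ae hnull
  have h := ae_all_iff.2 fun i => ae_all_iff.2 fun j => ae_all_iff.2 fun hij => key i j hij
  filter_upwards [h] with p hp i j hij
  by_contra hne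
  exact hp i j hne hij

/-- Almost every configuration has distinct non-zero link times. -/
theorem ae_generic [Finite G.edgeSet] (k : ℕ) :
    ∀ᵐ p ∂(Measure.pi fun _ : Fin k => linkVolume G β),
      (StrictMono fun j => timeRep (p (sortPerm (fun i => (p i).2) j)).2) ∧
      ∀ j, timeRep (p (sortPerm (fun i => (p i).2) j)).2 ∈ Set.Ioo 0 (2 * β) := by
  filter_upwards [ae_times_ne k 0, ae_times_injective k] with p h0 hinj
  refine ⟨sorted_strictMono hinj, fun j => ⟨lt_of_le_of_ne (timeRep_nonneg _) fun h => ?_,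
    timeRep_lt _⟩⟩
  apply h0 (sortPerm (fun i => (p i).2) j)
  rw [← coe_timeRep (p _).2, ← h]
  rfl

theorem pi_count (k : ℕ) {κ : Type*} [Finite κ] [MeasurableSpace κ] [DiscreteMeasurableSpace κ] :
    (Measure.pi fun _ : Fin k => (Measure.count : Measure κ)) = Measure.count := by
  have := Fintype.ofFinite κ
  refine Measure.ext_of_singleton fun f => ?_
  rw [Measure.pi_singleton]
  simp

/-- For functions of the time-ordered sequence of marked edges, integration over the links amounts
to summation over these sequences. -/
theorem integral_sorted [Fintype G.edgeSet] (k : ℕ) {E : Type*} [NormedAddCommGroup E]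
    [NormedSpace ℝ E] [CompleteSpace E] [MeasurableSpace E] [BorelSpace E]
    [SecondCountableTopology E] (Φ : (Fin k → G.edgeSet × Mark) → E) :
    Integrable (fun p : Fin k → Link G β => Φ fun j => (p (sortPerm (fun i => (p i).2) j)).1)
      (Measure.pi fun _ => linkVolume G β) ∧
    ∫ p, Φ (fun j => (p (sortPerm (fun i => (p i).2) j)).1)
      ∂(Measure.pi fun _ : Fin k => linkVolume G β) = (2 * β) ^ k • ∑ e, Φ e := by
  have hpos : 0 < 2 * β := Fact.out
  have hmp := measurePreserving_arrowProdEquivProdArrow (G.edgeSet × Mark) (AddCircle (2 * β))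
    (Fin k) (fun _ => Measure.count) (fun _ => volume)
  set g : (Fin k → G.edgeSet × Mark) × (Fin k → AddCircle (2 * β)) → E :=
    fun q => Φ fun j => q.1 (sortPerm q.2 j) with hg
  have hgm : Measurable g := measurable_from_prod_countable_right fun e =>
    measurable_sortPerm fun σ => Φ fun j => e (σ j)
  obtain ⟨C, hC⟩ : ∃ C, ∀ e, ‖Φ e‖ ≤ C := by
    obtain ⟨C, hC⟩ := (Set.finite_range fun e => ‖Φ e‖).bddAbove
    exact ⟨C, fun e => hC ⟨e, rfl⟩⟩
  have hgi : Integrable g ((Measure.pi fun _ : Fin k => Measure.count).prod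
      (Measure.pi fun _ : Fin k => volume)) :=
    Integrable.of_bound hgm.aestronglyMeasurable C (Filter.Eventually.of_forall fun q => hC _)
  refine ⟨(hmp.integrable_comp hgm.aestronglyMeasurable).2 hgi, ?_⟩
  refine (hmp.integral_comp' g).trans ?_
  rw [integral_prod_symm _ hgi]
  have : ∀ t : Fin k → AddCircle (2 * β),
      ∫ e, g (e, t) ∂(Measure.pi fun _ : Fin k => Measure.count) = ∑ e, Φ e := by
    intro t
    rw [pi_count, integral_count]
    exact Fintype.sum_equiv ((sortPerm t).symm.arrowCongr (Equiv.refl _)) _ _ fun e => rfl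
  simp only [this, integral_const]
  congr 1
  rw [measureReal_def, Measure.pi_univ]
  simp only [AddCircle.measure_univ, Finset.prod_const, Finset.card_univ, Fintype.card_fin,
    ENNReal.toReal_pow, ENNReal.toReal_ofReal hpos.le]

end Generic

/-! ### The expansion of the exponential -/

section Expansion

open scoped Matrix.Norms.Operator

variable {ι : Type*} [Fintype ι] [DecidableEq ι]

theorem sum_prod_ofFn {R κ : Type*} [Semiring R] [Fintype κ] (A : κ → R) (k : ℕ) :
    ∑ e : Fin k → κ, (List.ofFn fun j => A (e j)).prod = (∑ l, A l) ^ k := by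
  induction k with
  | zero => simp
  | succ k ih =>
    rw [pow_succ', ← ih, Finset.sum_mul_sum, ← Fintype.sum_prod_type']
    refine Fintype.sum_equiv (Fin.consEquiv fun _ => κ).symm _ _ fun e => ?_
    rw [List.ofFn_succ, List.prod_cons]
    rfl

theorem exists_norm_le_of_finiteDimensional {E : Type*} [NormedAddCommGroup E] [NormedSpace ℂ E]
    [FiniteDimensional ℂ E] (f : E →ₗ[ℂ] ℂ) : ∃ C, 0 ≤ C ∧ ∀ x, ‖f x‖ ≤ C * ‖x‖ :=
  ⟨‖LinearMap.toContinuousLinearMap f‖, norm_nonneg _,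
    fun x => (LinearMap.toContinuousLinearMap f).le_opNorm x⟩

/-- The traces of the ordered products of `k` factors, summed over all products, grow at most
exponentially in `k`. With the factor `1 / k!` they are summable. -/
theorem exists_bound_trace {κ : Type*} [Fintype κ] (A : κ → Matrix ι ι ℂ) (B : Matrix ι ι ℂ) :
    ∃ C a : ℝ, ∀ k, ∑ e : Fin k → κ, ‖(B * (List.ofFn fun j => A (e j)).prod).trace‖ ≤
      C * a ^ k := by
  obtain ⟨K, hK0, hK⟩ := exists_norm_le_of_finiteDimensional (Matrix.traceLinearMap ι ℂ ℂ)
  refine ⟨K * ‖B‖ * ‖(1 : Matrix ι ι ℂ)‖, ∑ l, ‖A l‖, fun k => ?_⟩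
  have hp : ∀ L : List (Matrix ι ι ℂ), ‖L.prod‖ ≤ ‖(1 : Matrix ι ι ℂ)‖ * (L.map norm).prod := by
    intro L
    induction L with
    | nil => simp
    | cons a L ih =>
      rw [List.prod_cons, List.map_cons, List.prod_cons]
      calc ‖a * L.prod‖ ≤ ‖a‖ * ‖L.prod‖ := norm_mul_le _ _
        _ ≤ ‖a‖ * (‖(1 : Matrix ι ι ℂ)‖ * (L.map norm).prod) := by gcongr
        _ = _ := by ring
  rw [← sum_prod_ofFn, Finset.mul_sum]
  refine Finset.sum_le_sum fun e _ => ?_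
  calc _ ≤ K * ‖B * (List.ofFn fun j => A (e j)).prod‖ := hK _
    _ ≤ K * (‖B‖ * (‖(1 : Matrix ι ι ℂ)‖ *
        ((List.ofFn fun j => A (e j)).map norm).prod)) := by
        gcongr
        exact (norm_mul_le _ _).trans (by gcongr; exact hp _)
    _ = _ := by rw [List.map_ofFn]; simp only [Function.comp_def]; ring

theorem hasSum_trace_exp (B S : Matrix ι ι ℂ) :
    HasSum (fun k : ℕ => ((k.factorial : ℂ)⁻¹) * (B * S ^ k).trace)
      (B * NormedSpace.exp S).trace := by
  set T : Matrix ι ι ℂ →L[ℂ] ℂ := LinearMap.toContinuousLinearMap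
    ((Matrix.traceLinearMap ι ℂ ℂ).comp (LinearMap.mulLeft ℂ B))
  have hT : ∀ M, T M = (B * M).trace := fun _ => rfl
  have h := (NormedSpace.exp_series_hasSum_exp' (𝕂 := ℂ) S).mapL T
  simp only [hT, mul_smul_comm, Matrix.trace_smul, smul_eq_mul] at h
  exact h

end Expansion

section Dyson

variable {V : Type*} [DecidableEq V] {G : SimpleGraph V} {β : ℝ} [Fact (0 < 2 * β)]
variable {ι : Type*} [Fintype ι] [DecidableEq ι]

omit [DecidableEq V] [Fact (0 < 2 * β)] in
theorem measurableEmbedding_sigmaMk (k : ℕ) :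
    MeasurableEmbedding fun p : Fin k → Link G β => (⟨k, p⟩ : Enumerated G β) where
  injective := sigma_mk_injective (β := fun k : ℕ => Fin k → Link G β)
  measurable := by
    refine measurable_iff_le_map.2 ?_
    exact iInf_le (fun k : ℕ => (inferInstance : MeasurableSpace (Fin k → Link G β)).map
      (Sigma.mk k)) k
  measurableSet_image' := by
    intro s hs
    refine MeasurableSpace.measurableSet_iInf.2 fun j => ?_
    change MeasurableSet ((fun q : Fin j → Link G β => (⟨j, q⟩ : Enumerated G β)) ⁻¹' _)
    by_cases h : j = k
    · subst h
      rwa [Set.preimage_image_eq _ (sigma_mk_injective (β := fun k : ℕ => Fin k → Link G β))]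
    · convert MeasurableSet.empty
      ext p
      simp only [Set.mem_preimage, Set.mem_image, Sigma.mk.injEq, Set.mem_empty_iff_false,
        iff_false]
      rintro ⟨q, -, hq, -⟩
      exact h hq.symm

/-- If a function of configurations is given on time-ordered configurations by the trace of the
ordered product of matrices attached to the links, then its integral is the trace of the
exponential of the sum of these matrices. The order of the product matters only for fixed times:
after summation over the marked edges, every arrangement of times contributes a power of the
sum. -/
theorem integral_configMeasure_eq_trace [Fintype G.edgeSet]
    (A : G.edgeSet × Mark → Matrix ι ι ℂ) (B : Matrix ι ι ℂ) (F : Config G β → ℝ)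
    (hF : ∀ (k : ℕ) (e : Fin k → G.edgeSet × Mark) (r : Fin k → ℝ), StrictMono r →
      (∀ j, r j ∈ Set.Ioo 0 (2 * β)) →
      ((F (timedConfig β e r) : ℝ) : ℂ) = (B * (List.ofFn fun j => A (e j)).prod).trace) :
    Integrable (fun p : Enumerated G β => F p.config) (configMeasure G β) ∧
      (((∫ p, F p.config ∂(configMeasure G β) : ℝ) : ℂ)) =
        (B * NormedSpace.exp (((2 * β : ℝ) : ℂ) • ∑ l, A l)).trace := by
  have hpos : 0 < 2 * β := Fact.out
  set W : (k : ℕ) → (Fin k → G.edgeSet × Mark) → ℂ :=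
    fun k e => (B * (List.ofFn fun j => A (e j)).prod).trace with hW
  have hae : ∀ k, (fun p : Fin k → Link G β => ((F (Enumerated.config ⟨k, p⟩) : ℝ) : ℂ)) =ᵐ[
      Measure.pi fun _ => linkVolume G β]
      fun p => W k fun j => (p (sortPerm (fun i => (p i).2) j)).1 := by
    intro k
    filter_upwards [ae_generic k] with p hp
    rw [config_eq_timedConfig, hF k _ _ hp.1 hp.2]
  have hint : ∀ k, Integrable (fun p : Fin k → Link G β =>
      ((F (Enumerated.config ⟨k, p⟩) : ℝ) : ℂ)) (Measure.pi fun _ => linkVolume G β) :=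
    fun k => (integrable_congr (hae k)).2 (integral_sorted k (W k)).1
  have hval : ∀ k, ∫ p : Fin k → Link G β, ((F (Enumerated.config ⟨k, p⟩) : ℝ) : ℂ)
      ∂(Measure.pi fun _ => linkVolume G β) = (2 * β) ^ k • (B * (∑ l, A l) ^ k).trace := by
    intro k
    rw [integral_congr_ae (hae k), (integral_sorted k (W k)).2, ← sum_prod_ofFn,
      Finset.mul_sum, Matrix.trace_sum]
  have hnorm : ∀ k, ∫ p : Fin k → Link G β, ‖((F (Enumerated.config ⟨k, p⟩) : ℝ) : ℂ)‖
      ∂(Measure.pi fun _ => linkVolume G β) = (2 * β) ^ k • ∑ e, ‖W k e‖ := by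
    intro k
    rw [← (integral_sorted k fun e => ‖W k e‖).2]
    refine integral_congr_ae ?_
    filter_upwards [hae k] with p hp
    rw [hp]
  have hcint : Integrable (fun p : Enumerated G β => ((F p.config : ℝ) : ℂ))
      (configMeasure G β) := by
    refine integrable_sum_measure_iff.2 ⟨fun k => ?_, ?_⟩
    · exact (((measurableEmbedding_sigmaMk k).integrable_map_iff).2 (hint k)).smul_measure
        (ENNReal.inv_ne_top.2 (by exact_mod_cast k.factorial_ne_zero))
    · obtain ⟨C, a, hC⟩ := exists_bound_trace A B
      refine Summable.of_nonneg_of_le (fun k => by positivity) (fun k => ?_)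
        ((Real.summable_pow_div_factorial (2 * β * a)).mul_left C)
      rw [integral_smul_measure, (measurableEmbedding_sigmaMk k).integral_map, hnorm,
        ENNReal.toReal_inv, ENNReal.toReal_natCast, smul_eq_mul, smul_eq_mul]
      calc _ ≤ ((k.factorial : ℝ))⁻¹ * ((2 * β) ^ k * (C * a ^ k)) := by
            gcongr; exact hC k
        _ = _ := by rw [mul_pow]; ring
  refine ⟨?_, ?_⟩
  · simpa using hcint.re
  · rw [← integral_complex_ofReal]
    have hs := hasSum_trace_exp B (((2 * β : ℝ) : ℂ) • ∑ l, A l)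
    refine HasSum.unique (f := fun k : ℕ => ((k.factorial : ℂ)⁻¹) *
      (B * (((2 * β : ℝ) : ℂ) • ∑ l, A l) ^ k).trace) ?_ hs
    have h := hasSum_integral_measure hcint
    refine h.congr_fun fun k => ?_
    rw [integral_smul_measure, (measurableEmbedding_sigmaMk k).integral_map, hval, smul_pow,
      mul_smul_comm, Matrix.trace_smul, ENNReal.toReal_inv, ENNReal.toReal_natCast]
    simp

end Dyson

/-! ### Permutations reversed by an involution -/

section Reversal

variable {D : Type*} {P : Equiv.Perm D} {J R : D → D}

/-- A permutation `P = R ∘ J` that is a product of two fixed-point free involutions. The involution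
`R` reverses the orientation of the cycles of `P`. -/
structure Reversible (P : Equiv.Perm D) (J R : D → D) : Prop where
  apply_eq : ∀ a, P a = R (J a)
  J_invol : ∀ a, J (J a) = a
  R_invol : ∀ a, R (R a) = a
  J_ne : ∀ a, J a ≠ a
  R_ne : ∀ a, R a ≠ a

namespace Reversible

theorem symm_apply (h : Reversible P J R) (a : D) : P.symm a = J (R a) := by
  rw [Equiv.symm_apply_eq, h.apply_eq, h.J_invol, h.R_invol]

theorem R_apply (h : Reversible P J R) (a : D) : R (P a) = P.symm (R a) := by
  rw [h.symm_apply, h.R_invol, h.apply_eq, h.R_invol]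

theorem R_symm_apply (h : Reversible P J R) (a : D) : R (P.symm a) = P (R a) := by
  rw [h.symm_apply, h.apply_eq]

theorem R_zpow (h : Reversible P J R) (m : ℤ) (a : D) : R ((P ^ m) a) = (P ^ (-m)) (R a) := by
  induction m generalizing a with
  | zero => simp
  | succ m ih =>
    rw [zpow_add_one, Equiv.Perm.mul_apply, ih, h.R_apply, neg_add, zpow_add,
      Equiv.Perm.mul_apply]
    rfl
  | pred m ih =>
    rw [zpow_sub_one, Equiv.Perm.mul_apply, ih]
    change (P ^ _) (R (P.symm a)) = _
    rw [h.R_symm_apply, neg_sub, sub_neg_eq_add, add_comm, zpow_add, Equiv.Perm.mul_apply, neg_neg,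
      ← Equiv.Perm.mul_apply, ← Equiv.Perm.mul_apply, zpow_one,
      (Commute.zpow_self P _).eq]

theorem sameCycle_R (h : Reversible P J R) {a b : D} (hab : P.SameCycle a b) :
    P.SameCycle (R a) (R b) := by
  obtain ⟨m, rfl⟩ := hab
  exact ⟨-m, (h.R_zpow m a).symm⟩

theorem sameCycle_R_iff (h : Reversible P J R) {a b : D} :
    P.SameCycle (R a) (R b) ↔ P.SameCycle a b :=
  ⟨fun hab => by simpa [h.R_invol] using h.sameCycle_R hab, h.sameCycle_R⟩

theorem sameCycle_R_comm (h : Reversible P J R) {a b : D} :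
    P.SameCycle (R a) b ↔ P.SameCycle a (R b) := by
  rw [← h.sameCycle_R_iff, h.R_invol]

/-- No cycle is its own reversal: in the middle of the way from `a` to `R a` there would be a fixed
point of one of the two involutions. -/
theorem not_sameCycle_R (h : Reversible P J R) (a : D) : ¬ P.SameCycle a (R a) := by
  rintro ⟨m, hm⟩
  have key : ∀ p : ℤ, R ((P ^ p) a) = (P ^ (m - p)) a := by
    intro p
    rw [h.R_zpow, ← hm, ← Equiv.Perm.mul_apply, ← zpow_add, neg_add_eq_sub]
  rcases Int.even_or_odd' m with ⟨p, hp | hp⟩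
  · refine h.R_ne ((P ^ p) a) ?_
    rw [key, hp]; congr 2; ring
  · refine h.J_ne ((P ^ p) a) ?_
    have h1 : R ((P ^ p) a) = P ((P ^ p) a) := by
      rw [key, ← Equiv.Perm.mul_apply, ← zpow_one_add, hp]; congr 2; ring
    rw [h.apply_eq] at h1
    have h2 := congrArg R h1
    rw [h.R_invol, h.R_invol] at h2
    exact h2.symm

end Reversible

end Reversal

/-! ### Counting colourings of loops -/

section Colourings

variable {D : Type*} {P : Equiv.Perm D} {J R : D → D} {Λ : Type*}

/-- The map `ℓ` classifies the states by their unoriented loops, and `rep` chooses a state, hence an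
orientation, for each loop. -/
structure LoopIndex (P : Equiv.Perm D) (R : D → D) (ℓ : D → Λ) (rep : Λ → D) : Prop where
  ell_rep : ∀ l, ℓ (rep l) = l
  ell_eq_iff : ∀ a b, ℓ a = ℓ b ↔ P.SameCycle a b ∨ P.SameCycle a (R b)

variable {ℓ : D → Λ} {rep : Λ → D}

namespace LoopIndex

theorem sameCycle_or (hℓ : LoopIndex P R ℓ rep) (a : D) :
    P.SameCycle (rep (ℓ a)) a ∨ P.SameCycle (rep (ℓ a)) (R a) :=
  (hℓ.ell_eq_iff _ _).1 (hℓ.ell_rep _)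

theorem sameCycle_rep_R_iff (hℓ : LoopIndex P R ℓ rep) (h : Reversible P J R) (a : D) :
    P.SameCycle (rep (ℓ a)) (R a) ↔ ¬ P.SameCycle (rep (ℓ a)) a :=
  ⟨fun h1 h2 => h.not_sameCycle_R a (h2.symm.trans h1),
    fun h1 => (hℓ.sameCycle_or a).resolve_left h1⟩

theorem ell_eq_of_sameCycle (hℓ : LoopIndex P R ℓ rep) {a b : D} (hab : P.SameCycle a b) :
    ℓ a = ℓ b := (hℓ.ell_eq_iff _ _).2 (Or.inl hab)

theorem ell_R (hℓ : LoopIndex P R ℓ rep) (a : D) : ℓ (R a) = ℓ a :=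
  (hℓ.ell_eq_iff _ _).2 (Or.inr (Equiv.Perm.SameCycle.refl _ _))

end LoopIndex

/-- A colouring of the states with `n` colours that is constant along oriented trajectories and
reversed when the orientation is reversed. -/
def IsColouring (P : Equiv.Perm D) (R : D → D) {n : ℕ} (f : D → Fin n) : Prop :=
  (∀ a, f (P a) = f a) ∧ ∀ a, f (R a) = Fin.rev (f a)

theorem IsColouring.sameCycle {n : ℕ} {f : D → Fin n} (hf : IsColouring P R f) {a b : D}
    (hab : P.SameCycle a b) : f a = f b := by
  obtain ⟨m, rfl⟩ := hab
  induction m with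
  | zero => simp
  | succ m ih => rw [add_comm, zpow_one_add, Equiv.Perm.mul_apply, hf.1, ih]
  | pred m ih =>
    rw [ih, ← hf.1 ((P ^ (-(m : ℤ) - 1)) a), ← Equiv.Perm.mul_apply, ← zpow_one_add]
    congr 3; ring

open Classical in
/-- The colour of a state, given the colours of the oriented loops. -/
def colourOf (P : Equiv.Perm D) (ℓ : D → Λ) (rep : Λ → D) {n : ℕ} (g : Λ → Fin n) (a : D) : Fin n :=
  if P.SameCycle (rep (ℓ a)) a then g (ℓ a) else Fin.rev (g (ℓ a))

theorem isColouring_colourOf (h : Reversible P J R) (hℓ : LoopIndex P R ℓ rep) {n : ℕ}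
    (g : Λ → Fin n) : IsColouring P R (colourOf P ℓ rep g) := by
  refine ⟨fun a => ?_, fun a => ?_⟩
  · have : ℓ (P a) = ℓ a := hℓ.ell_eq_of_sameCycle
      (Equiv.Perm.sameCycle_apply_left.2 (Equiv.Perm.SameCycle.refl _ _))
    unfold colourOf
    rw [this]
    by_cases hc : P.SameCycle (rep (ℓ a)) a
    · rw [if_pos hc, if_pos (Equiv.Perm.sameCycle_apply_right.2 hc)]
    · rw [if_neg hc, if_neg (mt Equiv.Perm.sameCycle_apply_right.1 hc)]
  · unfold colourOf
    rw [hℓ.ell_R]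
    by_cases hc : P.SameCycle (rep (ℓ a)) a
    · rw [if_pos hc, if_neg fun h' => (hℓ.sameCycle_rep_R_iff h a).1 h' hc]
    · rw [if_neg hc, if_pos ((hℓ.sameCycle_rep_R_iff h a).2 hc), Fin.rev_rev]

/-- Colourings correspond to arbitrary assignments of colours to the oriented loops. -/
def colouringEquiv (h : Reversible P J R) (hℓ : LoopIndex P R ℓ rep) (n : ℕ) :
    {f : D → Fin n // IsColouring P R f} ≃ (Λ → Fin n) where
  toFun f l := f.1 (rep l)
  invFun g := ⟨colourOf P ℓ rep g, isColouring_colourOf h hℓ g⟩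
  left_inv f := by
    refine Subtype.ext (funext fun a => ?_)
    change colourOf P ℓ rep (fun l => f.1 (rep l)) a = f.1 a
    unfold colourOf
    split_ifs with h1
    · exact f.2.sameCycle h1
    · change Fin.rev (f.1 (rep (ℓ a))) = _
      rw [f.2.sameCycle ((hℓ.sameCycle_or a).resolve_left h1), f.2.2, Fin.rev_rev]
  right_inv g := by
    refine funext fun l => ?_
    simp [colourOf, hℓ.ell_rep, Equiv.Perm.SameCycle.refl]

theorem sum_spinValue (n : ℕ) : ∑ a, spinValue n a = 0 := by
  have h : ∑ a, spinValue n a = ∑ a, -spinValue n a := by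
    rw [← Equiv.sum_comp Fin.revPerm]
    exact Finset.sum_congr rfl fun a _ => spinValue_rev n a
  rw [Finset.sum_neg_distrib] at h
  linarith

theorem sum_spinValue_sq (n : ℕ) :
    ∑ a, spinValue n a * spinValue n a = n * (((n : ℝ) ^ 2 - 1) / 12) := by
  have h : ∀ m : ℕ, ∀ b : ℝ, ∑ a ∈ Finset.range m, ((a : ℝ) - b) * ((a : ℝ) - b) =
      m * (m - 1) * (2 * m - 1) / 6 - b * (m * (m - 1)) + m * b ^ 2 := by
    intro m b
    induction m with
    | zero => simp
    | succ m ih => rw [Finset.sum_range_succ, ih]; push_cast; ring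
  unfold spinValue
  rw [Fin.sum_univ_eq_sum_range (fun a : ℕ => ((a : ℝ) - ((n : ℝ) - 1) / 2) *
    ((a : ℝ) - ((n : ℝ) - 1) / 2)) n, h]
  ring

variable [Fintype Λ]

theorem card_colourings (h : Reversible P J R)
    (hℓ : LoopIndex P R ℓ rep) (n : ℕ) [Fintype {f : D → Fin n // IsColouring P R f}] :
    Fintype.card {f : D → Fin n // IsColouring P R f} = n ^ Fintype.card Λ := by
  classical
  rw [Fintype.card_congr (colouringEquiv h hℓ n), Fintype.card_fun, Fintype.card_fin]

theorem sum_apply_mul_apply [DecidableEq Λ] (n : ℕ) (l l' : Λ) :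
    ∑ g : Λ → Fin n, spinValue n (g l) * spinValue n (g l') =
      if l = l' then ((n : ℝ) ^ 2 - 1) / 12 * (n : ℝ) ^ Fintype.card Λ else 0 := by
  split_ifs with h
  · subst h
    have h1 : ∀ g : Λ → Fin n, spinValue n (g l) * spinValue n (g l) =
        ∏ m, (if m = l then spinValue n (g m) * spinValue n (g m) else 1) := by
      intro g; rw [Finset.prod_ite_eq' Finset.univ l]; simp
    simp only [h1]
    rw [← Fintype.prod_sum (fun (m : Λ) (a : Fin n) =>
      if m = l then spinValue n a * spinValue n a else 1)]
    have h2 : ∀ m : Λ, ∑ a : Fin n, (if m = l then spinValue n a * spinValue n a else 1) =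
        (n : ℝ) * if m = l then (((n : ℝ) ^ 2 - 1) / 12) else 1 := by
      intro m
      split_ifs
      · exact sum_spinValue_sq n
      · simp
    simp only [h2, Finset.prod_mul_distrib, Finset.prod_const, Finset.card_univ,
      Finset.prod_ite_eq', Finset.mem_univ, if_true]
    ring
  · have h1 : ∀ g : Λ → Fin n, spinValue n (g l) * spinValue n (g l') =
        ∏ m, (if m = l then spinValue n (g m) else 1) *
          (if m = l' then spinValue n (g m) else 1) := by
      intro g
      rw [Finset.prod_mul_distrib, Finset.prod_ite_eq' Finset.univ l,
        Finset.prod_ite_eq' Finset.univ l']; simp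
    simp only [h1]
    rw [← Fintype.prod_sum (fun (m : Λ) (a : Fin n) => (if m = l then spinValue n a else 1) *
          (if m = l' then spinValue n a else 1))]
    refine Finset.prod_eq_zero (Finset.mem_univ l) ?_
    simp [h, sum_spinValue]

open Classical in
/-- Colours of different loops are independent and have mean zero. -/
theorem sum_colourings_mul (h : Reversible P J R)
    (hℓ : LoopIndex P R ℓ rep) (n : ℕ) [Fintype {f : D → Fin n // IsColouring P R f}] (a b : D) :
    ∑ f : {f : D → Fin n // IsColouring P R f}, spinValue n (f.1 a) * spinValue n (f.1 b) =
      ((n : ℝ) ^ 2 - 1) / 12 * (n : ℝ) ^ Fintype.card Λ *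
        ((if P.SameCycle a b then 1 else 0) - (if P.SameCycle a (R b) then 1 else 0)) := by
  have hval : ∀ (g : Λ → Fin n) (a : D), spinValue n (colourOf P ℓ rep g a) =
      (if P.SameCycle (rep (ℓ a)) a then 1 else -1) * spinValue n (g (ℓ a)) := by
    intro g a
    unfold colourOf
    split_ifs
    · rw [one_mul]
    · rw [spinValue_rev]; ring
  rw [← Equiv.sum_comp (colouringEquiv h hℓ n).symm]
  change ∑ g, spinValue n (colourOf P ℓ rep g a) * spinValue n (colourOf P ℓ rep g b) = _
  simp only [hval]
  have : ∀ g : Λ → Fin n, (if P.SameCycle (rep (ℓ a)) a then 1 else -1) * spinValue n (g (ℓ a)) *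
      ((if P.SameCycle (rep (ℓ b)) b then 1 else -1) * spinValue n (g (ℓ b))) =
      ((if P.SameCycle (rep (ℓ a)) a then 1 else -1) *
        (if P.SameCycle (rep (ℓ b)) b then 1 else -1)) *
        (spinValue n (g (ℓ a)) * spinValue n (g (ℓ b))) := fun g => by ring
  simp only [this]
  rw [← Finset.mul_sum, sum_apply_mul_apply]
  by_cases hl : ℓ a = ℓ b
  · rw [if_pos hl]
    have hor := (hℓ.ell_eq_iff a b).1 hl
    by_cases h1 : P.SameCycle a b
    · have h2 : ¬ P.SameCycle a (R b) := fun h2 => h.not_sameCycle_R b (h1.symm.trans h2)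
      have h3 : P.SameCycle (rep (ℓ a)) a ↔ P.SameCycle (rep (ℓ b)) b := by
        rw [hl]; exact ⟨fun h' => h'.trans h1, fun h' => h'.trans h1.symm⟩
      rw [if_pos h1, if_neg h2]
      simp only [h3]
      split_ifs <;> ring
    · have h2 := hor.resolve_left h1
      have h3 : P.SameCycle (rep (ℓ a)) a ↔ ¬ P.SameCycle (rep (ℓ b)) b := by
        rw [← hℓ.sameCycle_rep_R_iff h, hl]
        exact ⟨fun h' => h'.trans h2, fun h' => h'.trans h2.symm⟩
      rw [if_neg h1, if_pos h2]
      simp only [h3, ite_not]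
      split_ifs <;> ring
  · have hor := not_or.1 (mt (hℓ.ell_eq_iff a b).2 hl)
    rw [if_neg hl, if_neg hor.1, if_neg hor.2]
    ring

end Colourings

/-! ### Discretized trajectories -/

/-- A discretized configuration: cyclically ordered time slots `i : I`, and for each level between
the slots `i` and `next i` at most one link, described by the involution `swap i` of the sites that
exchanges its end-points, and by its mark (`bar i` says whether it is a double bar). A level
without link has `swap i = id`. -/
structure Ladder (V I : Type*) where
  /-- the slot above the slot `i` -/
  next : Equiv.Perm I
  /-- the site at the other end of the link at the level above `i` -/
  swap : I → V → V
  /-- whether the link at the level above `i` is a double bar -/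
  bar : I → Bool
  swap_swap : ∀ i x, swap i (swap i x) = x

namespace Ladder

variable {V I : Type*} [DecidableEq V] (L : Ladder V I)

/-- The level above `i` reverses the direction of a particle at the site `x`. -/
def Turn (i : I) (x : V) : Prop := L.bar i = true ∧ L.swap i x ≠ x

/-- The level above `i` carries a cross with end-point `x`. -/
def Crossing (i : I) (x : V) : Prop := L.bar i = false ∧ L.swap i x ≠ x

instance (i : I) (x : V) : Decidable (L.Turn i x) := inferInstanceAs (Decidable (_ ∧ _))

instance (i : I) (x : V) : Decidable (L.Crossing i x) := inferInstanceAs (Decidable (_ ∧ _))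

omit [DecidableEq V] in
theorem swap_swap_ne_iff (i : I) (x : V) :
    L.swap i (L.swap i x) ≠ L.swap i x ↔ L.swap i x ≠ x := by
  rw [L.swap_swap, ne_comm]

omit [DecidableEq V] in
theorem turn_swap (i : I) (x : V) : L.Turn i (L.swap i x) ↔ L.Turn i x :=
  and_congr Iff.rfl (L.swap_swap_ne_iff i x)

omit [DecidableEq V] in
theorem crossing_swap (i : I) (x : V) : L.Crossing i (L.swap i x) ↔ L.Crossing i x :=
  and_congr Iff.rfl (L.swap_swap_ne_iff i x)

theorem swap_eq_of_not (i : I) (x : V) (h1 : ¬ L.Turn i x) (h2 : ¬ L.Crossing i x) :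
    L.swap i x = x := by
  unfold Turn Crossing at *
  by_contra h
  cases hb : L.bar i <;> simp_all

/-- The matching of the end-points of the vertical segments: the end-point of the segment `(x, i)`
in the direction `d` is denoted by `(x, i, d)`. -/
def endMatch (a : V × I × ℤˣ) : V × I × ℤˣ :=
  if a.2.2 = 1 then
    if L.Turn a.2.1 a.1 then (L.swap a.2.1 a.1, a.2.1, 1)
    else (L.swap a.2.1 a.1, L.next a.2.1, -1)
  else
    if L.Turn (L.next.symm a.2.1) a.1 then (L.swap (L.next.symm a.2.1) a.1, a.2.1, -1)
    else (L.swap (L.next.symm a.2.1) a.1, L.next.symm a.2.1, 1)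

/-- Reversal of the direction. -/
def flip (a : V × I × ℤˣ) : V × I × ℤˣ := (a.1, a.2.1, -a.2.2)

omit [DecidableEq V] in
@[simp] theorem flip_flip (a : V × I × ℤˣ) : flip (flip a) = a := by simp [flip]

theorem units_neg_one_ne : (-1 : ℤˣ) ≠ 1 := by decide

theorem endMatch_one (x : V) (i : I) : L.endMatch (x, i, 1) =
    if L.Turn i x then (L.swap i x, i, 1) else (L.swap i x, L.next i, -1) := by
  simp [endMatch]

theorem endMatch_neg_one (x : V) (i : I) : L.endMatch (x, L.next i, -1) =
    if L.Turn i x then (L.swap i x, L.next i, -1) else (L.swap i x, i, 1) := by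
  simp [endMatch]

theorem endMatch_endMatch (a : V × I × ℤˣ) : L.endMatch (L.endMatch a) = a := by
  obtain ⟨x, i, d⟩ := a
  rcases Int.units_eq_one_or d with rfl | rfl
  · rw [endMatch_one]
    split_ifs with h
    · rw [endMatch_one, if_pos ((L.turn_swap i x).2 h), L.swap_swap]
    · rw [endMatch_neg_one, if_neg (mt (L.turn_swap i x).1 h), L.swap_swap]
  · obtain ⟨j, rfl⟩ := L.next.surjective i
    rw [endMatch_neg_one]
    split_ifs with h
    · rw [endMatch_neg_one, if_pos ((L.turn_swap j x).2 h), L.swap_swap]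
    · rw [endMatch_one, if_neg (mt (L.turn_swap j x).1 h), L.swap_swap]

/-- One step of the motion: the state `(x, i, d)` travels along the segment `(x, i)` in the
direction `d`, and passes to the next segment. -/
def step : Equiv.Perm (V × I × ℤˣ) where
  toFun a := flip (L.endMatch a)
  invFun a := L.endMatch (flip a)
  left_inv a := by simp only [flip_flip, L.endMatch_endMatch]
  right_inv a := by simp only [L.endMatch_endMatch, flip_flip]

theorem reversible : Reversible L.step L.endMatch flip where
  apply_eq _ := rfl
  J_invol := L.endMatch_endMatch
  R_invol := flip_flip
  J_ne := by
    rintro ⟨x, i, d⟩ h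
    rcases Int.units_eq_one_or d with rfl | rfl
    · rw [endMatch_one] at h
      split_ifs at h with ht
      · exact ht.2 (congrArg Prod.fst h)
      · exact units_neg_one_ne (congrArg (fun a => a.2.2) h)
    · obtain ⟨j, rfl⟩ := L.next.surjective i
      rw [endMatch_neg_one] at h
      split_ifs at h with ht
      · exact ht.2 (congrArg Prod.fst h)
      · exact units_neg_one_ne (congrArg (fun a => a.2.2) h).symm
  R_ne := by
    rintro ⟨x, i, d⟩ h
    have : -d = d := congrArg (fun a => a.2.2) h
    rcases Int.units_eq_one_or d with rfl | rfl <;> exact absurd this (by decide)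

/-- The state of a particle that has just left the level above `j`, at the site `z` in the
direction `d`. -/
def arrival (t : I × V × ℤˣ) : V × I × ℤˣ :=
  (t.2.1, if t.2.2 = 1 then L.next t.1 else t.1, t.2.2)

/-- Each state is the arrival from a unique level. -/
def arrivalEquiv : I × V × ℤˣ ≃ V × I × ℤˣ where
  toFun := L.arrival
  invFun a := (if a.2.2 = 1 then L.next.symm a.2.1 else a.2.1, a.1, a.2.2)
  left_inv t := by
    obtain ⟨j, z, d⟩ := t
    simp only [arrival]
    split_ifs <;> simp
  right_inv a := by
    obtain ⟨x, i, d⟩ := a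
    simp only [arrival]
    split_ifs <;> simp

theorem step_symm_arrival (j : I) (z : V) (d : ℤˣ) : L.step.symm (L.arrival (j, z, d)) =
    flip (L.arrival (j, L.swap j z, if L.Turn j z then d else -d)) := by
  change L.endMatch (flip _) = _
  rcases Int.units_eq_one_or d with rfl | rfl
  · simp only [arrival, flip, if_true]
    rw [endMatch_neg_one]
    split_ifs with h1 h2
    · rfl
    · exact absurd rfl h2
    · rename_i h3; exact absurd h3 units_neg_one_ne
    · simp
  · simp only [arrival, flip, units_neg_one_ne, if_false, neg_neg]
    rw [endMatch_one]
    split_ifs with h1 h2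
    · exact absurd h2 units_neg_one_ne
    · rfl
    · rfl
    · rename_i h3; exact absurd rfl h3

theorem sameCycle_arrival (j : I) (z : V) (d : ℤˣ) : L.step.SameCycle
    (flip (L.arrival (j, L.swap j z, if L.Turn j z then d else -d))) (L.arrival (j, z, d)) := by
  rw [← step_symm_arrival]
  exact Equiv.Perm.sameCycle_symm_apply_left.2 (Equiv.Perm.SameCycle.refl _ _)

/-- A cross is left at one end-point, or at the other in the reversed direction. -/
theorem sameCycle_arrival_crossing {j : I} {z : V} (h : L.Crossing j z) (d : ℤˣ)
    (a : V × I × ℤˣ) : L.step.SameCycle a (L.arrival (j, L.swap j z, -d)) ↔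
      L.step.SameCycle a (flip (L.arrival (j, z, d))) := by
  have hs := L.sameCycle_arrival j z d
  rw [if_neg fun ht : L.Turn j z => by simp [Turn, h.1] at ht, L.reversible.sameCycle_R_comm] at hs
  exact ⟨fun h' => h'.trans hs, fun h' => h'.trans hs.symm⟩

/-- The sites are two-coloured by `ε` so that links join sites of opposite colours. -/
def IsSublattice (ε : V → ℤˣ) : Prop := ∀ i x, L.swap i x ≠ x → ε (L.swap i x) = -ε x

variable [Fintype V] [Fintype I]

open Classical in
/-- The arrivals from crosses along the oriented trajectory of `a`. -/
def arrivals (a : V × I × ℤˣ) : Finset (I × V × ℤˣ) :=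
  Finset.univ.filter fun t => L.Crossing t.1 t.2.1 ∧ L.step.SameCycle a (L.arrival t)

theorem mem_arrivals {a : V × I × ℤˣ} {t : I × V × ℤˣ} :
    t ∈ L.arrivals a ↔ L.Crossing t.1 t.2.1 ∧ L.step.SameCycle a (L.arrival t) := by
  simp [arrivals]

/-- The product of the signs `χ` over the arrivals from crosses along a trajectory. -/
def sgn (χ : V → ℤˣ → ℤˣ) (a : V × I × ℤˣ) : ℤˣ := ∏ t ∈ L.arrivals a, χ t.2.1 t.2.2

/-- Along a closed trajectory there is an even number of passages through crosses, because exactly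
at these the product of the sublattice sign and of the direction changes. -/
theorem prod_arrivals_neg_one {ε : V → ℤˣ} (hε : L.IsSublattice ε) (a : V × I × ℤˣ) :
    ∏ _t ∈ L.arrivals a, (-1 : ℤˣ) = 1 := by
  classical
  set κ : V × I × ℤˣ → ℤˣ := fun b => ε b.1 * b.2.2
  have hκ : ∀ t : I × V × ℤˣ, κ (L.arrival t) * κ (L.step.symm (L.arrival t)) =
      if L.Crossing t.1 t.2.1 then -1 else 1 := by
    rintro ⟨j, z, d⟩
    rw [step_symm_arrival]
    change ε z * d * (ε (L.swap j z) * -(if L.Turn j z then d else -d)) = _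
    have hz := Int.units_mul_self (ε z)
    have hd := Int.units_mul_self d
    have e : ε z * d * (ε z * d) = 1 := by rw [mul_mul_mul_comm, hz, hd, one_mul]
    by_cases h1 : L.Turn j z
    · have h2 : ¬ L.Crossing j z := fun h2 => by simp [Turn, h2.1] at h1
      rw [if_pos h1, if_neg h2, hε j z h1.2, neg_mul_neg, e]
    · rw [if_neg h1, neg_neg]
      by_cases h2 : L.Crossing j z
      · rw [if_pos h2, hε j z h2.2, neg_mul, mul_neg, e]
      · rw [if_neg h2, L.swap_eq_of_not j z h1 h2, e]
  set C : Finset (V × I × ℤˣ) := Finset.univ.filter fun b => L.step.SameCycle a b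
  have h1 : ∏ b ∈ C, κ (L.step.symm b) = ∏ b ∈ C, κ b := by
    refine Finset.prod_equiv L.step.symm (fun b => ?_) fun b _ => rfl
    simp [C]
  have h2 : ∏ b ∈ C, κ b * κ (L.step.symm b) = 1 := by
    rw [Finset.prod_mul_distrib, h1, Int.units_mul_self]
  refine Eq.trans ?_ h2
  rw [arrivals, ← Finset.filter_filter, Finset.filter_comm, Finset.prod_filter]
  refine Finset.prod_equiv L.arrivalEquiv (fun t => ?_) fun t _ => ?_
  · simp [C, arrivalEquiv]
  · exact (hκ t).symm

theorem arrivals_congr {a b : V × I × ℤˣ} (h : L.step.SameCycle a b) :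
    L.arrivals a = L.arrivals b := by
  ext t
  rw [mem_arrivals, mem_arrivals]
  exact and_congr Iff.rfl ⟨fun h' => h.symm.trans h', fun h' => h.trans h'⟩

theorem sgn_flip {ε : V → ℤˣ} (hε : L.IsSublattice ε) {χ : V → ℤˣ → ℤˣ} {η : ℤˣ}
    (hχ : ∀ j z, L.Crossing j z → ∀ d, χ (L.swap j z) (-d) = η * χ z d) (a : V × I × ℤˣ) :
    L.sgn χ (flip a) = L.sgn χ a := by
  have hη : ∏ _t ∈ L.arrivals (flip a), η = 1 := by
    rcases Int.units_eq_one_or η with rfl | rfl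
    · simp
    · exact L.prod_arrivals_neg_one hε _
  have h1 : ∏ t ∈ L.arrivals (flip a), η * χ t.2.1 t.2.2 = L.sgn χ (flip a) := by
    rw [Finset.prod_mul_distrib, hη, one_mul]; rfl
  rw [← h1, sgn]
  refine Finset.prod_nbij' (fun t => (t.1, L.swap t.1 t.2.1, -t.2.2))
    (fun t => (t.1, L.swap t.1 t.2.1, -t.2.2)) ?_ ?_ ?_ ?_ ?_
  · rintro ⟨j, z, d⟩ ht
    rw [mem_arrivals] at ht ⊢
    refine ⟨(L.crossing_swap j z).2 ht.1, ?_⟩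
    rw [L.sameCycle_arrival_crossing ht.1, ← L.reversible.sameCycle_R_comm]
    exact ht.2
  · rintro ⟨j, z, d⟩ ht
    rw [mem_arrivals] at ht ⊢
    refine ⟨(L.crossing_swap j z).2 ht.1, ?_⟩
    rw [L.sameCycle_arrival_crossing ht.1, L.reversible.sameCycle_R_iff]
    exact ht.2
  · rintro ⟨j, z, d⟩ _; simp [L.swap_swap]
  · rintro ⟨j, z, d⟩ _; simp [L.swap_swap]
  · rintro ⟨j, z, d⟩ ht
    exact (hχ j z (L.mem_arrivals.1 ht).1 d).symm

variable {Λ : Type*} [Fintype Λ] {ℓ : V × I × ℤˣ → Λ} {rep : Λ → V × I × ℤˣ}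

/-- A product over the legs of the crosses, indexed by their upper end-points, is a product over the
passages of the oriented loops through crosses. A passage downwards that arrives at `z` uses the
leg with upper end-point `swap j z`. -/
theorem prod_legs {M : Type*} [CommMonoid M] (hℓ : LoopIndex L.step flip ℓ rep) (θ : I → V → M) :
    ∏ t : I × V, (if L.Crossing t.1 t.2 then θ t.1 t.2 else 1) =
      ∏ l, ∏ t ∈ L.arrivals (rep l),
        if t.2.2 = 1 then θ t.1 t.2.1 else θ t.1 (L.swap t.1 t.2.1) := by
  classical
  have : DecidableEq Λ := Classical.decEq Λ
  set φ : I × V × ℤˣ → M := fun t => if t.2.2 = 1 then θ t.1 t.2.1 else θ t.1 (L.swap t.1 t.2.1)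
  have h1 : ∀ l, L.arrivals (rep l) = (Finset.univ.filter fun t : I × V × ℤˣ =>
      L.Crossing t.1 t.2.1 ∧ L.step.SameCycle (rep (ℓ (L.arrival t))) (L.arrival t)).filter
      fun t => ℓ (L.arrival t) = l := by
    intro l
    ext t
    simp only [mem_arrivals, Finset.mem_filter, Finset.mem_univ, true_and, and_assoc]
    refine and_congr Iff.rfl ⟨fun h => ?_, fun h => ?_⟩
    · have : ℓ (L.arrival t) = l := by rw [← hℓ.ell_eq_of_sameCycle h, hℓ.ell_rep]
      exact ⟨by rw [this]; exact h, this⟩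
    · rw [← h.2]; exact h.1
  simp only [h1]
  rw [Finset.prod_fiberwise _ (fun t => ℓ (L.arrival t)), Finset.prod_filter]
  have h2 : ∀ F : I × V × ℤˣ → M, ∏ t, F t = (∏ p : I × V, F (p.1, p.2, 1)) *
      ∏ p : I × V, F (p.1, p.2, -1) := by
    intro F
    rw [← Finset.prod_mul_distrib, Fintype.prod_prod_type, Fintype.prod_prod_type]
    refine Finset.prod_congr rfl fun i _ => ?_
    rw [Fintype.prod_prod_type]
    refine Finset.prod_congr rfl fun x _ => ?_
    have : (Finset.univ : Finset ℤˣ) = {1, -1} := rfl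
    rw [this, Finset.prod_pair (by decide)]
  rw [h2]
  have h3 : ∏ p : I × V, (if L.Crossing p.1 p.2 ∧
      L.step.SameCycle (rep (ℓ (L.arrival (p.1, p.2, -1)))) (L.arrival (p.1, p.2, -1))
      then φ (p.1, p.2, -1) else 1) = ∏ p : I × V, (if L.Crossing p.1 p.2 ∧
      ¬ L.step.SameCycle (rep (ℓ (L.arrival (p.1, p.2, 1)))) (L.arrival (p.1, p.2, 1))
      then θ p.1 p.2 else 1) := by
    have hinv : Function.Involutive fun p : I × V => (p.1, L.swap p.1 p.2) := by
      rintro ⟨j, z⟩; simp [L.swap_swap]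
    rw [← Equiv.prod_comp hinv.toPerm]
    refine Finset.prod_congr rfl fun p _ => ?_
    obtain ⟨j, z⟩ := p
    change (if L.Crossing j (L.swap j z) ∧ L.step.SameCycle
      (rep (ℓ (L.arrival (j, L.swap j z, -1)))) (L.arrival (j, L.swap j z, -1))
      then (if (-1 : ℤˣ) = 1 then θ j (L.swap j z) else θ j (L.swap j (L.swap j z))) else 1) = _
    rw [if_neg units_neg_one_ne, L.swap_swap]
    refine if_congr ?_ rfl rfl
    rw [L.crossing_swap]
    by_cases hc : L.Crossing j z
    · have hl : ℓ (L.arrival (j, L.swap j z, -1)) = ℓ (L.arrival (j, z, 1)) := by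
        rw [← hℓ.ell_R (a := L.arrival (j, z, 1))]
        exact hℓ.ell_eq_of_sameCycle ((L.sameCycle_arrival_crossing hc 1 _).1
          (Equiv.Perm.SameCycle.refl _ _))
      rw [hl, L.sameCycle_arrival_crossing hc, hℓ.sameCycle_rep_R_iff L.reversible]
    · simp [hc]
  rw [h3, ← Finset.prod_mul_distrib]
  refine Finset.prod_congr rfl fun p _ => ?_
  simp only [φ, if_true]
  by_cases hc : L.Crossing p.1 p.2 <;>
    by_cases ho : L.step.SameCycle (rep (ℓ (L.arrival (p.1, p.2, 1)))) (L.arrival (p.1, p.2, 1)) <;>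
      simp [hc, ho]

end Ladder

/-! ### Spin configurations as colourings -/

section Twist

variable {n : ℕ}

/-- The spin index `v`, reversed if the sign `e` is `-1`. -/
def twist (e : ℤˣ) (v : Fin n) : Fin n := if e = 1 then v else Fin.rev v

@[simp] theorem twist_one (v : Fin n) : twist 1 v = v := rfl

theorem twist_neg (e : ℤˣ) (v : Fin n) : twist (-e) v = Fin.rev (twist e v) := by
  rcases Int.units_eq_one_or e with rfl | rfl <;> simp [twist]

theorem twist_rev (e : ℤˣ) (v : Fin n) : twist e (Fin.rev v) = Fin.rev (twist e v) := by
  rcases Int.units_eq_one_or e with rfl | rfl <;> simp [twist]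

theorem twist_twist (e : ℤˣ) (v : Fin n) : twist e (twist e v) = v := by
  rcases Int.units_eq_one_or e with rfl | rfl <;> simp [twist]

theorem twist_inj {e : ℤˣ} {v w : Fin n} : twist e v = twist e w ↔ v = w :=
  ⟨fun h => by rw [← twist_twist e v, h, twist_twist], fun h => by rw [h]⟩

theorem spinValue_twist (e : ℤˣ) (v : Fin n) :
    spinValue n (twist e v) = ((e : ℤ) : ℝ) * spinValue n v := by
  rcases Int.units_eq_one_or e with rfl | rfl <;> simp [twist, spinValue_rev]

/-- The parity of a spin index. -/
def paritySign (v : Fin n) : ℤˣ := (-1) ^ (v : ℕ)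

theorem paritySign_rev (v : Fin n) : paritySign (Fin.rev v) = (-1) ^ (n + 1) * paritySign v := by
  unfold paritySign
  have h : ((Fin.rev v : Fin n) : ℕ) + 2 * (v + 1) = n + 1 + v := by
    rw [Fin.val_rev]; omega
  rw [← pow_add, ← h, pow_add, pow_mul]; simp

theorem paritySign_twist_even (hn : Even n) (e : ℤˣ) (v : Fin n) :
    paritySign (twist e v) = e * paritySign v := by
  rcases Int.units_eq_one_or e with rfl | rfl
  · simp
  · rw [twist_neg, twist_one, paritySign_rev, hn.add_one.neg_one_pow]

theorem paritySign_twist_odd (hn : Odd n) (e : ℤˣ) (v : Fin n) :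
    paritySign (twist e v) = paritySign v := by
  rcases Int.units_eq_one_or e with rfl | rfl
  · simp
  · rw [twist_neg, twist_one, paritySign_rev, hn.add_one.neg_one_pow, one_mul]

end Twist

namespace Ladder

variable {V I : Type*} [DecidableEq V] (L : Ladder V I) {n : ℕ}

/-- The constraints that the level above `i` imposes on the spin configurations `σ` below and `σ'`
above it: the configuration does not change away from the link, the spins at the end-points of a
double bar agree on either side, and a cross exchanges the spins and reverses them. -/
def LevelCompat (i : I) (σ σ' : V → Fin n) : Prop := ∀ z,
  if L.Turn i z then σ (L.swap i z) = σ z ∧ σ' (L.swap i z) = σ' z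
  else if L.Crossing i z then σ' (L.swap i z) = Fin.rev (σ z)
  else σ' z = σ z

/-- The colouring of the states given by a history of spin configurations: the spin at `(x, i)` is
reversed if `x` belongs to the second sublattice, and once more if the direction is downwards. -/
def spinColour (ε : V → ℤˣ) (s : I → V → Fin n) (a : V × I × ℤˣ) : Fin n :=
  twist (ε a.1 * a.2.2) (s a.2.1 a.1)

omit [DecidableEq V] in
theorem spinColour_flip (ε : V → ℤˣ) (s : I → V → Fin n) (a : V × I × ℤˣ) :
    spinColour ε s (flip a) = Fin.rev (spinColour ε s a) := by
  unfold spinColour flip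
  rw [mul_neg, twist_neg]

theorem levelCompat_iff {ε : V → ℤˣ} (hε : L.IsSublattice ε) (s : I → V → Fin n) (i : I) :
    L.LevelCompat i (s i) (s (L.next i)) ↔ ∀ z,
      spinColour ε s (L.endMatch (z, i, 1)) = Fin.rev (spinColour ε s (z, i, 1)) ∧
      spinColour ε s (L.endMatch (z, L.next i, -1)) =
        Fin.rev (spinColour ε s (z, L.next i, -1)) := by
  have hturn : ∀ z, L.Turn i z →
      ((spinColour ε s (L.endMatch (z, i, 1)) = Fin.rev (spinColour ε s (z, i, 1)) ∧
        spinColour ε s (L.endMatch (z, L.next i, -1)) =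
          Fin.rev (spinColour ε s (z, L.next i, -1))) ↔
        s i (L.swap i z) = s i z ∧ s (L.next i) (L.swap i z) = s (L.next i) z) := by
    intro z hz
    rw [endMatch_one, endMatch_neg_one, if_pos hz, if_pos hz]
    simp only [spinColour, hε i z hz.2, mul_one, mul_neg, neg_neg, twist_neg]
    simp only [Fin.rev_inj, Fin.rev_rev, twist_inj]
  have hcross : ∀ z, L.Crossing i z →
      ((spinColour ε s (L.endMatch (z, i, 1)) = Fin.rev (spinColour ε s (z, i, 1)) ∧
        spinColour ε s (L.endMatch (z, L.next i, -1)) =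
          Fin.rev (spinColour ε s (z, L.next i, -1))) ↔
        s (L.next i) (L.swap i z) = Fin.rev (s i z) ∧
          s (L.next i) z = Fin.rev (s i (L.swap i z))) := by
    intro z hz
    have ht : ¬ L.Turn i z := fun ht => by simp [Turn, hz.1] at ht
    rw [endMatch_one, endMatch_neg_one, if_neg ht, if_neg ht]
    simp only [spinColour, hε i z hz.2, mul_one, mul_neg, neg_neg, twist_neg, ← twist_rev]
    simp only [Fin.rev_rev, twist_inj]
    exact and_congr Iff.rfl eq_comm
  have hfree : ∀ z, ¬ L.Turn i z → ¬ L.Crossing i z →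
      ((spinColour ε s (L.endMatch (z, i, 1)) = Fin.rev (spinColour ε s (z, i, 1)) ∧
        spinColour ε s (L.endMatch (z, L.next i, -1)) =
          Fin.rev (spinColour ε s (z, L.next i, -1))) ↔ s (L.next i) z = s i z) := by
    intro z ht hc
    have hz := L.swap_eq_of_not i z ht hc
    rw [endMatch_one, endMatch_neg_one, if_neg ht, if_neg ht]
    simp only [spinColour, hz, mul_one, mul_neg, twist_neg]
    simp only [Fin.rev_inj, Fin.rev_rev, twist_inj]
    exact ⟨fun h => h.1, fun h => ⟨h, h.symm⟩⟩
  unfold LevelCompat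
  constructor
  · intro h z
    have hz := h z
    by_cases ht : L.Turn i z
    · rw [if_pos ht] at hz
      exact (hturn z ht).2 hz
    · rw [if_neg ht] at hz
      by_cases hc : L.Crossing i z
      · rw [if_pos hc] at hz
        refine (hcross z hc).2 ⟨hz, ?_⟩
        have hz' := h (L.swap i z)
        rw [if_neg (mt (L.turn_swap i z).1 ht), if_pos ((L.crossing_swap i z).2 hc),
          L.swap_swap] at hz'
        exact hz'
      · rw [if_neg hc] at hz
        exact (hfree z ht hc).2 hz
  · intro h z
    split_ifs with ht hc
    · exact (hturn z ht).1 (h z)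
    · exact ((hcross z hc).1 (h z)).1
    · exact (hfree z ht hc).1 (h z)

theorem isColouring_spinColour_iff {ε : V → ℤˣ} (hε : L.IsSublattice ε) (s : I → V → Fin n) :
    IsColouring L.step flip (spinColour ε s) ↔ ∀ i, L.LevelCompat i (s i) (s (L.next i)) := by
  have h1 : IsColouring L.step flip (spinColour ε s) ↔
      ∀ a, spinColour ε s (L.endMatch a) = Fin.rev (spinColour ε s a) := by
    refine ⟨fun h a => ?_, fun h => ⟨fun a => ?_, spinColour_flip ε s⟩⟩
    · have h2 : spinColour ε s (flip (L.endMatch a)) = spinColour ε s a := h.1 a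
      rw [← h2, spinColour_flip, Fin.rev_rev]
    · change spinColour ε s (flip (L.endMatch a)) = _
      rw [spinColour_flip, h, Fin.rev_rev]
  rw [h1]
  simp only [L.levelCompat_iff hε]
  constructor
  · exact fun h i z => ⟨h _, h _⟩
  · rintro h ⟨x, i, d⟩
    rcases Int.units_eq_one_or d with rfl | rfl
    · exact (h i x).1
    · obtain ⟨j, rfl⟩ := L.next.surjective i
      exact (h j x).2

/-- Histories of spin configurations that satisfy all constraints correspond to colourings. -/
def spinEquiv {ε : V → ℤˣ} (hε : L.IsSublattice ε) (n : ℕ) :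
    {s : I → V → Fin n // ∀ i, L.LevelCompat i (s i) (s (L.next i))} ≃
      {f : V × I × ℤˣ → Fin n // IsColouring L.step flip f} where
  toFun s := ⟨spinColour ε s.1, (L.isColouring_spinColour_iff hε s.1).2 s.2⟩
  invFun f := ⟨fun i x => twist (ε x) (f.1 (x, i, 1)), by
    rw [← L.isColouring_spinColour_iff hε]
    convert f.2 using 1
    funext ⟨x, i, d⟩
    rcases Int.units_eq_one_or d with rfl | rfl
    · simp [spinColour, twist_twist]
    · have := f.2.2 (x, i, 1)
      simp only [spinColour, mul_neg, mul_one, twist_neg, twist_twist]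
      exact this.symm⟩
  left_inv s := by
    refine Subtype.ext (funext fun i => funext fun x => ?_)
    simp [spinColour, twist_twist]
  right_inv f := by
    refine Subtype.ext (funext fun ⟨x, i, d⟩ => ?_)
    rcases Int.units_eq_one_or d with rfl | rfl
    · simp [spinColour, twist_twist]
    · have := f.2.2 (x, i, 1)
      simp only [spinColour, mul_neg, mul_one, twist_neg, twist_twist]
      exact this.symm

variable [Fintype V] [Fintype I]
variable {Λ : Type*} [Fintype Λ] {ℓ : V × I × ℤˣ → Λ} {rep : Λ → V × I × ℤˣ}

/-- The spin above a passage through a cross is the colour of the loop, reversed on the second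
sublattice. -/
theorem upper_spin_eq {ε : V → ℤˣ} (hε : L.IsSublattice ε) {s : I → V → Fin n}
    (hs : ∀ i, L.LevelCompat i (s i) (s (L.next i))) {a : V × I × ℤˣ} {t : I × V × ℤˣ}
    (ht : t ∈ L.arrivals a) :
    (if t.2.2 = 1 then s (L.next t.1) t.2.1 else s (L.next t.1) (L.swap t.1 t.2.1)) =
      twist (ε t.2.1) (spinColour ε s a) := by
  obtain ⟨j, z, d⟩ := t
  obtain ⟨hc, hcyc⟩ := L.mem_arrivals.1 ht
  rw [((L.isColouring_spinColour_iff hε s).2 hs).sameCycle hcyc]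
  rcases Int.units_eq_one_or d with rfl | rfl
  · simp [spinColour, arrival, twist_twist]
  · have hz := hs j z
    rw [if_neg (fun h : L.Turn j z => by simp [Turn, hc.1] at h), if_pos hc] at hz
    simp only [spinColour, arrival, units_neg_one_ne, if_false, mul_neg, mul_one, twist_neg,
      twist_rev, twist_twist]
    exact hz

/-- For even `n` reversal changes the parity of a spin. Each passage through a cross contributes the
sublattice sign of the site of arrival, and the parity sign of the colour of the loop, which cancels
because the number of passages is even. -/
theorem prod_paritySign_even (hn : Even n) {ε : V → ℤˣ} (hε : L.IsSublattice ε)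
    (hℓ : LoopIndex L.step flip ℓ rep) {s : I → V → Fin n}
    (hs : ∀ i, L.LevelCompat i (s i) (s (L.next i))) :
    ∏ t : I × V, (if L.Crossing t.1 t.2 then paritySign (s (L.next t.1) t.2) else 1) =
      ∏ l, L.sgn (fun z _ => ε z) (rep l) := by
  rw [L.prod_legs hℓ fun i x => paritySign (s (L.next i) x)]
  refine Finset.prod_congr rfl fun l _ => ?_
  have h1 : ∀ t ∈ L.arrivals (rep l), (if t.2.2 = 1 then paritySign (s (L.next t.1) t.2.1)
      else paritySign (s (L.next t.1) (L.swap t.1 t.2.1))) =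
      ε t.2.1 * paritySign (spinColour ε s (rep l)) := by
    intro t ht
    rw [← paritySign_twist_even hn, ← L.upper_spin_eq hε hs ht, apply_ite paritySign]
  rw [Finset.prod_congr rfl h1, Finset.prod_mul_distrib]
  have h2 : ∏ _t ∈ L.arrivals (rep l), paritySign (spinColour ε s (rep l)) = 1 := by
    rcases Int.units_eq_one_or (paritySign (spinColour ε s (rep l))) with h | h <;> rw [h]
    · simp
    · exact L.prod_arrivals_neg_one hε _
  rw [h2, mul_one]
  rfl

/-- For odd `n` reversal preserves the parity of a spin, so that the parity signs along a loop are
equal, and cancel because the number of passages through crosses is even. -/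
theorem prod_paritySign_odd (hn : Odd n) {ε : V → ℤˣ} (hε : L.IsSublattice ε)
    (hℓ : LoopIndex L.step flip ℓ rep) {s : I → V → Fin n}
    (hs : ∀ i, L.LevelCompat i (s i) (s (L.next i))) :
    ∏ t : I × V, (if L.Crossing t.1 t.2 then paritySign (s (L.next t.1) t.2) else 1) = 1 := by
  rw [L.prod_legs hℓ fun i x => paritySign (s (L.next i) x)]
  refine Finset.prod_eq_one fun l _ => ?_
  have h1 : ∀ t ∈ L.arrivals (rep l), (if t.2.2 = 1 then paritySign (s (L.next t.1) t.2.1)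
      else paritySign (s (L.next t.1) (L.swap t.1 t.2.1))) =
      paritySign (spinColour ε s (rep l)) := by
    intro t ht
    rw [← paritySign_twist_odd hn (ε t.2.1) (spinColour ε s (rep l)),
      ← L.upper_spin_eq hε hs ht, apply_ite paritySign]
  rw [Finset.prod_congr rfl h1]
  rcases Int.units_eq_one_or (paritySign (spinColour ε s (rep l))) with h | h <;> rw [h]
  · simp
  · exact L.prod_arrivals_neg_one hε _

/-- Each cross has exactly one leg with upper end-point on the second sublattice. -/
theorem prod_sublattice {ε : V → ℤˣ} (hε : L.IsSublattice ε)
    (hℓ : LoopIndex L.step flip ℓ rep) :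
    ∏ t : I × V, (if L.Crossing t.1 t.2 then ε t.2 else 1) =
      ∏ l, L.sgn (fun z d => ε z * d) (rep l) := by
  rw [L.prod_legs hℓ fun _ x => ε x]
  refine Finset.prod_congr rfl fun l _ => Finset.prod_congr rfl fun t ht => ?_
  obtain ⟨j, z, d⟩ := t
  have hc := (L.mem_arrivals.1 ht).1
  rcases Int.units_eq_one_or d with rfl | rfl
  · simp
  · simp [hε j z hc.2]

end Ladder

/-! ### Traces of ordered products -/

section Path

variable {ι : Type*} [Fintype ι] [DecidableEq ι]

/-- Expansion of a matrix product as a sum over paths. -/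
theorem prod_ofFn_apply {k : ℕ} (M : Fin k → Matrix ι ι ℂ) (a b : ι) :
    (List.ofFn M).prod a b = ∑ s : Fin k → ι,
      (∏ i, M i ((Fin.cons a s : Fin (k + 1) → ι) i.castSucc) (s i)) *
        (if (Fin.cons a s : Fin (k + 1) → ι) (Fin.last k) = b then 1 else 0) := by
  induction k generalizing a with
  | zero => simp [Matrix.one_apply]
  | succ k ih =>
    rw [List.ofFn_succ, List.prod_cons, Matrix.mul_apply]
    simp only [ih]
    simp only [Finset.mul_sum]
    rw [← Fintype.sum_prod_type']
    refine Fintype.sum_equiv (Fin.consEquiv fun _ => ι) _ _ fun p => ?_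
    obtain ⟨c, s⟩ := p
    rw [Fin.prod_univ_succ]
    simp only [Fin.consEquiv, Equiv.coe_fn_mk, Fin.castSucc_zero, Fin.cons_zero, Fin.cons_succ,
      ← Fin.succ_castSucc, ← Fin.succ_last]
    rw [mul_assoc]

/-- The trace of an ordered product, expanded over closed paths. The last factor of the product
over the cyclically ordered levels expresses that the path closes. -/
theorem trace_diagonal_mul_prod_ofFn {k : ℕ} (M : Fin k → Matrix ι ι ℂ) (δ : ι → ℂ) :
    (Matrix.diagonal δ * (List.ofFn M).prod).trace = ∑ s : Fin (k + 1) → ι,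
      δ (s 0) * ∏ i : Fin (k + 1),
        (Fin.snoc M 1 : Fin (k + 1) → Matrix ι ι ℂ) i (s i) (s (i + 1)) := by
  unfold Matrix.trace
  simp only [Matrix.diag_apply, Matrix.diagonal_mul, prod_ofFn_apply, Finset.mul_sum]
  rw [← Fintype.sum_prod_type']
  refine Fintype.sum_equiv (Fin.consEquiv fun _ => ι) _ _ fun p => ?_
  obtain ⟨a, s⟩ := p
  rw [Fin.prod_univ_castSucc]
  simp only [Fin.consEquiv, Equiv.coe_fn_mk, Fin.cons_zero, Fin.snoc_castSucc, Fin.snoc_last,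
    Fin.last_add_one, Fin.coeSucc_eq_succ, Fin.cons_succ, Matrix.one_apply]

end Path

namespace Ladder

variable {V : Type*} [DecidableEq V] [Fintype V] {n k : ℕ}

open Classical in
/-- If the matrix elements of the levels are constants times parity signs of spins above crosses,
on the spin configurations allowed by the constraints, then the trace of the ordered product is
given by a sum over the allowed histories. -/
theorem trace_eq_sum (L : Ladder V (Fin (k + 1))) (hnext : ∀ i, L.next i = i + 1)
    (hlast : ∀ x, L.swap (Fin.last k) x = x)
    (M : Fin k → Matrix (V → Fin n) (V → Fin n) ℂ) (q : Fin k → ℂ)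
    (hM : ∀ i σ σ', M i σ σ' = if L.LevelCompat i.castSucc σ σ' then
      q i * ((∏ x, (if L.Crossing i.castSucc x then paritySign (σ' x) else 1) : ℤˣ) : ℤ) else 0)
    (δ : (V → Fin n) → ℂ) :
    (Matrix.diagonal δ * (List.ofFn M).prod).trace =
      (∏ i, q i) * ∑ s : {s : Fin (k + 1) → V → Fin n //
        ∀ i, L.LevelCompat i (s i) (s (L.next i))}, δ (s.1 0) *
        ((∏ t : Fin (k + 1) × V, (if L.Crossing t.1 t.2 then paritySign (s.1 (L.next t.1) t.2)
          else 1) : ℤˣ) : ℤ) := by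
  have hN : ∀ (i : Fin (k + 1)) σ σ',
      (Fin.snoc M 1 : Fin (k + 1) → Matrix (V → Fin n) (V → Fin n) ℂ) i σ σ' =
      if L.LevelCompat i σ σ' then (Fin.snoc q 1 : Fin (k + 1) → ℂ) i *
        ((∏ x, (if L.Crossing i x then paritySign (σ' x) else 1) : ℤˣ) : ℤ) else 0 := by
    intro i σ σ'
    refine Fin.lastCases ?_ (fun j => ?_) i
    · have h1 : ∀ x, ¬ L.Turn (Fin.last k) x := fun x h => h.2 (hlast x)
      have h2 : ∀ x, ¬ L.Crossing (Fin.last k) x := fun x h => h.2 (hlast x)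
      simp only [Fin.snoc_last, LevelCompat, h1, h2, if_false, Matrix.one_apply]
      have : σ = σ' ↔ ∀ z, σ' z = σ z := by rw [eq_comm, funext_iff]
      simp [this]
    · simp only [Fin.snoc_castSucc]
      exact hM j σ σ'
  rw [trace_diagonal_mul_prod_ofFn]
  have h1 : ∀ s : Fin (k + 1) → V → Fin n, (δ (s 0) * ∏ i : Fin (k + 1),
      (Fin.snoc M 1 : Fin (k + 1) → Matrix (V → Fin n) (V → Fin n) ℂ) i (s i) (s (i + 1))) =
      if ∀ i, L.LevelCompat i (s i) (s (L.next i)) then (∏ i, q i) * (δ (s 0) *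
        ((∏ t : Fin (k + 1) × V, (if L.Crossing t.1 t.2 then paritySign (s (L.next t.1) t.2)
          else 1) : ℤˣ) : ℤ)) else 0 := by
    intro s
    split_ifs with h
    · rw [Fintype.prod_prod_type]
      simp only [hN, ← hnext, h, if_true]
      rw [Finset.prod_mul_distrib, Fin.prod_univ_castSucc (Fin.snoc q 1 : Fin (k + 1) → ℂ)]
      simp only [Fin.snoc_castSucc, Fin.snoc_last, mul_one, Units.coe_prod, Int.cast_prod]
      ring
    · push Not at h
      obtain ⟨i, hi⟩ := h
      rw [Finset.prod_eq_zero (Finset.mem_univ i), mul_zero]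
      rw [hN, ← hnext, if_neg hi]
  rw [Finset.sum_congr rfl fun s _ => h1 s, ← Finset.sum_filter, Finset.mul_sum]
  exact (Finset.sum_subtype _ (fun s => by simp) fun s => _)

end Ladder

/-! ### The time grid -/

section Grid

variable {k : ℕ}

/-- The slot with number `q`, counted cyclically. -/
def slot (k : ℕ) (q : ℤ) : Fin (k + 1) :=
  ⟨(q % ((k : ℤ) + 1)).toNat, by
    have h1 := Int.emod_nonneg q (show (k : ℤ) + 1 ≠ 0 by omega)
    have h2 := Int.emod_lt_of_pos q (show (0 : ℤ) < (k : ℤ) + 1 by omega)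
    omega⟩

/-- The lower end of the slot with number `q`, for links at the times `r`, extended periodically
with period `T`. The slot `0` begins at the time `0`. -/
def grid (T : ℝ) (r : Fin k → ℝ) (q : ℤ) : ℝ :=
  T * ((q / ((k : ℤ) + 1) : ℤ) : ℝ) + (Fin.cons 0 r : Fin (k + 1) → ℝ) (slot k q)

theorem exists_eq_mul_add (k : ℕ) (q : ℤ) : ∃ (a : ℤ) (i : Fin (k + 1)),
    q = ((k : ℤ) + 1) * a + (i : ℕ) := by
  refine ⟨q / ((k : ℤ) + 1), slot k q, ?_⟩
  have h1 := Int.emod_nonneg q (show (k : ℤ) + 1 ≠ 0 by omega)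
  have h2 := Int.mul_ediv_add_emod q ((k : ℤ) + 1)
  simp only [slot]
  omega

theorem ediv_mul_add (a : ℤ) (i : Fin (k + 1)) :
    (((k : ℤ) + 1) * a + (i : ℕ)) / ((k : ℤ) + 1) = a := by
  rw [Int.mul_add_ediv_left _ _ (by omega), Int.ediv_eq_zero_of_lt (by omega) (by omega), add_zero]

theorem slot_mul_add (a : ℤ) (i : Fin (k + 1)) :
    slot k (((k : ℤ) + 1) * a + (i : ℕ)) = i := by
  ext
  simp only [slot]
  rw [Int.mul_add_emod_self_left, Int.emod_eq_of_lt (by omega) (by omega)]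
  simp

theorem slot_add_mul (q m : ℤ) : slot k (q + ((k : ℤ) + 1) * m) = slot k q := by
  ext
  simp [slot]

theorem eq_of_slot_eq {q q' : ℤ} (h : slot k q = slot k q') :
    ∃ m, q' = q + ((k : ℤ) + 1) * m := by
  obtain ⟨a, i, rfl⟩ := exists_eq_mul_add k q
  obtain ⟨b, j, rfl⟩ := exists_eq_mul_add k q'
  rw [slot_mul_add, slot_mul_add] at h
  subst h
  exact ⟨b - a, by ring⟩

theorem slot_natCast (i : Fin (k + 1)) : slot k ((i : ℕ) : ℤ) = i := by
  simpa using slot_mul_add 0 i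

theorem slot_add_one (q : ℤ) : slot k (q + 1) = slot k q + 1 := by
  obtain ⟨a, i, rfl⟩ := exists_eq_mul_add k q
  rw [slot_mul_add]
  induction i using Fin.lastCases with
  | last =>
    rw [Fin.last_add_one, show ((k : ℤ) + 1) * a + ((Fin.last k : Fin (k + 1)) : ℕ) + 1 =
      ((k : ℤ) + 1) * (a + 1) + ((0 : Fin (k + 1)) : ℕ) by simp; ring, slot_mul_add]
  | cast j =>
    rw [Fin.coeSucc_eq_succ, show ((k : ℤ) + 1) * a + ((j.castSucc : Fin (k + 1)) : ℕ) + 1 =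
      ((k : ℤ) + 1) * a + ((j.succ : Fin (k + 1)) : ℕ) by simp; ring, slot_mul_add]

variable (T : ℝ) (r : Fin k → ℝ)

theorem grid_add_mul (q m : ℤ) : grid T r (q + ((k : ℤ) + 1) * m) = grid T r q + T * m := by
  unfold grid
  rw [slot_add_mul, Int.add_mul_ediv_left _ _ (by omega)]
  push_cast; ring

theorem grid_mul_add (a : ℤ) (i : Fin (k + 1)) :
    grid T r (((k : ℤ) + 1) * a + (i : ℕ)) = T * a + (Fin.cons 0 r : Fin (k + 1) → ℝ) i := by
  rw [grid, slot_mul_add, ediv_mul_add]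

/-- The upper end of a slot that ends at a link. -/
theorem grid_add_one_of_slot {q : ℤ} {j : Fin k} (h : slot k q = j.castSucc) :
    ∃ a : ℤ, grid T r (q + 1) = r j + T * a := by
  obtain ⟨a, i, rfl⟩ := exists_eq_mul_add k q
  rw [slot_mul_add] at h
  subst h
  refine ⟨a, ?_⟩
  rw [show ((k : ℤ) + 1) * a + ((j.castSucc : Fin (k + 1)) : ℕ) + 1 =
      ((k : ℤ) + 1) * a + ((j.succ : Fin (k + 1)) : ℕ) by simp; ring, grid_mul_add,
    Fin.cons_succ, add_comm]

theorem grid_natCast_add_one (j : Fin k) : grid T r (((j : ℕ) : ℤ) + 1) = r j := by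
  have := grid_mul_add T r 0 j.succ
  simpa using this

theorem grid_zero : grid T r 0 = 0 := by
  have := grid_mul_add T r 0 0
  simpa using this

variable {T r}

theorem grid_strictMono (hr : StrictMono r) (hT : 0 < T) (hrT : ∀ j, r j ∈ Set.Ioo 0 T) :
    StrictMono (grid T r) := by
  refine strictMono_int_of_lt_succ fun q => ?_
  obtain ⟨a, i, rfl⟩ := exists_eq_mul_add k q
  have hc : StrictMono (Fin.cons 0 r : Fin (k + 1) → ℝ) := by
    refine Fin.strictMono_iff_lt_succ.2 fun i => ?_
    rw [Fin.cons_succ]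
    cases k with
    | zero => exact i.elim0
    | succ k =>
      induction i using Fin.cases with
      | zero => simpa using (hrT 0).1
      | succ i =>
        rw [← Fin.succ_castSucc, Fin.cons_succ]
        exact hr (Fin.castSucc_lt_succ (i := i))
  have hlt : ∀ i, (Fin.cons 0 r : Fin (k + 1) → ℝ) i < T := by
    intro i
    induction i using Fin.cases with
    | zero => simpa using hT
    | succ i => simpa using (hrT i).2
  rw [grid_mul_add]
  induction i using Fin.lastCases with
  | last =>
    rw [show ((k : ℤ) + 1) * a + ((Fin.last k : Fin (k + 1)) : ℕ) + 1 =
      ((k : ℤ) + 1) * (a + 1) + ((0 : Fin (k + 1)) : ℕ) by simp; ring, grid_mul_add]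
    have := hlt (Fin.last k)
    simp only [Fin.cons_zero]
    push_cast
    linarith
  | cast j =>
    rw [show ((k : ℤ) + 1) * a + ((j.castSucc : Fin (k + 1)) : ℕ) + 1 =
      ((k : ℤ) + 1) * a + ((j.succ : Fin (k + 1)) : ℕ) by simp; ring, grid_mul_add]
    have := hc (Fin.castSucc_lt_succ (i := j))
    linarith

/-- The times immediately after `s` in the direction `d` belong to the slot with number `q`. -/
def InSlot (T : ℝ) (r : Fin k → ℝ) (d : ℤˣ) (q : ℤ) (s : ℝ) : Prop :=
  if d = 1 then grid T r q ≤ s ∧ s < grid T r (q + 1) else grid T r q < s ∧ s ≤ grid T r (q + 1)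

theorem inSlot_one {q : ℤ} {s : ℝ} :
    InSlot T r 1 q s ↔ grid T r q ≤ s ∧ s < grid T r (q + 1) := by simp [InSlot]

theorem inSlot_neg_one {q : ℤ} {s : ℝ} :
    InSlot T r (-1) q s ↔ grid T r q < s ∧ s ≤ grid T r (q + 1) := by simp [InSlot]

theorem inSlot_grid_one (hg : StrictMono (grid T r)) (q : ℤ) : InSlot T r 1 q (grid T r q) :=
  inSlot_one.2 ⟨le_rfl, hg (lt_add_one q)⟩

theorem inSlot_grid_neg_one (hg : StrictMono (grid T r)) (q : ℤ) :
    InSlot T r (-1) q (grid T r (q + 1)) :=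
  inSlot_neg_one.2 ⟨hg (lt_add_one q), le_rfl⟩

theorem InSlot.unique (hg : StrictMono (grid T r)) {d : ℤˣ} {q q' : ℤ} {s : ℝ}
    (h : InSlot T r d q s) (h' : InSlot T r d q' s) : q = q' := by
  have key : ∀ p p' : ℤ, InSlot T r d p s → InSlot T r d p' s → ¬ p < p' := by
    intro p p' hp hp' hlt
    have := hg.monotone (show p + 1 ≤ p' by omega)
    rcases Int.units_eq_one_or d with rfl | rfl
    · rw [inSlot_one] at hp hp'; linarith
    · rw [inSlot_neg_one] at hp hp'; linarith
  have h1 := key q q' h h'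
  have h2 := key q' q h' h
  omega

theorem InSlot.add_mul {d : ℤˣ} {q : ℤ} {s : ℝ} (h : InSlot T r d q s) (m : ℤ) :
    InSlot T r d (q + ((k : ℤ) + 1) * m) (s + T * m) := by
  unfold InSlot at *
  rw [show q + ((k : ℤ) + 1) * m + 1 = q + 1 + ((k : ℤ) + 1) * m by ring, grid_add_mul,
    grid_add_mul]
  split_ifs at * <;> constructor <;> linarith [h.1, h.2]

theorem exists_inSlot (hT : 0 < T) (hg : StrictMono (grid T r)) (d : ℤˣ) (s : ℝ) :
    ∃ q, InSlot T r d q s := by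
  have hmul : ∀ a : ℤ, grid T r (((k : ℤ) + 1) * a) = T * a := by
    intro a
    have := grid_add_mul T r 0 a
    rwa [zero_add, grid_zero, zero_add] at this
  obtain ⟨a, ha⟩ := exists_int_lt (s / T)
  obtain ⟨b, hb⟩ := exists_int_gt (s / T)
  rw [lt_div_iff₀ hT] at ha
  rw [div_lt_iff₀ hT] at hb
  have hlo : grid T r (((k : ℤ) + 1) * a) < s := by rw [hmul]; linarith
  have hhi : s < grid T r (((k : ℤ) + 1) * b) := by rw [hmul]; linarith
  rcases Int.units_eq_one_or d with rfl | rfl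
  · obtain ⟨q, hq, hmax⟩ := Int.exists_greatest_of_bdd (P := fun q => grid T r q ≤ s)
      ⟨((k : ℤ) + 1) * b, fun z hz => (hg.lt_iff_lt.1 (hz.trans_lt hhi)).le⟩ ⟨_, hlo.le⟩
    refine ⟨q, inSlot_one.2 ⟨hq, ?_⟩⟩
    by_contra h
    have := hmax (q + 1) (not_lt.1 h)
    omega
  · obtain ⟨q, hq, hmax⟩ := Int.exists_greatest_of_bdd (P := fun q => grid T r q < s)
      ⟨((k : ℤ) + 1) * b, fun z hz => (hg.lt_iff_lt.1 (hz.trans hhi)).le⟩ ⟨_, hlo⟩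
    refine ⟨q, inSlot_neg_one.2 ⟨hq, ?_⟩⟩
    by_contra h
    have := hmax (q + 1) (not_le.1 h)
    omega

end Grid

/-! ### Trajectories of time-ordered configurations -/

section Timed

variable {V : Type*} [DecidableEq V] {G : SimpleGraph V} {β : ℝ} {k : ℕ}

/-- The exchange of the end-points of an edge. -/
def edgeSwap (e : Sym2 V) : Equiv.Perm V :=
  Sym2.lift ⟨fun x y => Equiv.swap x y, fun x y => Equiv.swap_comm x y⟩ e

@[simp] theorem edgeSwap_mk (x y : V) : edgeSwap s(x, y) = Equiv.swap x y := rfl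

theorem edgeSwap_edgeSwap (e : Sym2 V) (x : V) : edgeSwap e (edgeSwap e x) = x := by
  induction e using Sym2.ind with
  | _ a b => simp

theorem edgeSwap_ne_iff (e : G.edgeSet) (x : V) :
    edgeSwap (e : Sym2 V) x ≠ x ↔ x ∈ (e : Sym2 V) := by
  obtain ⟨e, he⟩ := e
  induction e using Sym2.ind with
  | _ a b =>
    have hne : a ≠ b := G.ne_of_adj he
    simp only [edgeSwap_mk, Sym2.mem_iff]
    rw [Equiv.swap_apply_ne_self_iff]
    simp [hne]

theorem mk_edgeSwap {e : Sym2 V} {x : V} (hx : x ∈ e) : s(x, edgeSwap e x) = e := by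
  induction e using Sym2.ind with
  | _ a b =>
    rcases Sym2.mem_iff.1 hx with rfl | rfl
    · simp
    · simp [Sym2.eq_swap]

/-- The ladder of a sequence of marked edges in the order of their times. The level above the last
slot, at the time `0`, carries no link. -/
def linkLadder (e : Fin k → G.edgeSet × Mark) : Ladder V (Fin (k + 1)) where
  next := Equiv.addRight 1
  swap := Fin.snoc (fun j => ⇑(edgeSwap ((e j).1 : Sym2 V))) id
  bar := Fin.snoc (fun j => decide ((e j).2 = Mark.dbar)) false
  swap_swap i x := by
    induction i using Fin.lastCases with
    | last => simp
    | cast j => simp [edgeSwap_edgeSwap]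

variable (e : Fin k → G.edgeSet × Mark)

theorem linkLadder_next (i : Fin (k + 1)) : (linkLadder e).next i = i + 1 := rfl

theorem linkLadder_swap_last (x : V) : (linkLadder e).swap (Fin.last k) x = x := by
  simp [linkLadder]

theorem linkLadder_swap_castSucc (j : Fin k) (x : V) :
    (linkLadder e).swap j.castSucc x = edgeSwap ((e j).1 : Sym2 V) x := by
  simp [linkLadder]

theorem linkLadder_bar_castSucc (j : Fin k) :
    (linkLadder e).bar j.castSucc = decide ((e j).2 = Mark.dbar) := by
  simp [linkLadder]

theorem swap_castSucc_ne_iff (j : Fin k) (x : V) :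
    (linkLadder e).swap j.castSucc x ≠ x ↔ x ∈ ((e j).1 : Sym2 V) := by
  rw [linkLadder_swap_castSucc, edgeSwap_ne_iff]

theorem turn_castSucc_iff (j : Fin k) (x : V) :
    (linkLadder e).Turn j.castSucc x ↔ (e j).2 = Mark.dbar ∧ x ∈ ((e j).1 : Sym2 V) := by
  rw [Ladder.Turn, swap_castSucc_ne_iff, linkLadder_bar_castSucc, decide_eq_true_iff]

theorem crossing_castSucc_iff (j : Fin k) (x : V) :
    (linkLadder e).Crossing j.castSucc x ↔ (e j).2 = Mark.cross ∧ x ∈ ((e j).1 : Sym2 V) := by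
  rw [Ladder.Crossing, swap_castSucc_ne_iff, linkLadder_bar_castSucc, decide_eq_false_iff_not]
  refine and_congr ?_ Iff.rfl
  cases (e j).2 <;> simp

theorem not_crossing_last (x : V) : ¬ (linkLadder e).Crossing (Fin.last k) x :=
  fun h => h.2 (linkLadder_swap_last e x)

theorem isSublattice_linkLadder {ε : V → ℤˣ} (hε : ∀ x y, G.Adj x y → ε y = -ε x) :
    (linkLadder e).IsSublattice ε := by
  intro i x hx
  induction i using Fin.lastCases with
  | last => exact absurd (linkLadder_swap_last e x) hx
  | cast j =>
    rw [swap_castSucc_ne_iff] at hx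
    rw [linkLadder_swap_castSucc]
    refine hε _ _ ?_
    have h := (e j).1.2
    rw [← mk_edgeSwap hx] at h
    exact h

variable (r : Fin k → ℝ)

theorem move_coe (s : ℝ) (d : ℤˣ) (r' : ℝ) :
    move ((s : ℝ) : AddCircle (2 * β)) d r' =
      ((s + ((d : ℤ) : ℝ) * r' : ℝ) : AddCircle (2 * β)) := by
  simp [move]

theorem coe_eq_coe {s s' : ℝ} (h : (s : AddCircle (2 * β)) = s') :
    ∃ m : ℤ, s' = s + 2 * β * m := by
  obtain ⟨m, hm⟩ := (QuotientAddGroup.eq.1 h : -s + s' ∈ AddSubgroup.zmultiples (2 * β))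
  refine ⟨m, ?_⟩
  have : (m : ℝ) * (2 * β) = -s + s' := by simpa using hm
  linarith

theorem coe_add_mul (s : ℝ) (m : ℤ) :
    ((s + 2 * β * m : ℝ) : AddCircle (2 * β)) = s := by
  rw [AddCircle.coe_add, mul_comm (2 * β), ← zsmul_eq_mul, AddCircle.coe_zsmul,
    AddCircle.coe_period]
  simp

omit [DecidableEq V] in
theorem mem_timedConfig {l : Link G β} :
    l ∈ timedConfig β e r ↔ ∃ j, (e j, (r j : AddCircle (2 * β))) = l := by
  simp [timedConfig]

omit [DecidableEq V] in
theorem mem_timedConfig_coe {l : G.edgeSet × Mark} {s : ℝ} :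
    (l, (s : AddCircle (2 * β))) ∈ timedConfig β e r ↔
      ∃ (q : ℤ) (j : Fin k), s = grid (2 * β) r (q + 1) ∧ slot k q = j.castSucc ∧ e j = l := by
  rw [mem_timedConfig]
  constructor
  · rintro ⟨j, hj⟩
    rw [Prod.mk.injEq] at hj
    obtain ⟨m, hm⟩ := coe_eq_coe hj.2
    refine ⟨(j : ℕ) + ((k : ℤ) + 1) * m, j, ?_, ?_, hj.1⟩
    · rw [add_right_comm, grid_add_mul, grid_natCast_add_one, hm]
    · rw [slot_add_mul]
      exact slot_natCast j.castSucc
  · rintro ⟨q, j, rfl, hq, rfl⟩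
    obtain ⟨a, ha⟩ := grid_add_one_of_slot (2 * β) r hq
    exact ⟨j, by rw [ha, coe_add_mul]⟩

theorem touched_coe_iff {x : V} {s : ℝ} :
    Touched (timedConfig β e r) x (s : AddCircle (2 * β)) ↔
      ∃ q : ℤ, s = grid (2 * β) r (q + 1) ∧ (linkLadder e).swap (slot k q) x ≠ x := by
  constructor
  · rintro ⟨⟨l, t⟩, hl, hx, rfl⟩
    obtain ⟨q, j, hs, hq, rfl⟩ := (mem_timedConfig_coe e r).1 hl
    exact ⟨q, hs, by rw [hq, swap_castSucc_ne_iff]; exact hx⟩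
  · rintro ⟨q, hs, hq⟩
    rcases Fin.eq_castSucc_or_eq_last (slot k q) with ⟨j, hj⟩ | hj
    · refine ⟨(e j, (s : AddCircle (2 * β))), (mem_timedConfig_coe e r).2 ⟨q, j, hs, hj, rfl⟩,
        ?_, rfl⟩
      rwa [hj, swap_castSucc_ne_iff] at hq
    · rw [hj] at hq
      exact absurd (linkLadder_swap_last e x) hq

variable [Fact (0 < 2 * β)]

/-- The number of the slot of a state. -/
def slotNumber (hg : StrictMono (grid (2 * β) r)) (a : State V β) : ℤ :=
  Classical.choose (exists_inSlot Fact.out hg a.2.2 (timeRep a.2.1))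

/-- The discretization of a state. -/
def locate (hg : StrictMono (grid (2 * β) r)) (a : State V β) : V × Fin (k + 1) × ℤˣ :=
  (a.1, slot k (slotNumber r hg a), a.2.2)

variable {r} (hg : StrictMono (grid (2 * β) r))

omit [DecidableEq V] in
theorem locate_eq {x : V} {d : ℤˣ} {q : ℤ} {s : ℝ} (h : InSlot (2 * β) r d q s) :
    locate r hg (x, (s : AddCircle (2 * β)), d) = (x, slot k q, d) := by
  have hspec := Classical.choose_spec
    (exists_inSlot Fact.out hg d (timeRep (s : AddCircle (2 * β))))
  obtain ⟨m, hm⟩ := coe_eq_coe (coe_timeRep (s : AddCircle (2 * β)))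
  have h' := hspec.add_mul m
  rw [← hm] at h'
  have := h.unique hg h'
  unfold locate slotNumber
  rw [this, slot_add_mul]

/-- Passing a level without link at `x`. -/
theorem sameCycle_slot_succ {x : V} {q : ℤ} (h : (linkLadder e).swap (slot k q) x = x) (d : ℤˣ) :
    (linkLadder e).step.SameCycle (x, slot k q, d) (x, slot k (q + 1), d) := by
  have ht : ¬ (linkLadder e).Turn (slot k q) x := fun ht => ht.2 h
  rw [slot_add_one, ← linkLadder_next e]
  rcases Int.units_eq_one_or d with rfl | rfl
  · have : (linkLadder e).step (x, slot k q, 1) = (x, (linkLadder e).next (slot k q), 1) := by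
      change Ladder.flip ((linkLadder e).endMatch _) = _
      rw [Ladder.endMatch_one, if_neg ht, h]
      simp [Ladder.flip]
    rw [← this]
    exact Equiv.Perm.sameCycle_apply_right.2 (Equiv.Perm.SameCycle.refl _ _)
  · have : (linkLadder e).step (x, (linkLadder e).next (slot k q), -1) = (x, slot k q, -1) := by
      change Ladder.flip ((linkLadder e).endMatch _) = _
      rw [Ladder.endMatch_neg_one, if_neg ht, h]
      rfl
    rw [← this]
    exact Equiv.Perm.sameCycle_apply_left.2 (Equiv.Perm.SameCycle.refl _ _)

theorem sameCycle_slots {x : V} {q q' : ℤ} (hq : q ≤ q')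
    (h : ∀ p, q ≤ p → p < q' → (linkLadder e).swap (slot k p) x = x) (d : ℤˣ) :
    (linkLadder e).step.SameCycle (x, slot k q, d) (x, slot k q', d) := by
  induction q', hq using Int.leInduction with
  | base => exact Equiv.Perm.SameCycle.refl _ _
  | succ m hm ih =>
    exact (ih fun p h1 h2 => h p h1 (by omega)).trans
      (sameCycle_slot_succ e (h m hm (by omega)) d)

/-- Passing through a link upwards. -/
theorem step_link_up {j : Fin k} {x : V} (hx : x ∈ ((e j).1 : Sym2 V)) :
    (linkLadder e).step (x, j.castSucc, 1) = (linkLadder e).arrival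
      (j.castSucc, edgeSwap ((e j).1 : Sym2 V) x, (e j).2.turn 1) := by
  change Ladder.flip ((linkLadder e).endMatch _) = _
  rw [Ladder.endMatch_one]
  cases hm : (e j).2 with
  | cross =>
    rw [if_neg (by rw [turn_castSucc_iff, hm]; simp), linkLadder_swap_castSucc]
    simp [Ladder.flip, Ladder.arrival, Mark.turn]
  | dbar =>
    rw [if_pos ((turn_castSucc_iff e j x).2 ⟨hm, hx⟩), linkLadder_swap_castSucc]
    simp [Ladder.flip, Ladder.arrival, Mark.turn]

/-- Passing through a link downwards. -/
theorem step_link_down {j : Fin k} {x : V} (hx : x ∈ ((e j).1 : Sym2 V)) :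
    (linkLadder e).step (x, (linkLadder e).next j.castSucc, -1) = (linkLadder e).arrival
      (j.castSucc, edgeSwap ((e j).1 : Sym2 V) x, (e j).2.turn (-1)) := by
  change Ladder.flip ((linkLadder e).endMatch _) = _
  rw [Ladder.endMatch_neg_one]
  cases hm : (e j).2 with
  | cross =>
    rw [if_neg (by rw [turn_castSucc_iff, hm]; simp), linkLadder_swap_castSucc]
    simp [Ladder.flip, Ladder.arrival, Mark.turn]
  | dbar =>
    rw [if_pos ((turn_castSucc_iff e j x).2 ⟨hm, hx⟩), linkLadder_swap_castSucc]
    simp [Ladder.flip, Ladder.arrival, Mark.turn]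

theorem locate_arrival {z : V} {q : ℤ} {j : Fin k} (hq : slot k q = j.castSucc) (d : ℤˣ) :
    locate r hg (z, (grid (2 * β) r (q + 1) : AddCircle (2 * β)), d) =
      (linkLadder e).arrival (j.castSucc, z, d) := by
  rcases Int.units_eq_one_or d with rfl | rfl
  · rw [locate_eq hg (inSlot_grid_one hg (q + 1)), slot_add_one, hq]
    rfl
  · rw [locate_eq hg (inSlot_grid_neg_one hg q), hq]
    rfl

theorem edgeSwap_of_eq {x y : V} {e : Sym2 V} (h : e = s(x, y)) : edgeSwap e x = y := by
  subst h; simp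

theorem sameCycle_of_step {a b : State V β} (h : Step (timedConfig β e r) a b) :
    (linkLadder e).step.SameCycle (locate r hg a) (locate r hg b) := by
  have hpos : 0 < 2 * β := Fact.out
  cases h with
  | glide x t d r' hr' free =>
    obtain ⟨s, rfl⟩ := QuotientAddGroup.mk_surjective t
    change (linkLadder e).step.SameCycle (locate r hg (x, (s : AddCircle (2 * β)), d)) _
    have free' : ∀ r'', 0 < r'' → r'' ≤ r' →
        ¬ Touched (timedConfig β e r) x ((s + ((d : ℤ) : ℝ) * r'' : ℝ) : AddCircle (2 * β)) := by
      intro r'' h1 h2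
      rw [← move_coe]
      exact free r'' h1 h2
    change (linkLadder e).step.SameCycle _
      (locate r hg (x, move (s : AddCircle (2 * β)) d r', d))
    rw [move_coe]
    obtain ⟨q, hq⟩ := exists_inSlot hpos hg d s
    obtain ⟨q', hq'⟩ := exists_inSlot hpos hg d (s + ((d : ℤ) : ℝ) * r')
    rw [locate_eq hg hq, locate_eq hg hq']
    rcases Int.units_eq_one_or d with rfl | rfl
    · rw [inSlot_one] at hq hq'
      have hle : q < q' + 1 := hg.lt_iff_lt.1 (by
        refine hq.1.trans_lt (lt_of_le_of_lt ?_ hq'.2); simpa using hr')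
      refine sameCycle_slots e (by omega) (fun p h1 h2 => ?_) 1
      have h3 := hg.monotone (show q + 1 ≤ p + 1 by omega)
      have h4 := hg.monotone (show p + 1 ≤ q' by omega)
      have := free' (grid (2 * β) r (p + 1) - s) (by linarith [hq.2])
        (by have := hq'.1; simp at this; linarith)
      by_contra hne
      refine this ((touched_coe_iff e r).2 ⟨p, by simp, hne⟩)
    · rw [inSlot_neg_one] at hq hq'
      have hle : q' < q + 1 := hg.lt_iff_lt.1 (by
        refine hq'.1.trans_le (le_trans ?_ hq.2); simpa using hr')
      refine (sameCycle_slots e (by omega) (fun p h1 h2 => ?_) (-1)).symm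
      have h3 := hg.monotone (show q' + 1 ≤ p + 1 by omega)
      have h4 := hg.monotone (show p + 1 ≤ q by omega)
      have := free' (s - grid (2 * β) r (p + 1)) (by linarith [hq.1])
        (by have := hq'.2; simp at this; linarith)
      by_contra hne
      refine this ((touched_coe_iff e r).2 ⟨p, by simp, hne⟩)
  | jump x y t d r' m hr' free hxy hl =>
    obtain ⟨s, rfl⟩ := QuotientAddGroup.mk_surjective t
    change (linkLadder e).step.SameCycle (locate r hg (x, (s : AddCircle (2 * β)), d)) _
    have free' : ∀ r'', 0 < r'' → r'' < r' →
        ¬ Touched (timedConfig β e r) x ((s + ((d : ℤ) : ℝ) * r'' : ℝ) : AddCircle (2 * β)) := by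
      intro r'' h1 h2
      rw [← move_coe]
      exact free r'' h1 h2
    change ((_, m), move (s : AddCircle (2 * β)) d r') ∈ _ at hl
    change (linkLadder e).step.SameCycle _
      (locate r hg (y, move (s : AddCircle (2 * β)) d r', m.turn d))
    rw [move_coe] at hl ⊢
    obtain ⟨p, j, hs, hp, hej⟩ := (mem_timedConfig_coe e r).1 hl
    rw [hs, locate_arrival e hg hp]
    have he1 : ((e j).1 : Sym2 V) = s(x, y) := by rw [hej]
    have he2 : (e j).2 = m := by rw [hej]
    have hx : x ∈ ((e j).1 : Sym2 V) := by rw [he1]; simp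
    rw [← edgeSwap_of_eq he1, ← he2]
    obtain ⟨q, hq⟩ := exists_inSlot hpos hg d s
    rw [locate_eq hg hq]
    rcases Int.units_eq_one_or d with rfl | rfl
    · rw [← step_link_up e hx, Equiv.Perm.sameCycle_apply_right, ← hp]
      rw [inSlot_one] at hq
      have hs' : s + r' = grid (2 * β) r (p + 1) := by simpa using hs
      have hle : q < p + 1 := hg.lt_iff_lt.1 (by linarith [hq.1])
      refine sameCycle_slots e (by omega) (fun p' h1 h2 => ?_) 1
      have h3 := hg.monotone (show q + 1 ≤ p' + 1 by omega)
      have h4 := hg (show p' + 1 < p + 1 by omega)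
      have := free' (grid (2 * β) r (p' + 1) - s) (by linarith [hq.2]) (by linarith)
      by_contra hne
      exact this ((touched_coe_iff e r).2 ⟨p', by simp, hne⟩)
    · rw [← step_link_down e hx, Equiv.Perm.sameCycle_apply_right, ← hp, linkLadder_next,
        ← slot_add_one]
      rw [inSlot_neg_one] at hq
      have hs' : s - r' = grid (2 * β) r (p + 1) := by simpa [sub_eq_add_neg] using hs
      have hle : p + 1 < q + 1 := hg.lt_iff_lt.1 (by linarith [hq.2])
      refine (sameCycle_slots e (by omega) (fun p' h1 h2 => ?_) (-1)).symm
      have h3 := hg (show p + 1 < p' + 1 by omega)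
      have h4 := hg.monotone (show p' + 1 ≤ q by omega)
      have := free' (s - grid (2 * β) r (p' + 1)) (by linarith [hq.1]) (by linarith)
      by_contra hne
      exact this ((touched_coe_iff e r).2 ⟨p', by simp, hne⟩)

theorem sameCycle_of_sameTrajectory {a b : State V β}
    (h : SameTrajectory (timedConfig β e r) a b) :
    (linkLadder e).step.SameCycle (locate r hg a) (locate r hg b) := by
  induction h with
  | rel a b h => exact sameCycle_of_step e hg h
  | refl a => exact Equiv.Perm.SameCycle.refl _ _
  | symm a b _ ih => exact ih.symm
  | trans a b c _ _ ih1 ih2 => exact ih1.trans ih2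

end Timed

section TimedLoops

variable {V : Type*} [DecidableEq V] {G : SimpleGraph V} {β : ℝ} {k : ℕ}
  (e : Fin k → G.edgeSet × Mark) {r : Fin k → ℝ}

theorem sameTrajectory_glide {x : V} {s s' : ℝ} {d : ℤˣ} (hs : 0 ≤ ((d : ℤ) : ℝ) * (s' - s))
    (free : ∀ p : ℤ, 0 < ((d : ℤ) : ℝ) * (grid (2 * β) r (p + 1) - s) →
      0 ≤ ((d : ℤ) : ℝ) * (s' - grid (2 * β) r (p + 1)) →
      (linkLadder e).swap (slot k p) x = x) :
    SameTrajectory (timedConfig β e r) (x, (s : AddCircle (2 * β)), d)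
      (x, (s' : AddCircle (2 * β)), d) := by
  have hd : ((d : ℤ) : ℝ) * ((d : ℤ) : ℝ) = 1 := by
    rcases Int.units_eq_one_or d with rfl | rfl <;> simp
  have h := Step.glide (ω := timedConfig β e r) x (s : AddCircle (2 * β)) d
    (((d : ℤ) : ℝ) * (s' - s)) hs (fun r' h1 h2 => by
      rw [move_coe, touched_coe_iff]
      rintro ⟨p, hp, hne⟩
      refine hne (free p ?_ ?_)
      · rw [← hp, add_sub_cancel_left, ← mul_assoc, hd, one_mul]; exact h1
      · rw [← hp, show ((d : ℤ) : ℝ) * (s' - (s + ((d : ℤ) : ℝ) * r')) =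
          ((d : ℤ) : ℝ) * (s' - s) - (((d : ℤ) : ℝ) * ((d : ℤ) : ℝ)) * r' by ring, hd]
        linarith)
  rw [move_coe, ← mul_assoc, hd, one_mul, add_sub_cancel] at h
  exact Relation.EqvGen.rel _ _ h

theorem sameTrajectory_jump {x : V} {s : ℝ} {d : ℤˣ} {q : ℤ} {j : Fin k}
    (hq : slot k q = j.castSucc) (hx : x ∈ ((e j).1 : Sym2 V))
    (hs : 0 < ((d : ℤ) : ℝ) * (grid (2 * β) r (q + 1) - s))
    (free : ∀ p : ℤ, 0 < ((d : ℤ) : ℝ) * (grid (2 * β) r (p + 1) - s) →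
      0 < ((d : ℤ) : ℝ) * (grid (2 * β) r (q + 1) - grid (2 * β) r (p + 1)) → False) :
    SameTrajectory (timedConfig β e r) (x, (s : AddCircle (2 * β)), d)
      (edgeSwap ((e j).1 : Sym2 V) x, (grid (2 * β) r (q + 1) : AddCircle (2 * β)),
        (e j).2.turn d) := by
  have hd : ((d : ℤ) : ℝ) * ((d : ℤ) : ℝ) = 1 := by
    rcases Int.units_eq_one_or d with rfl | rfl <;> simp
  have hmove : move (s : AddCircle (2 * β)) d (((d : ℤ) : ℝ) * (grid (2 * β) r (q + 1) - s)) =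
      (grid (2 * β) r (q + 1) : AddCircle (2 * β)) := by
    rw [move_coe, ← mul_assoc, hd, one_mul, add_sub_cancel]
  have hmk := mk_edgeSwap hx
  have hadj : G.Adj x (edgeSwap ((e j).1 : Sym2 V) x) := by
    have h := (e j).1.2
    rw [← hmk] at h
    exact h
  have hej : ((⟨s(x, edgeSwap ((e j).1 : Sym2 V) x), G.mem_edgeSet.2 hadj⟩ : G.edgeSet),
      (e j).2) = e j := by
    refine Prod.ext (Subtype.ext hmk) rfl
  have h := Step.jump (ω := timedConfig β e r) x (edgeSwap ((e j).1 : Sym2 V) x)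
    (s : AddCircle (2 * β)) d (((d : ℤ) : ℝ) * (grid (2 * β) r (q + 1) - s)) (e j).2 hs
    (fun r' h1 h2 => by
      rw [move_coe, touched_coe_iff]
      rintro ⟨p, hp, -⟩
      refine free p ?_ ?_
      · rw [← hp, add_sub_cancel_left, ← mul_assoc, hd, one_mul]; exact h1
      · rw [← hp, show ((d : ℤ) : ℝ) * (grid (2 * β) r (q + 1) - (s + ((d : ℤ) : ℝ) * r')) =
          ((d : ℤ) : ℝ) * (grid (2 * β) r (q + 1) - s) -
            (((d : ℤ) : ℝ) * ((d : ℤ) : ℝ)) * r' by ring, hd]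
        linarith)
    hadj (by rw [hej, hmove, mem_timedConfig_coe]; exact ⟨q, j, rfl, hq, rfl⟩)
  rw [hmove] at h
  exact Relation.EqvGen.rel _ _ h

theorem sameTrajectory_of_inSlot (hg : StrictMono (grid (2 * β) r)) {x : V} {d : ℤˣ} {q : ℤ}
    {s s' : ℝ} (h : InSlot (2 * β) r d q s) (h' : InSlot (2 * β) r d q s') :
    SameTrajectory (timedConfig β e r) (x, (s : AddCircle (2 * β)), d)
      (x, (s' : AddCircle (2 * β)), d) := by
  have key : ∀ s s' : ℝ, InSlot (2 * β) r d q s → InSlot (2 * β) r d q s' →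
      0 ≤ ((d : ℤ) : ℝ) * (s' - s) → SameTrajectory (timedConfig β e r)
        (x, (s : AddCircle (2 * β)), d) (x, (s' : AddCircle (2 * β)), d) := by
    intro s s' h h' hs
    refine sameTrajectory_glide e hs fun p h1 h2 => ?_
    exfalso
    rcases Int.units_eq_one_or d with rfl | rfl
    · rw [inSlot_one] at h h'
      simp at h1 h2
      have h3 : q < p + 1 := hg.lt_iff_lt.1 (by linarith [h.1])
      have h4 : p + 1 < q + 1 := hg.lt_iff_lt.1 (by linarith [h'.2])
      omega
    · rw [inSlot_neg_one] at h h'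
      simp at h1 h2
      have h3 : p + 1 < q + 1 := hg.lt_iff_lt.1 (by linarith [h.2])
      have h4 : q < p + 1 := hg.lt_iff_lt.1 (by linarith [h'.1])
      omega
  rcases le_total 0 (((d : ℤ) : ℝ) * (s' - s)) with hs | hs
  · exact key s s' h h' hs
  · exact (key s' s h' h (by linarith)).symm

variable [Fact (0 < 2 * β)] (hg : StrictMono (grid (2 * β) r))

theorem sameTrajectory_of_locate_eq {a b : State V β} (h : locate r hg a = locate r hg b) :
    SameTrajectory (timedConfig β e r) a b := by
  have hpos : 0 < 2 * β := Fact.out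
  obtain ⟨x, t, d⟩ := a
  obtain ⟨x', t', d'⟩ := b
  obtain ⟨s, rfl⟩ := QuotientAddGroup.mk_surjective t
  obtain ⟨s', rfl⟩ := QuotientAddGroup.mk_surjective t'
  change locate r hg (x, (s : AddCircle (2 * β)), d) =
    locate r hg (x', (s' : AddCircle (2 * β)), d') at h
  change SameTrajectory _ (x, (s : AddCircle (2 * β)), d) (x', (s' : AddCircle (2 * β)), d')
  obtain ⟨q, hq⟩ := exists_inSlot hpos hg d s
  obtain ⟨q', hq'⟩ := exists_inSlot hpos hg d' s'
  rw [locate_eq hg hq, locate_eq hg hq', Prod.mk.injEq, Prod.mk.injEq] at h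
  obtain ⟨rfl, h2, rfl⟩ := h
  obtain ⟨m, rfl⟩ := eq_of_slot_eq h2
  have := sameTrajectory_of_inSlot e hg (x := x) (hq.add_mul m) hq'
  rwa [coe_add_mul] at this

/-- Every step of the discretized motion comes from a continuous motion. -/
theorem exists_sameTrajectory_step (b : V × Fin (k + 1) × ℤˣ) : ∃ a a' : State V β,
    locate r hg a = b ∧ locate r hg a' = (linkLadder e).step b ∧
      SameTrajectory (timedConfig β e r) a a' := by
  obtain ⟨x, i, d⟩ := b
  rcases Int.units_eq_one_or d with rfl | rfl
  · set q : ℤ := ((i : ℕ) : ℤ) with hqdef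
    have hqi : slot k q = i := slot_natCast i
    have hlt := hg (lt_add_one q)
    have hgap : ∀ p : ℤ, grid (2 * β) r q < grid (2 * β) r (p + 1) →
        grid (2 * β) r (p + 1) < grid (2 * β) r (q + 1) → False := by
      intro p h1 h2
      have h3 := hg.lt_iff_lt.1 h1
      have h4 := hg.lt_iff_lt.1 h2
      omega
    refine ⟨(x, (grid (2 * β) r q : AddCircle (2 * β)), 1), ?_⟩
    have hloc : locate r hg (x, (grid (2 * β) r q : AddCircle (2 * β)), 1) = (x, i, 1) := by
      rw [locate_eq hg (inSlot_grid_one hg q), hqi]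
    by_cases hx : (linkLadder e).swap i x = x
    · refine ⟨(x, (grid (2 * β) r (q + 1) : AddCircle (2 * β)), 1), hloc, ?_, ?_⟩
      · rw [locate_eq hg (inSlot_grid_one hg (q + 1)), slot_add_one, hqi]
        change _ = Ladder.flip ((linkLadder e).endMatch _)
        rw [Ladder.endMatch_one, if_neg fun ht : (linkLadder e).Turn i x => ht.2 hx, hx]
        simp [Ladder.flip, linkLadder_next]
      · refine sameTrajectory_glide e (by simpa using hlt.le) fun p h1 h2 => ?_
        simp at h1 h2
        rcases h2.lt_or_eq with h3 | h3
        · exact (hgap p h1 h3).elim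
        · have := hg.injective h3
          rw [show p = q by omega, hqi, hx]
    · rcases Fin.eq_castSucc_or_eq_last i with ⟨j, rfl⟩ | rfl
      · have hxe := (swap_castSucc_ne_iff e j x).1 hx
        refine ⟨_, hloc, ?_, sameTrajectory_jump e hqi hxe (by simpa using hlt)
          fun p h1 h2 => hgap p (by simpa using h1) (by simpa using h2)⟩
        rw [locate_arrival e hg hqi, step_link_up e hxe]
      · exact absurd (linkLadder_swap_last e x) hx
  · obtain ⟨i, rfl⟩ := (linkLadder e).next.surjective i
    set q : ℤ := ((i : ℕ) : ℤ) with hqdef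
    have hqi : slot k q = i := slot_natCast i
    have hlt := hg (lt_add_one (q + 1))
    have hgap : ∀ p : ℤ, grid (2 * β) r (q + 1) < grid (2 * β) r (p + 1) →
        grid (2 * β) r (p + 1) < grid (2 * β) r (q + 1 + 1) → False := by
      intro p h1 h2
      have h3 := hg.lt_iff_lt.1 h1
      have h4 := hg.lt_iff_lt.1 h2
      omega
    refine ⟨(x, (grid (2 * β) r (q + 1 + 1) : AddCircle (2 * β)), -1), ?_⟩
    have hloc : locate r hg (x, (grid (2 * β) r (q + 1 + 1) : AddCircle (2 * β)), -1) =
        (x, (linkLadder e).next i, -1) := by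
      rw [locate_eq hg (inSlot_grid_neg_one hg (q + 1)), slot_add_one, hqi]; rfl
    by_cases hx : (linkLadder e).swap i x = x
    · refine ⟨(x, (grid (2 * β) r (q + 1) : AddCircle (2 * β)), -1), hloc, ?_, ?_⟩
      · rw [locate_eq hg (inSlot_grid_neg_one hg q), hqi]
        change _ = Ladder.flip ((linkLadder e).endMatch _)
        rw [Ladder.endMatch_neg_one, if_neg fun ht : (linkLadder e).Turn i x => ht.2 hx, hx]
        rfl
      · refine sameTrajectory_glide e (by simpa using hlt.le) fun p h1 h2 => ?_
        have h1' : grid (2 * β) r (p + 1) < grid (2 * β) r (q + 1 + 1) := by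
          simp at h1; exact h1
        have h2' : grid (2 * β) r (q + 1) ≤ grid (2 * β) r (p + 1) := by
          simpa using h2
        rcases h2'.lt_or_eq with h3 | h3
        · exact (hgap p h3 h1').elim
        · have := hg.injective h3
          rw [show p = q by omega, hqi, hx]
    · rcases Fin.eq_castSucc_or_eq_last i with ⟨j, rfl⟩ | rfl
      · have hxe := (swap_castSucc_ne_iff e j x).1 hx
        refine ⟨_, hloc, ?_, sameTrajectory_jump e hqi hxe (by simpa using hlt)
          fun p h1 h2 => hgap p ?_ ?_⟩
        · rw [locate_arrival e hg hqi, step_link_down e hxe]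
        · have := h2; push_cast at this; linarith
        · have := h1; push_cast at this; linarith
      · exact absurd (linkLadder_swap_last e x) hx

omit [DecidableEq V] in
theorem exists_locate_eq (b : V × Fin (k + 1) × ℤˣ) : ∃ a : State V β, locate r hg a = b := by
  obtain ⟨x, i, d⟩ := b
  rcases Int.units_eq_one_or d with rfl | rfl
  · exact ⟨(x, (grid (2 * β) r ((i : ℕ) : ℤ) : AddCircle (2 * β)), 1), by
      rw [locate_eq hg (inSlot_grid_one hg _), slot_natCast]⟩
  · exact ⟨(x, (grid (2 * β) r (((i : ℕ) : ℤ) + 1) : AddCircle (2 * β)), -1), by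
      rw [locate_eq hg (inSlot_grid_neg_one hg _), slot_natCast]⟩

/-- Two states lie on the same trajectory if and only if their discretizations do. -/
theorem sameTrajectory_iff {a b : State V β} : SameTrajectory (timedConfig β e r) a b ↔
    (linkLadder e).step.SameCycle (locate r hg a) (locate r hg b) := by
  refine ⟨sameCycle_of_sameTrajectory e hg, ?_⟩
  have key : ∀ (m : ℤ) (a b : State V β),
      locate r hg b = ((linkLadder e).step ^ m) (locate r hg a) →
      SameTrajectory (timedConfig β e r) a b := by
    intro m
    have hstep : ∀ a b : State V β, locate r hg b = (linkLadder e).step (locate r hg a) →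
        SameTrajectory (timedConfig β e r) a b := by
      intro a b hab
      obtain ⟨a1, b1, h1, h2, h3⟩ := exists_sameTrajectory_step e hg (locate r hg a)
      exact ((sameTrajectory_of_locate_eq e hg h1.symm).trans _ _ _ h3).trans _ _ _
        (sameTrajectory_of_locate_eq e hg (h2.trans hab.symm))
    induction m with
    | zero => exact fun a b hab => sameTrajectory_of_locate_eq e hg (by simpa using hab.symm)
    | succ m ih =>
      intro a b hab
      rw [add_comm (m : ℤ), zpow_one_add, Equiv.Perm.mul_apply] at hab
      obtain ⟨c, hc⟩ := exists_locate_eq hg (((linkLadder e).step ^ (m : ℤ)) (locate r hg a))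
      exact (ih a c hc).trans _ _ _ (hstep c b (by rw [hab, hc]))
    | pred m ih =>
      intro a b hab
      refine (ih a _ (?_ : locate r hg (exists_locate_eq hg
        (((linkLadder e).step ^ (-(m : ℤ))) (locate r hg a))).choose = _)).trans _ _ _
        (hstep b _ ?_).symm
      · exact (exists_locate_eq hg _).choose_spec
      · rw [(exists_locate_eq hg _).choose_spec, hab, ← Equiv.Perm.mul_apply, ← zpow_one_add]
        congr 2; ring
  rintro ⟨m, hm⟩
  exact key m a b hm.symm

end TimedLoops

/-! ### Loops determine their oriented trajectories -/

section Compare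

variable {V : Type*} {G : SimpleGraph V} {β : ℝ}

theorem move_move (t : AddCircle (2 * β)) (d : ℤˣ) (r r' : ℝ) :
    move (move t d r) d r' = move t d (r + r') := by
  simp only [move]
  rw [add_assoc, ← AddCircle.coe_add, mul_add]

theorem loopThrough_eq_of_sameTrajectory {ω : Config G β} {a b : State V β}
    (h : SameTrajectory ω a b) : loopThrough ω a = loopThrough ω b := by
  have key : ∀ c, SameTrajectory ω a c ↔ SameTrajectory ω b c :=
    fun c => ⟨fun h' => h.symm.trans _ _ _ h', fun h' => h.trans _ _ _ h'⟩
  unfold loopThrough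
  simp only [key]

theorem exists_step_of_mem {ω : Config G β} {x : V} {t : AddCircle (2 * β)} {d : ℤˣ} {r : ℝ}
    (hr : 0 < r) (free : ∀ r', 0 < r' → r' < r → ¬ Touched ω x (move t d r')) {l : Link G β}
    (hl : l ∈ ω) (hx : x ∈ (l.1.1 : Sym2 V)) (ht : l.2 = move t d r) :
    ∃ y ∈ (l.1.1 : Sym2 V), ∃ d', Step ω (x, t, d) (y, l.2, d') := by
  obtain ⟨⟨⟨e, he⟩, m⟩, t'⟩ := l
  change t' = _ at ht
  subst ht
  change x ∈ e at hx
  obtain ⟨y, rfl⟩ := hx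
  exact ⟨y, by simp, m.turn d, Step.jump x y t d r m hr free he hl⟩

variable [Fact (0 < 2 * β)]

/-- A travelling particle meets finitely many links in a bounded time. -/
theorem finite_touched (ω : Config G β) (x : V) (t : AddCircle (2 * β)) (d : ℤˣ) (R : ℝ) :
    {r | 0 < r ∧ r ≤ R ∧ Touched ω x (move t d r)}.Finite := by
  have hpos : 0 < 2 * β := Fact.out
  have hfin : ∀ c : AddCircle (2 * β), {r | 0 < r ∧ r ≤ R ∧ move t d r = c}.Finite := by
    intro c
    rcases Set.eq_empty_or_nonempty {r | 0 < r ∧ r ≤ R ∧ move t d r = c} with h | ⟨r0, h0⟩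
    · rw [h]; exact Set.finite_empty
    · obtain ⟨M, hM⟩ := exists_nat_gt (R / (2 * β))
      rw [div_lt_iff₀ hpos] at hM
      refine ((Set.finite_Icc (-(M : ℤ)) M).image fun m : ℤ => r0 + 2 * β * m).subset ?_
      rintro r ⟨h1, h2, h3⟩
      have h4 : ((((d : ℤ) : ℝ) * r0 : ℝ) : AddCircle (2 * β)) = (((d : ℤ) : ℝ) * r : ℝ) :=
        add_left_cancel (h0.2.2.trans h3.symm)
      obtain ⟨m, hm⟩ := coe_eq_coe h4
      have h0' := h0.1
      have h0'' := h0.2.1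
      have key : ∀ m : ℤ, r = r0 + 2 * β * m → m ∈ Set.Icc (-(M : ℤ)) M := by
        intro m hm
        have e1 : (m : ℝ) < M := by
          by_contra hc
          have := mul_le_mul_of_nonneg_left (not_lt.1 hc) hpos.le
          nlinarith
        have e2 : -(M : ℝ) < m := by
          by_contra hc
          have := mul_le_mul_of_nonneg_left (not_lt.1 hc) hpos.le
          nlinarith
        constructor
        · exact_mod_cast e2.le
        · exact_mod_cast e1.le
      rcases Int.units_eq_one_or d with rfl | rfl
      · have : r = r0 + 2 * β * m := by simpa using hm
        exact ⟨m, key m this, this.symm⟩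
      · have : r = r0 + 2 * β * ((-m : ℤ) : ℝ) := by
          push_cast at hm ⊢; linarith
        exact ⟨-m, key _ this, this.symm⟩
  refine ((ω.finite_toSet).biUnion fun l _ => hfin l.2).subset ?_
  rintro r ⟨h1, h2, l, hl, -, hlt⟩
  exact Set.mem_biUnion (show l ∈ (ω : Set (Link G β)) from hl) ⟨h1, h2, hlt.symm⟩

/-- Suppose that a trajectory of `ω'` runs through `(x, t, d)` or through `b`, where `b` is the end
of an uninterrupted motion from `(x, t, d)`. On the way from `(x, t, d)` to `b` it meets no link of
`ω'` that is not in `ω`, as the first or the last such link would belong to its loop. -/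
theorem free_of_links_subset {ω ω' : Config G β} {c : State V β}
    (h : (loopThrough ω' c).links ⊆ (loopThrough ω c).links) {x : V} {t : AddCircle (2 * β)}
    {d : ℤˣ} {R : ℝ} {b : State V β} {S : Set ℝ} (hS : ∀ r ∈ S, 0 < r ∧ r ≤ R)
    (hS' : ∀ r ∈ S, ∀ r', 0 < r' → r' < r → r' ∈ S)
    (hb : ∀ r ∈ S, (∀ r' ∈ S, r < r' → ¬ Touched ω' x (move t d r')) →
      Step ω' (x, move t d r, d) b)
    (hc : SameTrajectory ω' c (x, t, d) ∨ SameTrajectory ω' c b)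
    (free : ∀ r ∈ S, ¬ Touched ω x (move t d r)) :
    ∀ r ∈ S, ¬ Touched ω' x (move t d r) := by
  intro r hr htouch
  have hfin : {r | r ∈ S ∧ Touched ω' x (move t d r)}.Finite :=
    (finite_touched ω' x t d R).subset fun r hr => ⟨(hS r hr.1).1, (hS r hr.1).2, hr.2⟩
  have hne : {r | r ∈ S ∧ Touched ω' x (move t d r)}.Nonempty := ⟨r, hr, htouch⟩
  have hcontra : ∀ r ∈ S, ∀ l ∈ ω', x ∈ (l.1.1 : Sym2 V) → l.2 = move t d r →
      l ∈ (loopThrough ω' c).links → False := by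
    intro r hr l _ hx hlt hlink
    exact free r hr ⟨l, (h hlink).1, hx, hlt⟩
  rcases hc with hc | hc
  · obtain ⟨r1, ⟨h1, l, hl, hx, hlt⟩, hmin⟩ := Set.exists_min_image _ id hfin hne
    obtain ⟨y, hy, d', hstep⟩ := exists_step_of_mem (hS r1 h1).1 (fun r' h3 h4 h5 =>
      absurd (hmin r' ⟨hS' r1 h1 r' h3 h4, h5⟩) (not_le.2 h4)) hl hx hlt
    exact hcontra r1 h1 l hl hx hlt
      ⟨hl, y, hy, d', hc.trans _ _ _ (Relation.EqvGen.rel _ _ hstep)⟩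
  · obtain ⟨r1, ⟨h1, l, hl, hx, hlt⟩, hmax⟩ := Set.exists_max_image _ id hfin hne
    have hstep := hb r1 h1 fun r' h3 h4 h5 => absurd (hmax r' ⟨h3, h5⟩) (not_le.2 h4)
    refine hcontra r1 h1 l hl hx hlt ⟨hl, x, hx, d, ?_⟩
    rw [hlt]
    exact hc.trans _ _ _ (Relation.EqvGen.rel _ _ hstep).symm

/-- A step along a trajectory through `c` is also a step in a configuration in which the loop
through `c` traverses the same links. -/
theorem step_of_links_eq {ω ω' : Config G β} {c : State V β}
    (h : (loopThrough ω c).links = (loopThrough ω' c).links) {a b : State V β}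
    (hab : Step ω a b) (hb : SameTrajectory ω c b)
    (hc : SameTrajectory ω' c a ∨ SameTrajectory ω' c b) : Step ω' a b := by
  cases hab with
  | glide x t d R hR free =>
    have := free_of_links_subset (S := Set.Ioc 0 R) h.ge (fun r hr => hr)
      (fun r hr r' h1 h2 => ⟨h1, h2.le.trans hr.2⟩) ?_ hc (fun r hr => free r hr.1 hr.2)
    · exact Step.glide x t d R hR fun r h1 h2 => this r ⟨h1, h2⟩
    intro r1 h1 h3
    have := Step.glide (ω := ω') x (move t d r1) d (R - r1) (by linarith [h1.2])
      (fun r' h4 h5 => by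
        rw [move_move]
        exact h3 _ ⟨by linarith [h1.1], by linarith⟩ (by linarith))
    rwa [move_move, add_sub_cancel] at this
  | jump x y t d R m hR free hxy hl =>
    have hl' : ((⟨s(x, y), G.mem_edgeSet.2 hxy⟩, m), move t d R) ∈ ω' := by
      have : ((⟨s(x, y), G.mem_edgeSet.2 hxy⟩, m), move t d R) ∈ (loopThrough ω c).links :=
        ⟨hl, y, by simp, m.turn d, hb⟩
      rw [h] at this
      exact this.1
    have := free_of_links_subset (S := Set.Ioo 0 R) h.ge (fun r hr => ⟨hr.1, hr.2.le⟩)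
      (fun r hr r' h1 h2 => ⟨h1, h2.trans hr.2⟩) ?_ hc (fun r hr => free r hr.1 hr.2)
    · exact Step.jump x y t d R m hR (fun r h1 h2 => this r ⟨h1, h2⟩) hxy hl'
    intro r1 h1 h3
    have := Step.jump (ω := ω') x y (move t d r1) d (R - r1) m (by linarith [h1.2])
      (fun r' h4 h5 => by
        rw [move_move]
        exact h3 _ ⟨by linarith [h1.1], by linarith⟩ (by linarith))
      hxy (by rwa [move_move, add_sub_cancel])
    rwa [move_move, add_sub_cancel] at this

/-- If the loops through `c` in two configurations traverse the same links, the trajectories through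
`c` coincide. -/
theorem sameTrajectory_iff_of_links_eq {ω ω' : Config G β} {c : State V β}
    (h : (loopThrough ω c).links = (loopThrough ω' c).links) (b : State V β) :
    SameTrajectory ω c b ↔ SameTrajectory ω' c b := by
  have key : ∀ {ω ω' : Config G β}, (loopThrough ω c).links = (loopThrough ω' c).links →
      ∀ a b, SameTrajectory ω a b → SameTrajectory ω c a →
        (SameTrajectory ω' c a ↔ SameTrajectory ω' c b) := by
    intro ω ω' h a b hab
    induction hab with
    | rel a b hab =>
      intro ha
      have hb := ha.trans _ _ _ (Relation.EqvGen.rel _ _ hab)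
      constructor
      · intro hc
        exact hc.trans _ _ _ (Relation.EqvGen.rel _ _ (step_of_links_eq h hab hb (Or.inl hc)))
      · intro hc
        exact hc.trans _ _ _
          (Relation.EqvGen.rel _ _ (step_of_links_eq h hab hb (Or.inr hc))).symm
    | refl a => exact fun _ => Iff.rfl
    | symm a b hab ih => exact fun hb => (ih (hb.trans _ _ _ hab.symm)).symm
    | trans a b c hab hbc ih1 ih2 =>
      exact fun ha => (ih1 ha).trans (ih2 (ha.trans _ _ _ hab))
  constructor
  · intro hb
    exact (key h c b hb (.refl _)).1 (.refl _)
  · intro hb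
    exact (key h.symm c b hb (.refl _)).1 (.refl _)

end Compare

/-! ### Loops of time-ordered configurations -/

theorem units_eq_or_eq_neg : ∀ d d' : ℤˣ, d = d' ∨ d = -d' := by decide

section TimedLoops

open Ladder

variable {V : Type*} [DecidableEq V] {G : SimpleGraph V} {β : ℝ} {k : ℕ}
  (e : Fin k → G.edgeSet × Mark) {r : Fin k → ℝ} [Fact (0 < 2 * β)]
  (hg : StrictMono (grid (2 * β) r))

include hg in
omit [DecidableEq V] [Fact (0 < 2 * β)] in
theorem coe_time_injective {j j' : Fin k}
    (h : (r j : AddCircle (2 * β)) = (r j' : AddCircle (2 * β))) : j = j' := by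
  obtain ⟨m, hm⟩ := coe_eq_coe h
  rw [← grid_natCast_add_one (2 * β) r j, ← grid_natCast_add_one (2 * β) r j', ← grid_add_mul] at hm
  have h1 : ((j' : ℕ) : ℤ) = (j : ℕ) + ((k : ℤ) + 1) * m := by
    have := hg.injective hm
    linarith
  have h2 : j.castSucc = j'.castSucc := by
    rw [← slot_natCast j.castSucc, ← slot_natCast j'.castSucc, Fin.val_castSucc, Fin.val_castSucc,
      h1, slot_add_mul]
  exact Fin.castSucc_injective k h2

/-- At a point that is not the end-point of a link, the two directions belong to the same
trajectory, up to orientation. -/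
theorem sameCycle_flip_of_not_touched {x : V} {t : AddCircle (2 * β)}
    (h : ¬ Touched (timedConfig β e r) x t) (d : ℤˣ) :
    (linkLadder e).step.SameCycle (locate r hg (x, t, -d)) (flip (locate r hg (x, t, d))) := by
  have hpos : 0 < 2 * β := Fact.out
  have key : ∀ d' : ℤˣ, (linkLadder e).step.SameCycle
      (x, (locate r hg (x, t, -1)).2.1, d') (x, (locate r hg (x, t, 1)).2.1, d') := by
    obtain ⟨s, rfl⟩ := QuotientAddGroup.mk_surjective t
    change ¬ Touched _ x (s : AddCircle (2 * β)) at h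
    intro d'
    obtain ⟨q, hq⟩ := exists_inSlot hpos hg 1 s
    rw [locate_eq hg hq]
    have hq' := inSlot_one.1 hq
    rcases hq'.1.lt_or_eq with h1 | h1
    · rw [locate_eq hg (inSlot_neg_one.2 ⟨h1, hq'.2.le⟩)]
    · obtain ⟨p, rfl⟩ : ∃ p, q = p + 1 := ⟨q - 1, by ring⟩
      have h2 : InSlot (2 * β) r (-1) p s := by
        rw [← h1]; exact inSlot_grid_neg_one hg p
      rw [locate_eq hg h2]
      refine sameCycle_slot_succ e ?_ d'
      by_contra hne
      exact h ((touched_coe_iff e r).2 ⟨p, h1.symm, hne⟩)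
  rcases Int.units_eq_one_or d with rfl | rfl
  · exact key (-1)
  · rw [neg_neg]
    exact (key 1).symm

include hg in
/-- Every trajectory visits points that are not end-points of links. -/
theorem exists_not_touched (a : State V β) : ∃ c : State V β,
    ¬ Touched (timedConfig β e r) c.1 c.2.1 ∧ SameTrajectory (timedConfig β e r) a c := by
  obtain ⟨x, t, d⟩ := a
  set i : Fin (k + 1) := (locate r hg (x, t, d)).2.1 with hi
  set q : ℤ := ((i : ℕ) : ℤ)
  have hqi : slot k q = i := slot_natCast i
  have hlt := hg (lt_add_one q)
  obtain ⟨s, hs1, hs2⟩ := exists_between hlt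
  refine ⟨(x, (s : AddCircle (2 * β)), d), ?_, sameTrajectory_of_locate_eq e hg ?_⟩
  · rw [touched_coe_iff]
    rintro ⟨p, rfl, -⟩
    have h1 := hg.lt_iff_lt.1 hs1
    have h2 := hg.lt_iff_lt.1 hs2
    omega
  · have hs : InSlot (2 * β) r d q s := by
      rcases Int.units_eq_one_or d with rfl | rfl
      · exact inSlot_one.2 ⟨hs1.le, hs2⟩
      · exact inSlot_neg_one.2 ⟨hs1, hs2.le⟩
    rw [locate_eq hg hs, hqi]
    rfl

theorem loopThrough_eq_of_sameCycle_flip {a b : State V β}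
    (h : (linkLadder e).step.SameCycle (locate r hg a) (flip (locate r hg b))) :
    loopThrough (timedConfig β e r) a = loopThrough (timedConfig β e r) b := by
  have hR := (linkLadder e).reversible
  have hs : ∀ {a b : State V β}, (linkLadder e).step.SameCycle (locate r hg a)
      (flip (locate r hg b)) → ∀ p : V × AddCircle (2 * β), ¬ Touched (timedConfig β e r) p.1 p.2 →
      (∃ d, SameTrajectory (timedConfig β e r) a (p.1, p.2, d)) →
      ∃ d, SameTrajectory (timedConfig β e r) b (p.1, p.2, d) := by
    rintro a b h p hp ⟨d, hd⟩
    refine ⟨-d, (sameTrajectory_iff e hg).2 ?_⟩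
    rw [sameTrajectory_iff e hg] at hd
    exact (hR.sameCycle_R_comm.1 (h.symm.trans hd)).trans
      (sameCycle_flip_of_not_touched e hg hp d).symm
  have hl : ∀ {a b : State V β}, (linkLadder e).step.SameCycle (locate r hg a)
      (flip (locate r hg b)) → ∀ l : Link G β, l ∈ timedConfig β e r →
      (∃ y ∈ (l.1.1 : Sym2 V), ∃ d, SameTrajectory (timedConfig β e r) a (y, l.2, d)) →
      ∃ y ∈ (l.1.1 : Sym2 V), ∃ d, SameTrajectory (timedConfig β e r) b (y, l.2, d) := by
    rintro a b h l hl ⟨y, hy, d, hd⟩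
    obtain ⟨j, rfl⟩ := (mem_timedConfig e r).1 hl
    rw [sameTrajectory_iff e hg] at hd
    change (linkLadder e).step.SameCycle _
      (locate r hg (y, (r j : AddCircle (2 * β)), d)) at hd
    have hloc : ∀ z d, locate r hg (z, (r j : AddCircle (2 * β)), d) =
        (linkLadder e).arrival (j.castSucc, z, d) := by
      intro z d
      rw [← grid_natCast_add_one (2 * β) r j]
      exact locate_arrival e hg (slot_natCast j.castSucc) d
    refine ⟨(linkLadder e).swap j.castSucc y, ?_,
      if (linkLadder e).Turn j.castSucc y then d else -d, (sameTrajectory_iff e hg).2 ?_⟩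
    · rw [← swap_castSucc_ne_iff, swap_swap_ne_iff, swap_castSucc_ne_iff]
      exact hy
    · change (linkLadder e).step.SameCycle _ (locate r hg (_, (r j : AddCircle (2 * β)), _))
      rw [hloc] at hd ⊢
      refine (hR.sameCycle_R_comm.1 (h.symm.trans hd)).trans ?_
      exact (hR.sameCycle_R_comm.1 ((linkLadder e).sameCycle_arrival j.castSucc y d)).symm
  have h' := (hR.sameCycle_R_comm.2 h.symm.symm).symm
  ext p
  · exact and_congr_right fun hp => ⟨hs h p hp, hs h' p hp⟩
  · exact and_congr_right fun hp => ⟨hl h p hp, hl h' p hp⟩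

theorem loopThrough_eq_iff {a b : State V β} :
    loopThrough (timedConfig β e r) a = loopThrough (timedConfig β e r) b ↔
      (linkLadder e).step.SameCycle (locate r hg a) (locate r hg b) ∨
        (linkLadder e).step.SameCycle (locate r hg a) (flip (locate r hg b)) := by
  constructor
  · intro h
    obtain ⟨c, hc, hac⟩ := exists_not_touched e hg a
    have hmem : (c.1, c.2.1) ∈ (loopThrough (timedConfig β e r) a).support := ⟨hc, c.2.2, hac⟩
    rw [h] at hmem
    obtain ⟨-, d, hd⟩ := hmem
    rw [sameTrajectory_iff e hg] at hac hd
    rcases units_eq_or_eq_neg d c.2.2 with rfl | rfl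
    · exact Or.inl (hac.trans hd.symm)
    · refine Or.inr (hac.trans ?_)
      have h1 := sameCycle_flip_of_not_touched e hg hc c.2.2
      have h2 := (linkLadder e).reversible.sameCycle_R_comm.1 (hd.trans h1).symm
      exact h2
  · rintro (h | h)
    · exact loopThrough_eq_of_sameTrajectory ((sameTrajectory_iff e hg).2 h)
    · exact loopThrough_eq_of_sameCycle_flip e hg h

/-- The loop of a discretized state. -/
def discreteLoop (b : V × Fin (k + 1) × ℤˣ) : loops (timedConfig β e r) :=
  ⟨loopThrough _ (exists_locate_eq hg b).choose, Set.mem_range_self _⟩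

/-- A discretized state on a loop. -/
def loopRep (l : loops (timedConfig β e r)) : V × Fin (k + 1) × ℤˣ :=
  locate r hg l.2.choose

theorem loopIndex : LoopIndex (linkLadder e).step flip (discreteLoop e hg) (loopRep e hg) where
  ell_rep l := by
    refine Subtype.ext (Eq.trans ?_ l.2.choose_spec)
    refine (loopThrough_eq_iff e hg).2 (Or.inl ?_)
    rw [(exists_locate_eq hg _).choose_spec]
    exact .refl _ _
  ell_eq_iff a b := by
    refine Subtype.ext_iff.trans ((loopThrough_eq_iff e hg).trans ?_)
    rw [(exists_locate_eq hg a).choose_spec, (exists_locate_eq hg b).choose_spec]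

include hg in
theorem finite_loops [Finite V] : Finite (loops (timedConfig β e r)) :=
  Finite.of_surjective (discreteLoop e hg) fun l => ⟨_, (loopIndex e hg).ell_rep l⟩

end TimedLoops

/-! ### Signs of loops -/

section Signs

open Ladder

variable {V : Type*} {G : SimpleGraph V} {β : ℝ}

/-- The arrivals from crosses along the oriented trajectory of `a`: the cross, the site reached, and
the direction of time. -/
def crossArrivals (ω : Config G β) (a : State V β) : Set (Link G β × V × ℤˣ) :=
  {t | t.1 ∈ ω ∧ t.1.1.2 = Mark.cross ∧ t.2.1 ∈ (t.1.1.1 : Sym2 V) ∧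
    SameTrajectory ω a (t.2.1, t.1.2, t.2.2)}

/-- The product of the signs `χ` over the arrivals from crosses along the trajectory of `a`. -/
def passageSign (χ : V → ℤˣ → ℤˣ) (ω : Config G β) (a : State V β) : ℤˣ :=
  ∏ᶠ t ∈ crossArrivals ω a, χ t.2.1 t.2.2

/-- The links of the configuration have distinct times, and there is no link at the time `0`. -/
def IsTimed (ω : Config G β) : Prop :=
  ∃ (k : ℕ) (e : Fin k → G.edgeSet × Mark) (r : Fin k → ℝ), StrictMono r ∧
    (∀ j, r j ∈ Set.Ioo 0 (2 * β)) ∧ ω = timedConfig β e r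

open Classical in
/-- The sign of a loop: the passage sign of any of its orientations in any configuration with links
at distinct times that contains it. -/
def loopSign (χ : V → ℤˣ → ℤˣ) (l : Loop G β) : ℤˣ :=
  if h : ∃ p : Config G β × State V β, IsTimed p.1 ∧ loopThrough p.1 p.2 = l then
    passageSign χ h.choose.1 h.choose.2 else 1

theorem crossArrivals_eq_of_links_eq [Fact (0 < 2 * β)] {ω ω' : Config G β} {c : State V β}
    (h : (loopThrough ω c).links = (loopThrough ω' c).links) :
    crossArrivals ω c = crossArrivals ω' c := by
  have key : ∀ {ω ω' : Config G β}, (loopThrough ω c).links = (loopThrough ω' c).links →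
      crossArrivals ω c ⊆ crossArrivals ω' c := by
    rintro ω ω' h ⟨l, z, d⟩ ⟨h1, h2, h3, h4⟩
    have hl : l ∈ (loopThrough ω c).links := ⟨h1, z, h3, d, h4⟩
    rw [h] at hl
    exact ⟨hl.1, h2, h3, (sameTrajectory_iff_of_links_eq h _).1 h4⟩
  exact (key h).antisymm (key h.symm)

variable [DecidableEq V] [Fintype V] [Fact (0 < 2 * β)]

theorem passageSign_timedConfig {k : ℕ} (e : Fin k → G.edgeSet × Mark) {r : Fin k → ℝ}
    (hg : StrictMono (grid (2 * β) r)) (χ : V → ℤˣ → ℤˣ) (a : State V β) :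
    passageSign χ (timedConfig β e r) a = (linkLadder e).sgn χ (locate r hg a) := by
  set B : Set (Fin k × V × ℤˣ) :=
    {t | (t.1.castSucc, t.2) ∈ (linkLadder e).arrivals (locate r hg a)} with hB
  have hloc : ∀ (j : Fin k) z d, locate r hg (z, (r j : AddCircle (2 * β)), d) =
      (linkLadder e).arrival (j.castSucc, z, d) := by
    intro j z d
    rw [← grid_natCast_add_one (2 * β) r j]
    exact locate_arrival e hg (slot_natCast j.castSucc) d
  have h1 : ∏ᶠ t ∈ B, χ t.2.1 t.2.2 = passageSign χ (timedConfig β e r) a := by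
    refine finprod_mem_eq_of_bijOn
      (fun t : Fin k × V × ℤˣ => ((e t.1, (r t.1 : AddCircle (2 * β))), t.2)) ⟨?_, ?_, ?_⟩ ?_
    · rintro ⟨j, z, d⟩ ht
      have ht' := (mem_arrivals _).1 ht
      rw [crossing_castSucc_iff, ← hloc, ← sameTrajectory_iff e hg] at ht'
      exact ⟨(mem_timedConfig e r).2 ⟨j, rfl⟩, ht'.1.1, ht'.1.2, ht'.2⟩
    · rintro ⟨j, z, d⟩ _ ⟨j', z', d'⟩ _ h
      simp only [Prod.mk.injEq] at h
      rw [coe_time_injective hg h.1.2, h.2.1, h.2.2]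
    · rintro ⟨l, z, d⟩ ⟨h1, h2, h3, h4⟩
      obtain ⟨j, rfl⟩ := (mem_timedConfig e r).1 h1
      refine ⟨(j, z, d), ?_, rfl⟩
      rw [sameTrajectory_iff e hg] at h4
      change (linkLadder e).step.SameCycle _
        (locate r hg (z, (r j : AddCircle (2 * β)), d)) at h4
      rw [hloc] at h4
      exact (mem_arrivals _).2 ⟨(crossing_castSucc_iff e j z).2 ⟨h2, h3⟩, h4⟩
    · intro t _; rfl
  rw [← h1, sgn, ← finprod_mem_coe_finset]
  refine finprod_mem_eq_of_bijOn (fun t : Fin k × V × ℤˣ => (t.1.castSucc, t.2)) ⟨?_, ?_, ?_⟩ ?_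
  · exact fun t ht => ht
  · rintro ⟨j, z, d⟩ _ ⟨j', z', d'⟩ _ h
    simpa using h
  · rintro ⟨i, z, d⟩ ht
    rcases Fin.eq_castSucc_or_eq_last i with ⟨j, rfl⟩ | rfl
    · exact ⟨(j, z, d), ht, rfl⟩
    · exact absurd ((mem_arrivals _).1 ht).1 (not_crossing_last e z)
  · intro t _; rfl

variable {χ : V → ℤˣ → ℤˣ} {ε : V → ℤˣ} {η : ℤˣ} (hε : ∀ x y, G.Adj x y → ε y = -ε x)
  (hχ : ∀ x y, G.Adj x y → ∀ d, χ y (-d) = η * χ x d)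

include hε hχ in
theorem sgn_flip_linkLadder {k : ℕ} (e : Fin k → G.edgeSet × Mark) (a : V × Fin (k + 1) × ℤˣ) :
    (linkLadder e).sgn χ (flip a) = (linkLadder e).sgn χ a := by
  refine (linkLadder e).sgn_flip (isSublattice_linkLadder e hε) (η := η) ?_ a
  intro i z hz d
  rcases Fin.eq_castSucc_or_eq_last i with ⟨j, rfl⟩ | rfl
  · have hz' := ((crossing_castSucc_iff e j z).1 hz).2
    rw [linkLadder_swap_castSucc]
    refine hχ _ _ ?_ d
    have h := (e j).1.2
    rw [← mk_edgeSwap hz'] at h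
    exact h
  · exact absurd hz (not_crossing_last e z)

include hε hχ in
theorem passageSign_eq_of_loopThrough_eq {ω : Config G β} (hω : IsTimed ω) {a b : State V β}
    (h : loopThrough ω a = loopThrough ω b) : passageSign χ ω a = passageSign χ ω b := by
  obtain ⟨k, e, r, hr, hrT, rfl⟩ := hω
  have hg := grid_strictMono hr Fact.out hrT
  rw [passageSign_timedConfig e hg, passageSign_timedConfig e hg]
  rcases (loopThrough_eq_iff e hg).1 h with h | h
  · rw [sgn, sgn, arrivals_congr _ h]
  · rw [← sgn_flip_linkLadder hε hχ e (locate r hg b), sgn, sgn, arrivals_congr _ h]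

include hε hχ in
/-- The sign of a loop does not depend on the choices of a configuration and of an orientation. -/
theorem loopSign_loopThrough {ω : Config G β} (hω : IsTimed ω) (a : State V β) :
    loopSign χ (loopThrough ω a) = passageSign χ ω a := by
  have hex : ∃ p : Config G β × State V β, IsTimed p.1 ∧ loopThrough p.1 p.2 = loopThrough ω a :=
    ⟨(ω, a), hω, rfl⟩
  rw [loopSign, dif_pos hex]
  obtain ⟨hω', h⟩ := hex.choose_spec
  generalize hex.choose.1 = ω' at *
  generalize hex.choose.2 = a' at *
  have hω0 := hω'
  obtain ⟨k, e, r, hr, hrT, rfl⟩ := hω0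
  have hg := grid_strictMono hr Fact.out hrT
  -- a state `c` that is not at the end of a link shows that the two trajectories run through a
  -- common state
  obtain ⟨c, hc, hac⟩ := exists_not_touched e hg a'
  have hmem : (c.1, c.2.1) ∈ (loopThrough (timedConfig β e r) a').support := ⟨hc, c.2.2, hac⟩
  rw [h] at hmem
  obtain ⟨-, d, hd⟩ := hmem
  set c' : State V β := (c.1, c.2.1, d) with hc'
  have h1 : loopThrough ω a = loopThrough ω c' := loopThrough_eq_of_sameTrajectory hd
  have h2 : loopThrough (timedConfig β e r) a' = loopThrough (timedConfig β e r) c' := by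
    rw [loopThrough_eq_of_sameTrajectory hac]
    rcases units_eq_or_eq_neg d c.2.2 with h3 | h3
    · rw [hc', h3]
    · refine (loopThrough_eq_of_sameCycle_flip e hg ?_).symm
      rw [hc', h3]
      exact sameCycle_flip_of_not_touched e hg hc c.2.2
  rw [passageSign_eq_of_loopThrough_eq hε hχ hω' h2, passageSign_eq_of_loopThrough_eq hε hχ hω h1,
    passageSign, passageSign, crossArrivals_eq_of_links_eq]
  rw [← h1, ← h2, h]

include hε hχ in
/-- The signs of the loops of a configuration, in terms of its discretization. -/
theorem prod_loopSign {k : ℕ} (e : Fin k → G.edgeSet × Mark) {r : Fin k → ℝ} (hr : StrictMono r)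
    (hrT : ∀ j, r j ∈ Set.Ioo 0 (2 * β)) (hg : StrictMono (grid (2 * β) r))
    [Fintype (loops (timedConfig β e r))] :
    ∏ᶠ l ∈ loops (timedConfig β e r), (((loopSign χ l : ℤˣ) : ℤ) : ℝ) =
      ((∏ l, (linkLadder e).sgn χ (loopRep e hg l) : ℤˣ) : ℤ) := by
  rw [← finprod_subtype_eq_finprod_cond (p := fun l => l ∈ loops (timedConfig β e r)),
    finprod_eq_prod_of_fintype]
  push_cast
  refine Finset.prod_congr rfl fun l _ => ?_
  have h : loopSign χ l.1 = (linkLadder e).sgn χ (loopRep e hg l) := by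
    conv_lhs => rw [← l.2.choose_spec]
    rw [loopSign_loopThrough hε hχ ⟨k, e, r, hr, hrT, rfl⟩, passageSign_timedConfig e hg]
    rfl
  rw [← h]

end Signs

/-! ### The contribution of a time-ordered configuration -/

section Weights

open Ladder

variable {V : Type*} [Fintype V] [DecidableEq V] {G : SimpleGraph V} {n k : ℕ}

theorem siteOp_diagonal (d : Fin n → ℂ) (x : V) :
    siteOp (Matrix.diagonal d) x = Matrix.diagonal fun σ : V → Fin n => d (σ x) := by
  ext σ τ
  simp only [siteOp, Matrix.diagonal_apply]
  by_cases h : σ = τ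
  · simp [h]
  · rw [if_neg h]
    split_ifs with h1 h2
    · refine absurd (funext fun z => ?_) h
      by_cases hz : z = x
      · rw [hz, h2]
      · exact h1 z hz
    · rfl
    · rfl

/-- The constant in the matrix elements of the operator attached to a link. -/
def markFactor (n : ℕ) (η : ℤˣ) (u v : ℝ) : Mark → ℝ
  | Mark.cross => u * ((η : ℤ) : ℝ)
  | Mark.dbar => -v / n

theorem paritySign_rev_mul_rev (a b : Fin n) :
    paritySign (Fin.rev a) * paritySign (Fin.rev b) = paritySign a * paritySign b := by
  rw [paritySign_rev, paritySign_rev, mul_mul_mul_comm, Int.units_mul_self, one_mul]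

theorem markOp_cross_apply (η : ℤˣ) (u v : ℝ) (a b : Fin n × Fin n) :
    markOp (-(((η : ℤ) : ℂ) • crossT n)) u v Mark.cross a b =
      if b.2 = Fin.rev a.1 ∧ b.1 = Fin.rev a.2 then
        (markFactor n η u v Mark.cross : ℂ) * ((paritySign b.1 * paritySign b.2 : ℤˣ) : ℤ)
      else 0 := by
  simp only [markOp, smul_neg, neg_neg, Matrix.smul_apply, crossT_apply, smul_eq_mul, markFactor]
  have h1 : (a.1 = Fin.rev b.2 ∧ a.2 = Fin.rev b.1) ↔ (b.2 = Fin.rev a.1 ∧ b.1 = Fin.rev a.2) := by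
    rw [← Fin.rev_eq_iff, ← Fin.rev_eq_iff, eq_comm, eq_comm (a := Fin.rev a.2)]
  rw [if_congr h1 rfl rfl]
  split_ifs with h
  · rw [h.1, h.2, paritySign_rev_mul_rev, mul_comm (paritySign a.2)]
    simp only [paritySign, ← pow_add]
    push_cast
    ring
  · simp

theorem markOp_dbar_apply (Tt : Matrix (Fin n × Fin n) (Fin n × Fin n) ℂ) (η : ℤˣ) (u v : ℝ)
    (a b : Fin n × Fin n) : markOp Tt u v Mark.dbar a b =
      if a.1 = a.2 ∧ b.1 = b.2 then (markFactor n η u v Mark.dbar : ℂ) else 0 := by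
  simp only [markOp, Matrix.neg_apply, Matrix.smul_apply, projQ, smul_eq_mul, markFactor]
  split_ifs
  · push_cast; ring
  · simp

open Classical in
/-- The matrix elements of the operator attached to a link, for the interaction `T̃ = -η (V ⊗ V) T`
with a sign `η`. -/
theorem linkOp_apply (η : ℤˣ) (u v : ℝ) (e : Fin k → G.edgeSet × Mark) (j : Fin k)
    (σ τ : V → Fin n) :
    linkOp (-(((η : ℤ) : ℂ) • crossT n)) u v (e j) σ τ =
      if (linkLadder e).LevelCompat j.castSucc σ τ then (markFactor n η u v (e j).2 : ℂ) *
        ((∏ x, (if (linkLadder e).Crossing j.castSucc x then paritySign (τ x) else 1) : ℤˣ) : ℤ)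
      else 0 := by
  obtain ⟨⟨x, y⟩, hxy⟩ := Quot.exists_rep ((e j).1 : Sym2 V)
  have hxy : ((e j).1 : Sym2 V) = s(x, y) := hxy.symm
  have hne : x ≠ y := by
    have h := (e j).1.2
    rw [hxy] at h
    exact G.ne_of_adj h
  rw [linkOp_eq (swapInvariant_crossT.smul _).neg u v (e j) hxy]
  have hmem : ∀ z, z ∈ ((e j).1 : Sym2 V) ↔ z = x ∨ z = y := by
    intro z; rw [hxy, Sym2.mem_iff]
  have hsx : (linkLadder e).swap j.castSucc x = y := by
    rw [linkLadder_swap_castSucc, hxy]; simp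
  have hsy : (linkLadder e).swap j.castSucc y = x := by
    rw [linkLadder_swap_castSucc, hxy]; simp
  have hT : ∀ z, (linkLadder e).Turn j.castSucc z ↔ (e j).2 = Mark.dbar ∧ (z = x ∨ z = y) := by
    intro z; rw [turn_castSucc_iff, hmem]
  have hC : ∀ z, (linkLadder e).Crossing j.castSucc z ↔
      (e j).2 = Mark.cross ∧ (z = x ∨ z = y) := by
    intro z; rw [crossing_castSucc_iff, hmem]
  rw [pairOp]
  cases hm : (e j).2 with
  | cross =>
    have hprod : ∏ z, (if (linkLadder e).Crossing j.castSucc z then paritySign (τ z) else 1) =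
        paritySign (τ x) * paritySign (τ y) := by
      rw [← Finset.prod_filter, ← Finset.prod_pair (f := fun z => paritySign (τ z)) hne]
      refine Finset.prod_congr ?_ fun _ _ => rfl
      ext z; simp [hC, hm]
    have hL : (linkLadder e).LevelCompat j.castSucc σ τ ↔ (∀ z, z ≠ x → z ≠ y → σ z = τ z) ∧
        τ y = Fin.rev (σ x) ∧ τ x = Fin.rev (σ y) := by
      simp only [LevelCompat, hT, hC, hm]
      constructor
      · intro h
        refine ⟨fun z h1 h2 => ?_, ?_, ?_⟩
        · simpa [h1, h2, eq_comm] using h z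
        · simpa [hsx] using h x
        · simpa [hsy] using h y
      · rintro ⟨h1, h2, h3⟩ z
        by_cases hx : z = x
        · subst hx; simpa [hsx] using h2
        · by_cases hy : z = y
          · subst hy; simpa [hsy] using h3
          · simpa [hx, hy] using (h1 z hx hy).symm
    rw [hprod, markOp_cross_apply, if_congr hL rfl rfl]
    simp only [ite_and]
  | dbar =>
    have hprod : ∏ z, (if (linkLadder e).Crossing j.castSucc z then paritySign (τ z) else 1) =
        1 := by
      refine Finset.prod_eq_one fun z _ => if_neg ?_
      rw [hC, hm]; simp
    have hL : (linkLadder e).LevelCompat j.castSucc σ τ ↔ (∀ z, z ≠ x → z ≠ y → σ z = τ z) ∧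
        σ x = σ y ∧ τ x = τ y := by
      simp only [LevelCompat, hT, hC, hm]
      constructor
      · intro h
        refine ⟨fun z h1 h2 => ?_, ?_⟩
        · simpa [h1, h2, eq_comm] using h z
        · simpa [hsx, eq_comm] using h x
      · rintro ⟨h1, h2, h3⟩ z
        by_cases hx : z = x
        · subst hx; simp [hsx, h2, h3]
        · by_cases hy : z = y
          · subst hy; simp [hsy, h2, h3]
          · simpa [hx, hy] using (h1 z hx hy).symm
    rw [hprod, markOp_dbar_apply _ η, if_congr hL rfl rfl]
    simp [ite_and]

variable {β : ℝ} [Fact (0 < 2 * β)] (e : Fin k → G.edgeSet × Mark) {r : Fin k → ℝ}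
  (hg : StrictMono (grid (2 * β) r))

include hg in
omit [Fintype V] [DecidableEq V] [Fact (0 < 2 * β)] in
theorem numMark_timedConfig (m : Mark) :
    numMark m (timedConfig β e r) = (Finset.univ.filter fun j => (e j).2 = m).card := by
  classical
  have h : ((timedConfig β e r).filter fun l => l.1.2 = m) =
      (Finset.univ.filter fun j => (e j).2 = m).image
        fun j => (e j, (r j : AddCircle (2 * β))) := by
    ext l
    simp only [Finset.mem_filter, Finset.mem_image, Finset.mem_univ, true_and, mem_timedConfig]
    constructor
    · rintro ⟨⟨j, rfl⟩, h⟩; exact ⟨j, h, rfl⟩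
    · rintro ⟨j, h, rfl⟩; exact ⟨⟨j, rfl⟩, h⟩
  rw [numMark, h, Finset.card_image_of_injective]
  intro j j' hj
  exact coe_time_injective hg (congrArg Prod.snd hj)

include hg in
omit [Fintype V] [DecidableEq V] [Fact (0 < 2 * β)] in
theorem prod_marks {M : Type*} [CommMonoid M] (q : Mark → M) : ∏ j, q (e j).2 =
    q Mark.cross ^ numMark Mark.cross (timedConfig β e r) *
      q Mark.dbar ^ numMark Mark.dbar (timedConfig β e r) := by
  rw [← Finset.prod_fiberwise' Finset.univ (fun j => (e j).2) q]
  have : (Finset.univ : Finset Mark) = {Mark.cross, Mark.dbar} := rfl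
  rw [this, Finset.prod_pair (by decide), numMark_timedConfig e hg, numMark_timedConfig e hg,
    Finset.prod_const, Finset.prod_const]

omit [Fintype V] [DecidableEq V] [Fact (0 < 2 * β)] in
theorem numLoops_eq_card [Fintype (loops (timedConfig β e r))] :
    numLoops (timedConfig β e r) = Fintype.card (loops (timedConfig β e r)) := by
  rw [numLoops, ← Nat.card_coe_set_eq, Nat.card_eq_fintype_card]

include hg in
open Classical in
theorem card_histories {ε : V → ℤˣ} (hε : ∀ x y, G.Adj x y → ε y = -ε x) (n : ℕ) :
    Fintype.card {s : Fin (k + 1) → V → Fin n //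
      ∀ i, (linkLadder e).LevelCompat i (s i) (s ((linkLadder e).next i))} =
      n ^ numLoops (timedConfig β e r) := by
  have := finite_loops e hg
  have := Fintype.ofFinite (loops (timedConfig β e r))
  rw [Fintype.card_congr ((linkLadder e).spinEquiv (isSublattice_linkLadder e hε) n),
    card_colourings (linkLadder e).reversible (loopIndex e hg), numLoops_eq_card]

omit [Fintype V] [DecidableEq V] in
theorem locate_zero_one (x : V) : locate r hg (x, 0, 1) = (x, 0, 1) := by
  have h := locate_eq hg (x := x) (inSlot_grid_one hg 0)
  rw [grid_zero] at h
  exact h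

include hg in
omit [Fintype V] in
theorem connPlus_iff (x y : V) : ConnPlus (timedConfig β e r) x y ↔
    (linkLadder e).step.SameCycle (x, 0, 1) (y, 0, 1) := by
  rw [ConnPlus, sameTrajectory_iff e hg, locate_zero_one, locate_zero_one]

include hg in
omit [Fintype V] in
theorem connMinus_iff (x y : V) : ConnMinus (timedConfig β e r) x y ↔
    (linkLadder e).step.SameCycle (x, 0, 1) (flip (y, 0, 1)) := by
  have h := locate_eq hg (x := y) (inSlot_grid_neg_one hg (-1))
  rw [neg_add_cancel, grid_zero] at h
  have hlast : slot k (-1) = Fin.last k := by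
    have := slot_add_mul (k := k) (-1) 1
    rw [← this, ← slot_natCast (Fin.last k)]
    congr 1
    simp
  have hs : (linkLadder e).step.SameCycle (y, slot k (-1), -1) (y, slot k (-1 + 1), -1) :=
    sameCycle_slot_succ e (by rw [hlast]; exact linkLadder_swap_last e y) (-1)
  rw [ConnMinus, sameTrajectory_iff e hg, locate_zero_one]
  change (linkLadder e).step.SameCycle (x, 0, 1)
    (locate r hg (y, ((0 : ℝ) : AddCircle (2 * β)), -1)) ↔ _
  rw [h]
  exact ⟨fun h' => h'.trans hs, fun h' => h'.trans hs.symm⟩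

include hg in
open Classical in
theorem sum_histories_mul {ε : V → ℤˣ} (hε : ∀ x y, G.Adj x y → ε y = -ε x) (n : ℕ) (x y : V) :
    ∑ s : {s : Fin (k + 1) → V → Fin n //
      ∀ i, (linkLadder e).LevelCompat i (s i) (s ((linkLadder e).next i))},
      (((ε x : ℤ) : ℝ) * spinValue n (s.1 0 x)) * (((ε y : ℤ) : ℝ) * spinValue n (s.1 0 y)) =
      ((n : ℝ) ^ 2 - 1) / 12 * (n : ℝ) ^ numLoops (timedConfig β e r) *
        connSign (timedConfig β e r) x y := by
  have := finite_loops e hg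
  have := Fintype.ofFinite (loops (timedConfig β e r))
  have h := sum_colourings_mul (linkLadder e).reversible (loopIndex e hg) n
    ((x, 0, 1) : V × Fin (k + 1) × ℤˣ) (y, 0, 1)
  rw [← Equiv.sum_comp ((linkLadder e).spinEquiv (isSublattice_linkLadder e hε) n)] at h
  have h2 : ∀ (s : {s : Fin (k + 1) → V → Fin n //
      ∀ i, (linkLadder e).LevelCompat i (s i) (s ((linkLadder e).next i))}) (z : V),
      ((linkLadder e).spinEquiv (isSublattice_linkLadder e hε) n s).1 (z, 0, 1) =
        twist (ε z) (s.1 0 z) := by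
    intro s z
    change twist (ε z * 1) (s.1 0 z) = _
    rw [mul_one]
  simp only [h2, spinValue_twist] at h
  rw [h, numLoops_eq_card, connSign]
  simp only [connPlus_iff e hg, connMinus_iff e hg]
  congr!

end Weights

/-! ### The loop representation -/

section Representation

open Ladder

variable {V : Type*} [Fintype V] [DecidableEq V] {G : SimpleGraph V} {β : ℝ} [Fact (0 < 2 * β)]
  {n : ℕ}

/-- The sign of a sublattice. -/
def coloringSign (c : G.Coloring Bool) (x : V) : ℤˣ := if c x = true then -1 else 1

omit [Fintype V] [DecidableEq V] in
theorem coloringSign_adj (c : G.Coloring Bool) (x y : V) (h : G.Adj x y) :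
    coloringSign c y = -coloringSign c x := by
  have := c.valid h
  unfold coloringSign
  cases hx : c x <;> cases hy : c y <;> simp_all

theorem transformedSpin_two_eq (c : G.Coloring Bool) (x : V) :
    transformedSpin c n 2 x = Matrix.diagonal fun σ : V → Fin n =>
      ((((coloringSign c x : ℤ) : ℝ) * spinValue n (σ x) : ℝ) : ℂ) := by
  have h : spin n 2 = Matrix.diagonal fun j => ((spinValue n j : ℝ) : ℂ) := rfl
  rw [transformedSpin_eq, h, siteOp_diagonal, ← Matrix.diagonal_smul]
  congr 1
  funext σ
  unfold sublatticeSign flipSign coloringSign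
  split_ifs with h1 h2
  · exact absurd h2 (by decide)
  · simp
  · simp

/-- The signs `sg` of loops account for the parity signs of the crosses and for the sign `η` of the
interaction `-η (V ⊗ V) T`. -/
def SignRule (G : SimpleGraph V) (β : ℝ) (n : ℕ) (η : ℤˣ) (sg : Loop G β → ℤˣ) : Prop :=
  ∀ (k : ℕ) (e : Fin k → G.edgeSet × Mark) (r : Fin k → ℝ), StrictMono r →
    (∀ j, r j ∈ Set.Ioo 0 (2 * β)) → ∀ s : Fin (k + 1) → V → Fin n,
    (∀ i, (linkLadder e).LevelCompat i (s i) (s ((linkLadder e).next i))) →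
    (((η ^ numMark Mark.cross (timedConfig β e r) *
      ∏ t : Fin (k + 1) × V, (if (linkLadder e).Crossing t.1 t.2 then
        paritySign (s ((linkLadder e).next t.1) t.2) else 1) : ℤˣ) : ℤ) : ℝ) =
      ∏ᶠ l ∈ loops (timedConfig β e r), (((sg l : ℤˣ) : ℤ) : ℝ)

open Classical in
/-- The trace of the ordered product of link operators of a configuration. The function `δ` of the
spin configuration at the time `0` stands for an observable. -/
theorem trace_prod_linkOp {η : ℤˣ} {sg : Loop G β → ℤˣ} (hs : SignRule G β n η sg) (u v : ℝ)
    {k : ℕ} (e : Fin k → G.edgeSet × Mark) {r : Fin k → ℝ} (hr : StrictMono r)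
    (hrT : ∀ j, r j ∈ Set.Ioo 0 (2 * β)) (δ : (V → Fin n) → ℝ) :
    (Matrix.diagonal (fun σ => (δ σ : ℂ)) *
      (List.ofFn fun j => linkOp (-(((η : ℤ) : ℂ) • crossT n)) u v (e j)).prod).trace =
    ((u ^ numMark Mark.cross (timedConfig β e r) *
      (-v / n) ^ numMark Mark.dbar (timedConfig β e r) *
      (∏ᶠ l ∈ loops (timedConfig β e r), (((sg l : ℤˣ) : ℤ) : ℝ)) *
      ∑ s : {s : Fin (k + 1) → V → Fin n //
        ∀ i, (linkLadder e).LevelCompat i (s i) (s ((linkLadder e).next i))},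
          δ (s.1 0) : ℝ) : ℂ) := by
  have hg := grid_strictMono hr Fact.out hrT
  rw [(linkLadder e).trace_eq_sum (linkLadder_next e) (linkLadder_swap_last e) _
    (fun j => (markFactor n η u v (e j).2 : ℂ)) (fun j σ τ => by rw [linkOp_apply]),
    ← Complex.ofReal_prod, prod_marks e hg, Finset.mul_sum, Finset.mul_sum, Complex.ofReal_sum]
  refine Finset.sum_congr rfl fun s _ => ?_
  rw [← hs k e r hr hrT s.1 s.2]
  simp only [markFactor, Units.val_mul, Units.val_pow_eq_pow_val]
  push_cast
  ring

/-- The weight of a configuration is the trace of the ordered product of its link operators. -/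
theorem hasLoopRepresentation_of_signRule [DecidableRel G.Adj] (hn : 2 ≤ n)
    (c0 : G.Coloring Bool) {η : ℤˣ} {sg : Loop G β → ℤˣ} (hs : SignRule G β n η sg) :
    HasLoopRepresentation G β n (-(((η : ℤ) : ℂ) • crossT n)) sg := by
  classical
  intro u v
  have hn0 : (n : ℝ) ≠ 0 := by positivity
  set Tt := -(((η : ℤ) : ℂ) • crossT n) with hTt
  set K : ℝ := Real.exp (2 * β * (1 + u) * (Nat.card G.edgeSet : ℝ)) with hK
  have hexp : boltzmann G Tt β u v =
      NormedSpace.exp (((2 * β : ℝ) : ℂ) • ∑ l : G.edgeSet × Mark, linkOp Tt u v l) :=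
    boltzmann_eq (swapInvariant_crossT.smul _).neg β u v
  have hcomm : ∀ i, Commute (pairSpin n i) Tt := fun i =>
    ((pairSpin_commute_crossT n i).smul_right _).neg_right
  have hweight : ∀ ω : Config G β, K * loopWeight n u v sg ω = u ^ numMark Mark.cross ω *
      (-v / n) ^ numMark Mark.dbar ω * (∏ᶠ l ∈ loops ω, (((sg l : ℤˣ) : ℤ) : ℝ)) *
      (n : ℝ) ^ numLoops ω := by
    intro ω
    have h1 : K * Real.exp (-((1 + u) * (2 * β) * (Nat.card G.edgeSet : ℝ))) = 1 := by
      rw [hK, ← Real.exp_add, ← Real.exp_zero]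
      congr 1; ring
    rw [loopWeight, rhoDensity, zpow_sub₀ hn0, zpow_natCast, zpow_natCast, div_pow]
    linear_combination (u ^ numMark Mark.cross ω * (-v) ^ numMark Mark.dbar ω *
      ((n : ℝ) ^ numLoops ω / (n : ℝ) ^ numMark Mark.dbar ω) *
      (∏ᶠ l ∈ loops ω, (((sg l : ℤˣ) : ℤ) : ℝ))) * h1
  have hint : ∀ {a : ℝ} (_ : a ≠ 0) {f : Enumerated G β → ℝ},
      Integrable (fun p => a * f p) (configMeasure G β) → Integrable f (configMeasure G β) :=
    fun ha _ h => (integrable_const_mul_iff (isUnit_iff_ne_zero.2 ha) _).1 h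
  have hK0 : K ≠ 0 := (Real.exp_pos _).ne'
  have hn1 : ((n : ℝ) ^ 2 - 1) / 12 ≠ 0 := by
    have : (2 : ℝ) ≤ n := by exact_mod_cast hn
    have : 0 < ((n : ℝ) ^ 2 - 1) / 12 := by nlinarith
    exact this.ne'
  refine ⟨?_, fun x y => ?_⟩
  · obtain ⟨h1, h2⟩ := integral_configMeasure_eq_trace (fun l => linkOp Tt u v l) 1
      (fun ω : Config G β => K * loopWeight n u v sg ω) (fun k e r hr hrT => by
        have hg := grid_strictMono hr Fact.out hrT
        have h := trace_prod_linkOp hs u v e hr hrT fun _ => 1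
        rw [Complex.ofReal_one, Matrix.diagonal_one] at h
        rw [h, hweight, Finset.sum_const, nsmul_one, Finset.card_univ,
          card_histories e hg (coloringSign_adj c0), Nat.cast_pow])
    refine ⟨hint hK0 h1, ?_⟩
    rw [hexp, ← one_mul (NormedSpace.exp _), ← h2, integral_const_mul]
  · have key : ∀ c : G.Coloring Bool,
        Integrable (fun p : Enumerated G β => ((n : ℝ) ^ 2 - 1) / 12 * K *
          (loopWeight n u v sg p.config * connSign p.config x y)) (configMeasure G β) ∧
        ((∫ p : Enumerated G β, ((n : ℝ) ^ 2 - 1) / 12 * K *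
          (loopWeight n u v sg p.config * connSign p.config x y) ∂(configMeasure G β) : ℝ) : ℂ) =
          (transformedSpin c n 2 x * transformedSpin c n 2 y * boltzmann G Tt β u v).trace := by
      intro c
      rw [transformedSpin_two_eq, transformedSpin_two_eq, Matrix.diagonal_mul_diagonal, hexp]
      refine integral_configMeasure_eq_trace (fun l => linkOp Tt u v l) _
        (fun ω : Config G β => ((n : ℝ) ^ 2 - 1) / 12 * K *
          (loopWeight n u v sg ω * connSign ω x y)) (fun k e r hr hrT => ?_)
      have hg := grid_strictMono hr Fact.out hrT
      have h := trace_prod_linkOp hs u v e hr hrT fun σ =>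
        (((coloringSign c x : ℤ) : ℝ) * spinValue n (σ x)) *
          (((coloringSign c y : ℤ) : ℝ) * spinValue n (σ y))
      rw [sum_histories_mul e hg (coloringSign_adj c)] at h
      simp only [Complex.ofReal_mul (((coloringSign c x : ℤ) : ℝ) * _)] at h
      rw [h]
      congr 1
      linear_combination ((n : ℝ) ^ 2 - 1) / 12 * connSign (timedConfig β e r) x y *
        hweight (timedConfig β e r)
    refine ⟨hint (mul_ne_zero hn1 hK0) (key c0).1, fun c i => ?_⟩
    have h : Matrix.trace
        (transformedSpin c n i x * transformedSpin c n i y * boltzmann G Tt β u v) =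
          ((((n : ℝ) ^ 2 - 1) / 12 * K *
            ∫ p, loopWeight n u v sg p.config * connSign p.config x y
              ∂(configMeasure G β) : ℝ) : ℂ) := by
      rw [trace_transformedSpin_eq c hcomm, ← (key c).2, integral_const_mul]
    refine ⟨h, ?_⟩
    rw [trace_spin_eq c, h]
    split_ifs <;> push_cast <;> ring

/-- For even `n` the sign of a loop is the product of the sublattice signs of the sites at which it
arrives from crosses. -/
theorem signRule_even (hn : Even n) {ε : V → ℤˣ} (hε : ∀ x y, G.Adj x y → ε y = -ε x) :
    SignRule G β n 1 (loopSign fun z _ => ε z) := by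
  intro k e r hr hrT s hs
  have hg := grid_strictMono hr Fact.out hrT
  have := finite_loops e hg
  have := Fintype.ofFinite (loops (timedConfig β e r))
  rw [one_pow, one_mul,
    prod_paritySign_even _ hn (isSublattice_linkLadder e hε) (loopIndex e hg) hs,
    prod_loopSign hε (η := -1) (fun x y h d => by rw [hε x y h, neg_one_mul]) e hr hrT hg]

/-- Each cross has a leg on either sublattice. -/
theorem prod_sublattice_eq {ε : V → ℤˣ} (hε : ∀ x y, G.Adj x y → ε y = -ε x) {k : ℕ}
    (e : Fin k → G.edgeSet × Mark) :
    ∏ t : Fin (k + 1) × V, (if (linkLadder e).Crossing t.1 t.2 then ε t.2 else 1) =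
      ∏ j, if (e j).2 = Mark.cross then -1 else 1 := by
  rw [Fintype.prod_prod_type, Fin.prod_univ_castSucc]
  rw [Finset.prod_eq_one (fun x _ => if_neg (not_crossing_last e x)), mul_one]
  refine Finset.prod_congr rfl fun j _ => ?_
  simp only [crossing_castSucc_iff]
  split_ifs with hm
  · have hj := (e j).1.2
    obtain ⟨⟨x, y⟩, hxy⟩ := Quot.exists_rep ((e j).1 : Sym2 V)
    have hxy : ((e j).1 : Sym2 V) = s(x, y) := hxy.symm
    rw [hxy] at hj
    have hadj : G.Adj x y := hj
    rw [← Finset.prod_filter]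
    have : (Finset.univ.filter fun z => (e j).2 = Mark.cross ∧ z ∈ ((e j).1 : Sym2 V)) =
        {x, y} := by
      ext z; simp [hm, hxy]
    rw [this, Finset.prod_pair hadj.ne, hε x y hadj, mul_neg, Int.units_mul_self]
  · simp [hm]

/-- For odd `n` and the interaction `(V ⊗ V) T` the sign of a loop is the product over its passages
through crosses of the sublattice sign of the site of arrival times the direction of time. -/
theorem signRule_odd (hn : Odd n) {ε : V → ℤˣ} (hε : ∀ x y, G.Adj x y → ε y = -ε x) :
    SignRule G β n (-1) (loopSign fun z d => ε z * d) := by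
  intro k e r hr hrT s hs
  have hg := grid_strictMono hr Fact.out hrT
  have := finite_loops e hg
  have := Fintype.ofFinite (loops (timedConfig β e r))
  have h := prod_marks e hg fun m => if m = Mark.cross then (-1 : ℤˣ) else 1
  rw [← prod_sublattice_eq hε e, prod_sublattice _ (isSublattice_linkLadder e hε) (loopIndex e hg),
    if_pos rfl, if_neg (by decide), one_pow, mul_one] at h
  rw [prod_paritySign_odd _ hn (isSublattice_linkLadder e hε) (loopIndex e hg) hs, mul_one, ← h,
    prod_loopSign hε (η := 1) (fun x y h d => by rw [hε x y h, neg_mul_neg, one_mul]) e hr hrT hg]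

theorem signRule_odd_one (hn : Odd n) {ε : V → ℤˣ} (hε : ∀ x y, G.Adj x y → ε y = -ε x) :
    SignRule G β n 1 (fun _ => 1) := by
  intro k e r hr hrT s hs
  have hg := grid_strictMono hr Fact.out hrT
  have := finite_loops e hg
  have := Fintype.ofFinite (loops (timedConfig β e r))
  rw [prod_paritySign_odd _ hn (isSublattice_linkLadder e hε) (loopIndex e hg) hs]
  simp

end Representation

end SpinLoop

end

theorem propositionA2 {V : Type*} [Fintype V] [DecidableEq V] (G : SimpleGraph V)
    [DecidableRel G.Adj] (hG : G.IsBipartite) (β : ℝ) [Fact (0 < 2 * β)] :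
    (∃ s : SpinLoop.Loop G β → ℤˣ, ∀ n : ℕ, 2 ≤ n → Even n →
      SpinLoop.transformedT n = SpinLoop.minusVVT n ∧
      SpinLoop.HasLoopRepresentation G β n (SpinLoop.transformedT n) s) ∧
    (∃ s : SpinLoop.Loop G β → ℤˣ, ∀ n : ℕ, 2 ≤ n → Odd n →
      SpinLoop.HasLoopRepresentation G β n (SpinLoop.transformedT n) s) ∧
    (∀ n : ℕ, 2 ≤ n → Odd n →
      SpinLoop.HasLoopRepresentation G β n (SpinLoop.minusVVT n) (fun _ => 1)) := by
  obtain ⟨c⟩ := hG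
  have c0 : G.Coloring Bool := G.recolorOfEquiv finTwoEquiv c
  have hε := SpinLoop.coloringSign_adj c0
  refine ⟨⟨SpinLoop.loopSign fun z _ => SpinLoop.coloringSign c0 z, fun n hn he => ?_⟩,
    ⟨SpinLoop.loopSign fun z d => SpinLoop.coloringSign c0 z * d, fun n hn ho => ?_⟩,
    fun n hn ho => ?_⟩
  · have h1 : SpinLoop.transformedT n = -((((1 : ℤˣ) : ℤ) : ℂ) • SpinLoop.crossT n) := by
      rw [SpinLoop.transformedT_eq, he.add_one.neg_one_pow]; simp
    refine ⟨by rw [h1, SpinLoop.minusVVT_eq]; simp, ?_⟩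
    rw [h1]
    exact SpinLoop.hasLoopRepresentation_of_signRule hn c0 (SpinLoop.signRule_even he hε)
  · have h1 : SpinLoop.transformedT n = -((((-1 : ℤˣ) : ℤ) : ℂ) • SpinLoop.crossT n) := by
      rw [SpinLoop.transformedT_eq, ho.add_one.neg_one_pow]; simp
    rw [h1]
    exact SpinLoop.hasLoopRepresentation_of_signRule hn c0 (SpinLoop.signRule_odd ho hε)
  · have h1 : SpinLoop.minusVVT n = -((((1 : ℤˣ) : ℤ) : ℂ) • SpinLoop.crossT n) := by
      rw [SpinLoop.minusVVT_eq]; simp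
    rw [h1]
    exact SpinLoop.hasLoopRepresentation_of_signRule hn c0 (SpinLoop.signRule_odd_one ho hε)
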